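/- **Valued digraphs.** A valued digraph $\mathcal G=(G,\theta)$ is a simple acyclic digraph $G=(V,E)$ with a valuation $\theta:V\to\mathbb N$ such that $\theta(x)\le d^+(x)$ for all $x$, where $d^+(x)\in\mathbb N\cup\{\infty\}$ is the out-degree. A vertex $x$ is erasable if $\theta(x)=0$ and $\theta(z)\neq0$ for every arc $(z,x)$. A peeling step removes an erasable vertex $x$ and decreases $\theta(z)$ by $1$ for every arc $(z,x)$; a peeling sequence $[x_1,x_2,\dots]$ records the vertices successively removed until no vertex is erasable (or for ever). $IS(\mathcal G)$ is the set consisting of $\emptyset$ and of all sets $\{x_1,\dots,x_k\}$, for all peeling sequences of $\mathcal G$. Below, each digraph is given by its set of boxes $V$ and a hook $H(\mathfrak c)$ for each box $\mathfrak c$, with an arc $(\mathfrak c,\mathfrak d)$ whenever $\mathfrak c\ne\mathfrak d$ and $\mathfrak d\in H(\mathfrak c)\cap V$. **Weak order.** For a group $W$ with its set $S$ of Coxeter generators and length $\ell$, $w\le_R t$ means that $t=ws_1\cdots s_k$ with $s_i\in S$ and $\ell(t)=\ell(w)+k$. Write $[n]=\{1,\dots,n\}$ and $[\pm n]=\{-n,\dots,-1,1,\dots,n\}$.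 **Theorem.** The following are valued digraphs, and the following statements hold. 1. (*Type $A_{n-1}=S_n$, $n\ge0$, generated by the transpositions of $i$ and $i+1$, $1\le i\le n-1$.*) Let $V=\{(a,b)\in[n]^2: a<b\}$, $H(a,b)=\{(a,b)\}\cup\{(a,k),(k,b): a<k<b\}$ and $\theta=d^+/2$; denote the valued digraph by $\mathcal A$. Put $\mathrm{Inv}(\sigma)=\{(a,b)\in[n]^2: a<b,\ \sigma^{-1}(a)>\sigma^{-1}(b)\}$. Then $IS(\mathcal A)=\{\mathrm{Inv}(\sigma):\sigma\in S_n\}$, and $\sigma\mapsto\mathrm{Inv}(\sigma)$ is an isomorphism of posets $(S_n,\le_R)\cong(IS(\mathcal A),\subseteq)$. 2. (*Type $B_n$, $n\ge0$: the group of bijections $\omega$ of $[\pm n]$ with $\omega(-m)=-\omega(m)$, generated by $s_0$, exchanging $1$ and $-1$ (if $n\geq 1$), and $s_i$, exchanging $i$ and $i+1$ and also $-i$ and $-i-1$, $1\le i\le n-1$.*) Let $V=\{(a,b)\in[\pm n]^2: a<b,\ |a|\le b\}$, $H(a,b)=\{(a,b)\}\cup\{(k,b),(a,k),(-k,-a):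 k\in[\pm n],\ a<k<b\}$ and $\theta=d^+/2$; denote the valued digraph by $\mathcal B$. Put $\mathrm{Inv}_B(\omega)=\{(a,b)\in[\pm n]^2: a<b,\ |a|\le b,\ \omega^{-1}(a)>\omega^{-1}(b)\}$. Then $IS(\mathcal B)=\{\mathrm{Inv}_B(\omega):\omega\in B_n\}$, and $\omega\mapsto\mathrm{Inv}_B(\omega)$ is an isomorphism of posets $(B_n,\le_R)\cong(IS(\mathcal B),\subseteq)$. 3. (*Type $\widetilde A_n$, $n\ge3$: the group of bijections $\sigma$ of $\mathbb Z$ with $\sigma(q+kn)=\sigma(q)+kn$ for all $q,k\in\mathbb Z$ and $\sigma(1)+\dots+\sigma(n)=n(n+1)/2$, generated by $s_1,\dots,s_n$, where $s_i$ exchanges $i+kn$ and $i+1+kn$ for all $k\in\mathbb Z$.*) Let $V=\{(a,b)\in\mathbb Z^2: 1\le a\le n,\ a<b,\ b\not\equiv a \pmod n\}$, $H(a,b)=\{(a,k): a<k<b\}\cup\{(k-jn,b-jn): a<k<b,\ j\in\mathbb N\}$ and $\theta(a,b)=|\{(a,k)\in V: a<k<b\}|$; denote the valued digraph by $\widetilde{\mathcal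 A}$. Put $\mathrm{Inv}_{\widetilde A}(\sigma)=\{(a,b): 1\le a\le n,\ a<b,\ \sigma^{-1}(a)>\sigma^{-1}(b)\}$. Then $IS(\widetilde{\mathcal A})=\{\mathrm{Inv}_{\widetilde A}(\sigma):\sigma\in\widetilde A_n\}$, and $\sigma\mapsto\mathrm{Inv}_{\widetilde A}(\sigma)$ is an isomorphism of posets $(\widetilde A_n,\le_R)\cong(IS(\widetilde{\mathcal A}),\subseteq)$. 4. (*Flag weak order, $r\ge1$, $n\ge0$.*) Let $\mathbb Z_r\wr S_n$ be the group of pairs $\pi=((c_1,\dots,c_n),\sigma)$, $c_i\in\mathbb Z_r$, $\sigma\in S_n$, with product $(c,\sigma)(d,\omega)=((c_{\omega(i)}+d_i)_i,\sigma\omega)$. Let $\mathrm{finv}(\pi)=r\,|\mathrm{Inv}(\sigma)|+\sum_i c_i$, with colors represented in $\{0,\dots,r-1\}$. Let $\delta_i$ be the color vector with $1$ at position $i$ and $0$ elsewhere, $a_i=(\delta_i,s_i)$ for $1\le i\le n-1$, where $s_i$ is the transposition of $i$ and $i+1$, and $b_i=(\delta_i,\mathrm{Id})$ for $1\le i\le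 n$. The flag weak order $\le_f$ is the reflexive transitive closure of the relation "$\tau=\pi s$ for some $s\in\{a_i\}\cup\{b_i\}$, and $\mathrm{finv}(\pi)<\mathrm{finv}(\tau)$". Let $V=V_A\cup V_B$ with $V_A=\{(a,b)\in[n]^2: a<b\}$ and $V_B=\{(a,b)\in\mathbb Z\times[n]: -b(r-1)\le a\le-1\}$; let $H(a,b)=\{(a,k),(k,b): a<k<b\}$ and $\theta(a,b)=b-a-1$ for $(a,b)\in V_A$, and $H(a,b)=\{(x,b): x>a\}$ and $\theta(a,b)=b+\lfloor a/(r-1)\rfloor$ for $(a,b)\in V_B$. Denote the valued digraph by $\mathcal G(r,n)$. Then $(\mathbb Z_r\wr S_n,\le_f)\cong(IS(\mathcal G(r,n)),\subseteq)$. 5. (*Finite posets.*) Let $P$ be a finite poset and let $G$ be the digraph with vertex set $P$ and an arc $(x,y)$ whenever $x\ne y$ and $x\le y$. With $\theta=0$, $(IS(G,\theta),\subseteq)$ is isomorphic to the poset of down-sets of $P$ ordered by inclusion. With $\theta=d^+$, it is isomorphic to the poset of up-sets of $P$ ordered by inclusion. -/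

import Mathlib

/-! ### Valued digraphs and the peeling process -/

/-- A valued digraph: a simple acyclic digraph `(verts, Arc)`, with vertices in an ambient type
`α`, together with an out-degree compatible valuation `val`, that is `0 ≤ val x ≤ d⁺(x)` for every
vertex `x` (the out-degree may be infinite). Values of `val` outside `verts` are irrelevant. -/
structure ValuedDigraph (α : Type*) where
  verts : Set α
  Arc : α → α → Prop
  mem_left : ∀ x y, Arc x y → x ∈ verts
  mem_right : ∀ x y, Arc x y → y ∈ verts
  acyclic : ∀ x, ¬ Relation.TransGen Arc x x
  val : α → ℕ
  val_le : ∀ x ∈ verts, (val x : ℕ∞) ≤ {y | Arc x y}.encard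

namespace ValuedDigraph

/-- A vertex is erasable if its value is `0` and every vertex with an arc to it has a
nonzero value. -/
def Erasable {α : Type*} (G : ValuedDigraph α) (x : α) : Prop :=
  x ∈ G.verts ∧ G.val x = 0 ∧ ∀ z, G.Arc z x → G.val z ≠ 0

open Classical in
/-- One step of the peeling process: remove an erasable vertex `x` with all its arcs, and
decrease by one the value of every vertex having an arc to `x`. -/
noncomputable def erase {α : Type*} (G : ValuedDigraph α) (x : α) (hx : G.Erasable x) :
    ValuedDigraph α where
  verts := G.verts \ {x}
  Arc y z := G.Arc y z ∧ y ≠ x ∧ z ≠ x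
  mem_left y z h := ⟨G.mem_left y z h.1, h.2.1⟩
  mem_right y z h := ⟨G.mem_right y z h.1, h.2.2⟩
  acyclic y h := G.acyclic y (Relation.TransGen.mono (fun _ _ h => h.1) y y h)
  val y := if G.Arc y x then G.val y - 1 else G.val y
  val_le y hy := by
    have hset : {z | G.Arc y z ∧ y ≠ x ∧ z ≠ x} = {z | G.Arc y z} \ {x} := by
      ext z
      have : y ≠ x := hy.2
      simp [this]
    rw [hset]
    have h1 := G.val_le y hy.1
    split_ifs with h
    · have h2 : ({z | G.Arc y z} \ {x}).encard + 1 = {z | G.Arc y z}.encard :=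
        Set.encard_sdiff_singleton_add_one h
      have h3 : G.val y ≠ 0 := hx.2.2 y h
      obtain ⟨m, hm⟩ := Nat.exists_eq_succ_of_ne_zero h3
      rw [← h2, hm] at h1
      rw [hm]
      push_cast at h1 ⊢
      simpa using h1
    · rw [Set.sdiff_singleton_eq_self (by simpa using h)]
      exact h1

/-- `G.IsPeeling [x₁, …, xₖ]`: the vertices `x₁, …, xₖ` can be chosen, in this order, in the first
`k` steps of the peeling process started at `G`. As every such choice can be continued until the
process stops (or for ever), these are exactly the finite prefixes of the peeling sequences. -/
inductive IsPeeling {α : Type*} : ValuedDigraph α → List α → Prop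
  | nil (G : ValuedDigraph α) : IsPeeling G []
  | cons (G : ValuedDigraph α) (x : α) (hx : G.Erasable x) (l : List α)
      (hl : IsPeeling (G.erase x hx) l) : IsPeeling G (x :: l)

/-- The set `IS(G)` of the initial sections `∅` and `{x₁, …, xₖ}` of all peeling sequences. -/
def IS {α : Type*} (G : ValuedDigraph α) : Set (Set α) :=
  {A | ∃ l : List α, G.IsPeeling l ∧ A = {x | x ∈ l}}

/-- Inclusion of initial sections: the order relation of the poset `(IS(G), ⊆)`. -/
def isLE {α : Type*} (G : ValuedDigraph α) (A B : G.IS) : Prop := (A : Set α) ⊆ (B : Set α)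

theorem acyclic_of_decreasing {α : Type*} {r : α → α → Prop} (f : α → ℕ)
    (hf : ∀ x y, r x y → f y < f x) (x : α) : ¬ Relation.TransGen r x x := by
  intro h
  have key : ∀ y z, Relation.TransGen r y z → f z < f y := by
    intro y z h
    induction h with
    | single h => exact hf _ _ h
    | tail _ h ih => exact (hf _ _ h).trans ih
  exact lt_irrefl _ (key x x h)

theorem ncard_le_encard {α : Type*} (s : Set α) : (s.ncard : ℕ∞) ≤ s.encard :=
  ENat.natCast_toNat_le_self _

theorem half_ncard_le_encard {α : Type*} (s : Set α) : ((s.ncard / 2 : ℕ) : ℕ∞) ≤ s.encard :=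
  le_trans (by exact_mod_cast Nat.div_le_self _ _) (ncard_le_encard s)

end ValuedDigraph

/-- The arcs of a digraph of hook type on a diagram `V`: there is an arc from `c` to `d` if and
only if `c ≠ d` and `d` lies in the hook `H c` based on `c`. -/
def HookArc {α : Type*} (V : Set α) (H : α → Set α) (c d : α) : Prop :=
  c ∈ V ∧ d ∈ V ∧ c ≠ d ∧ d ∈ H c

/-! ### The weak order of a group with a set of generators -/

/-- The length of `w` with respect to the generating set `S` of involutions: the smallest length
of a word in `S` with product `w`. -/
noncomputable def genLength {W : Type*} [Group W] (S : Set W) (w : W) : ℕ :=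
  sInf {k | ∃ l : List W, (∀ s ∈ l, s ∈ S) ∧ l.prod = w ∧ l.length = k}

/-- The right weak order: `w ≤ t` if and only if `t = w s₁ ⋯ sₖ` with `sᵢ ∈ S` and
`ℓ(t) = ℓ(w) + k`. -/
def WeakLE {W : Type*} [Group W] (S : Set W) (w t : W) : Prop :=
  ∃ l : List W, (∀ s ∈ l, s ∈ S) ∧ t = w * l.prod ∧ genLength S t = genLength S w + l.length

/-! ### Type `A` -/

/-- The simple transpositions of the symmetric group; here `[n]` is relabelled
increasingly as `Fin n`. -/
def simpleA (n : ℕ) : Set (Equiv.Perm (Fin n)) :=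
  {s | ∃ i j : Fin n, (i : ℕ) + 1 = j ∧ s = Equiv.swap i j}

/-- The staircase diagram. -/
def boxesA (n : ℕ) : Set (Fin n × Fin n) := {c | c.1 < c.2}

/-- The hook based on a box of the staircase diagram. -/
def hookA {n : ℕ} (c : Fin n × Fin n) : Set (Fin n × Fin n) :=
  {c} ∪ {d | ∃ k, c.1 < k ∧ k < c.2 ∧ (d = (c.1, k) ∨ d = (k, c.2))}

/-- The valued digraph on the staircase diagram, with `θ(c) = d⁺(c) / 2`. -/
noncomputable def digraphA (n : ℕ) : ValuedDigraph (Fin n × Fin n) where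
  verts := boxesA n
  Arc := HookArc (boxesA n) hookA
  mem_left _ _ h := h.1
  mem_right _ _ h := h.2.1
  acyclic := by
    refine ValuedDigraph.acyclic_of_decreasing (fun c => (c.2 : ℕ) - (c.1 : ℕ)) ?_
    rintro ⟨a, b⟩ d ⟨h1, h2, h3, h4⟩
    rcases h4 with h4 | ⟨k, hk1, hk2, rfl | rfl⟩
    · exact absurd h4.symm h3
    · simp only [Fin.lt_def] at hk1 hk2 ⊢
      omega
    · simp only [Fin.lt_def] at hk1 hk2 ⊢
      omega
  val c := {d | HookArc (boxesA n) hookA c d}.ncard / 2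
  val_le _ _ := ValuedDigraph.half_ncard_le_encard _

/-- The inversion set of a permutation. -/
def invA {n : ℕ} (σ : Equiv.Perm (Fin n)) : Set (Fin n × Fin n) :=
  {c | c.1 < c.2 ∧ σ⁻¹ c.2 < σ⁻¹ c.1}

theorem perm_apply_inv {α : Type*} (σ : Equiv.Perm α) (x : α) : σ (σ⁻¹ x) = x :=
  σ.apply_symm_apply x

/-! ### Type `B` -/

/-- The set `[±n] = {-n, …, -1, 1, …, n}`. -/
abbrev SignedIdx (n : ℕ) : Type := {m : ℤ // m ≠ 0 ∧ |m| ≤ (n : ℤ)}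

/-- The map `m ↦ -m` on `[±n]`. -/
def SignedIdx.neg {n : ℕ} (m : SignedIdx n) : SignedIdx n :=
  ⟨-m.1, neg_ne_zero.mpr m.2.1, by rw [abs_neg]; exact m.2.2⟩

/-- The group `Bₙ` of the signed permutations of `[±n]`. -/
def SignedPerm (n : ℕ) : Subgroup (Equiv.Perm (SignedIdx n)) where
  carrier := {ω | ∀ m, ω m.neg = (ω m).neg}
  one_mem' _ := rfl
  mul_mem' {ω τ} hω hτ m := by
    simp only [Equiv.Perm.mul_apply]
    rw [hτ m, hω (τ m)]
  inv_mem' {ω} hω m := by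
    rw [Equiv.Perm.inv_eq_iff_eq, hω, perm_apply_inv]

/-- The generators of `Bₙ`: `s₀` exchanges `1` and `-1`, and `sᵢ`, for `1 ≤ i ≤ n - 1`, exchanges
`i` and `i + 1`, and also `-i` and `-i - 1`. -/
def simpleB (n : ℕ) : Set (SignedPerm n) :=
  {s | ∃ i : SignedIdx n, i.1 = 1 ∧ s.1 = Equiv.swap i i.neg} ∪
  {s | ∃ i j : SignedIdx n, 1 ≤ i.1 ∧ j.1 = i.1 + 1 ∧
    s.1 = Equiv.swap i j * Equiv.swap i.neg j.neg}

/-- The shifted diagram of the partition `(2n-1, 2n-3, …, 1)`. -/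
def boxesB (n : ℕ) : Set (SignedIdx n × SignedIdx n) := {c | c.1 < c.2 ∧ |c.1.1| ≤ c.2.1}

/-- The shifted hook based on a box (before intersecting with the diagram). -/
def hookB {n : ℕ} (c : SignedIdx n × SignedIdx n) : Set (SignedIdx n × SignedIdx n) :=
  {c} ∪ {d | ∃ k, c.1 < k ∧ k < c.2 ∧ (d = (k, c.2) ∨ d = (c.1, k) ∨ d = (k.neg, c.1.neg))}

/-- The valued digraph on the shifted diagram, with `θ(c) = d⁺(c) / 2`. -/
noncomputable def digraphB (n : ℕ) : ValuedDigraph (SignedIdx n × SignedIdx n) where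
  verts := boxesB n
  Arc := HookArc (boxesB n) hookB
  mem_left _ _ h := h.1
  mem_right _ _ h := h.2.1
  acyclic := by
    refine ValuedDigraph.acyclic_of_decreasing (fun c => (c.2.1 - c.1.1).toNat) ?_
    rintro ⟨a, b⟩ d ⟨h1, h2, h3, h4⟩
    rcases h4 with h4 | ⟨k, hk1, hk2, rfl | rfl | rfl⟩
    · exact absurd h4.symm h3
    all_goals
      have e1 : a.1 < k.1 := hk1
      have e2 : k.1 < b.1 := hk2
      simp only [SignedIdx.neg]
      omega
  val c := {d | HookArc (boxesB n) hookB c d}.ncard / 2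
  val_le _ _ := ValuedDigraph.half_ncard_le_encard _

/-- The `B`-inversion set of a signed permutation. -/
def invB {n : ℕ} (ω : SignedPerm n) : Set (SignedIdx n × SignedIdx n) :=
  {c | c.1 < c.2 ∧ |c.1.1| ≤ c.2.1 ∧ ω.1⁻¹ c.2 < ω.1⁻¹ c.1}

/-! ### Type `Ã` -/

theorem affine_sum_comp {n : ℕ} {σ τ : Equiv.Perm ℤ}
    (hσ : ∀ q k : ℤ, σ (q + k * n) = σ q + k * n) (hτ : ∀ q k : ℤ, τ (q + k * n) = τ q + k * n) :
    ∑ i ∈ Finset.Icc (1 : ℤ) n, σ (τ i) + ∑ i ∈ Finset.Icc (1 : ℤ) n, i =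
      ∑ i ∈ Finset.Icc (1 : ℤ) n, σ i + ∑ i ∈ Finset.Icc (1 : ℤ) n, τ i := by
  rcases Nat.eq_zero_or_pos n with rfl | hn
  · simp
  have hn' : (0 : ℤ) < n := by exact_mod_cast hn
  let red : ℤ → ℤ := fun m => (m - 1) % n + 1
  have hred : ∀ m, red m = m + (-((m - 1) / n)) * n := by
    intro m
    have := Int.emod_add_mul_ediv (m - 1) n
    simp only [red]
    linarith
  have hmaps : ∀ m, red m ∈ Finset.Icc (1 : ℤ) n := by
    intro m
    have h1 := Int.emod_nonneg (m - 1) hn'.ne'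
    have h2 := Int.emod_lt_of_pos (m - 1) hn'
    simp only [Finset.mem_Icc, red]
    omega
  have hfix : ∀ m ∈ Finset.Icc (1 : ℤ) n, ∀ k : ℤ, m + k * n ∈ Finset.Icc (1 : ℤ) n →
      m + k * n = m := by
    intro m hm k hk
    rw [Finset.mem_Icc] at hm hk
    have h1 : k < 1 := by nlinarith
    have h2 : -1 < k := by nlinarith
    have : k = 0 := by omega
    simp [this]
  have hinj : Set.InjOn (fun i => red (τ i)) (Finset.Icc (1 : ℤ) n) := by
    intro i hi j hj hij
    have e : τ i = τ j + ((τ i - 1) / n - (τ j - 1) / n) * n := by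
      have e0 : red (τ i) = red (τ j) := hij
      rw [hred, hred] at e0
      linarith
    rw [← hτ] at e
    have e' := τ.injective e
    have := hfix j (by simpa using hj) ((τ i - 1) / n - (τ j - 1) / n) (by rw [← e']; simpa using hi)
    rw [e', this]
  have himg : (Finset.Icc (1 : ℤ) n).image (fun i => red (τ i)) = Finset.Icc (1 : ℤ) n := by
    refine Finset.eq_of_subset_of_card_le ?_ ?_
    · intro x hx
      obtain ⟨i, _, rfl⟩ := Finset.mem_image.mp hx
      exact hmaps _
    · rw [Finset.card_image_of_injOn hinj]
  have hsum : ∑ i ∈ Finset.Icc (1 : ℤ) n, (σ (red (τ i)) - red (τ i)) =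
      ∑ i ∈ Finset.Icc (1 : ℤ) n, (σ i - i) := by
    conv_rhs => rw [← himg]
    rw [Finset.sum_image hinj]
  have hper : ∀ m, σ (red m) - red m = σ m - m := by
    intro m
    rw [hred, hσ]
    ring
  simp only [hper, Finset.sum_sub_distrib] at hsum
  linarith

theorem sum_Icc_one (n : ℕ) : ∑ i ∈ Finset.Icc (1 : ℤ) n, i = (n : ℤ) * (n + 1) / 2 := by
  induction n with
  | zero => simp
  | succ m ih =>
    have h : Finset.Icc (1 : ℤ) ((m + 1 : ℕ) : ℤ) =
        insert ((m : ℤ) + 1) (Finset.Icc (1 : ℤ) (m : ℤ)) := by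
      ext x
      simp only [Finset.mem_Icc, Finset.mem_insert]
      push_cast
      omega
    rw [h, Finset.sum_insert (by simp), ih]
    push_cast
    have e : ((m : ℤ) + 1) * (m + 1 + 1) = m * (m + 1) + 2 * (m + 1) := by ring
    rw [e]
    omega

/-- The group `Ãₙ` of the affine permutations: bijections `σ` of `ℤ` with
`σ(q + kn) = σ(q) + kn` and `σ(1) + ⋯ + σ(n) = n(n+1)/2`. -/
def AffinePerm (n : ℕ) : Subgroup (Equiv.Perm ℤ) where
  carrier := {σ | (∀ q k : ℤ, σ (q + k * n) = σ q + k * n) ∧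
    ∑ i ∈ Finset.Icc (1 : ℤ) n, σ i = (n : ℤ) * (n + 1) / 2}
  one_mem' := ⟨fun _ _ => rfl, by simpa using sum_Icc_one n⟩
  mul_mem' {σ τ} hσ hτ := by
    refine ⟨fun q k => ?_, ?_⟩
    · simp only [Equiv.Perm.mul_apply]
      rw [hτ.1, hσ.1]
    · have h := affine_sum_comp hσ.1 hτ.1
      rw [hσ.2, hτ.2, sum_Icc_one] at h
      simp only [Equiv.Perm.mul_apply]
      linarith
  inv_mem' {σ} hσ := by
    have hp : ∀ q k : ℤ, σ⁻¹ (q + k * n) = σ⁻¹ q + k * n := by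
      intro q k
      rw [Equiv.Perm.inv_eq_iff_eq, hσ.1, perm_apply_inv]
    refine ⟨hp, ?_⟩
    have h := affine_sum_comp hσ.1 hp
    simp only [perm_apply_inv] at h
    rw [hσ.2, sum_Icc_one] at h
    linarith

/-- The generators of `Ãₙ`: `sᵢ`, for `1 ≤ i ≤ n`, exchanges `i + kn` and `i + 1 + kn` for
all `k`. -/
def simpleAffine (n : ℕ) : Set (AffinePerm n) :=
  {s | ∃ i : ℤ, 1 ≤ i ∧ i ≤ n ∧
    (∀ k : ℤ, s.1 (i + k * n) = i + 1 + k * n ∧ s.1 (i + 1 + k * n) = i + k * n) ∧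
    ∀ q : ℤ, ¬ q ≡ i [ZMOD n] → ¬ q ≡ i + 1 [ZMOD n] → s.1 q = q}

/-- The cylindrical diagram. -/
def boxesCyl (n : ℕ) : Set (ℤ × ℤ) :=
  {c | 1 ≤ c.1 ∧ c.1 ≤ n ∧ ¬ c.2 ≡ c.1 [ZMOD n] ∧ c.1 < c.2}

/-- The cylindrical hook based on `(a, b)` (before intersecting with the diagram): the boxes
`(a, k)` with `a < k < b`, and the boxes `(k, b)` with `a < k < b`, each of the latter being
translated by a multiple `(-jn, -jn)` of the period, `j ≥ 0`, into the fundamental domain. -/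
def hookCyl (n : ℕ) (c : ℤ × ℤ) : Set (ℤ × ℤ) :=
  {d | ∃ k, c.1 < k ∧ k < c.2 ∧ d = (c.1, k)} ∪
  {d | ∃ k, c.1 < k ∧ k < c.2 ∧ ∃ j : ℕ, d = (k - j * n, c.2 - j * n)}

/-- The valued digraph on the cylindrical diagram, with `θ(a, b)` the number of boxes `(a, k)` such
that `a < k < b`. -/
noncomputable def digraphCyl (n : ℕ) : ValuedDigraph (ℤ × ℤ) where
  verts := boxesCyl n
  Arc := HookArc (boxesCyl n) (hookCyl n)
  mem_left _ _ h := h.1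
  mem_right _ _ h := h.2.1
  acyclic := by
    refine ValuedDigraph.acyclic_of_decreasing (fun c => (c.2 - c.1).toNat) ?_
    rintro ⟨a, b⟩ d ⟨h1, h2, h3, h4⟩
    rcases h4 with ⟨k, hk1, hk2, rfl⟩ | ⟨k, hk1, hk2, j, rfl⟩
    · simp only at hk1 hk2 ⊢
      omega
    · simp only at hk1 hk2 ⊢
      omega
  val c := {d | d ∈ boxesCyl n ∧ ∃ k, c.1 < k ∧ k < c.2 ∧ d = (c.1, k)}.ncard
  val_le c hc := by
    refine (ValuedDigraph.ncard_le_encard _).trans (Set.encard_le_encard ?_)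
    rintro d ⟨hd, k, hk1, hk2, rfl⟩
    refine ⟨hc, hd, ?_, Or.inl ⟨k, hk1, hk2, rfl⟩⟩
    intro h
    have h' : c.2 = k := congrArg Prod.snd h
    omega

/-- The `Ã`-inversion set of an affine permutation. -/
def invAffine {n : ℕ} (σ : AffinePerm n) : Set (ℤ × ℤ) :=
  {c | 1 ≤ c.1 ∧ c.1 ≤ n ∧ c.1 < c.2 ∧ σ.1⁻¹ c.2 < σ.1⁻¹ c.1}

/-! ### The flag weak order on `ℤᵣ ≀ Sₙ` -/

/-- The `r`-colored permutations `((c₁, …, cₙ), σ)`. -/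
@[ext]
structure ColoredPerm (r n : ℕ) where
  color : Fin n → ZMod r
  perm : Equiv.Perm (Fin n)

namespace ColoredPerm

/-- The group structure of the wreath product `ℤᵣ ≀ Sₙ`:
`(c, σ) (d, ω) = ((c_{ω(i)} + d_i)_i, σ ω)`. -/
instance instGroup (r n : ℕ) : Group (ColoredPerm r n) where
  mul x y := ⟨fun i => x.color (y.perm i) + y.color i, x.perm * y.perm⟩
  one := ⟨fun _ => 0, 1⟩
  inv x := ⟨fun i => - x.color (x.perm⁻¹ i), x.perm⁻¹⟩
  mul_assoc x y z := by
    refine ColoredPerm.ext (funext fun i => ?_) (mul_assoc x.perm y.perm z.perm)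
    exact add_assoc (x.color (y.perm (z.perm i))) (y.color (z.perm i)) (z.color i)
  one_mul x := ColoredPerm.ext (funext fun i => zero_add (x.color i)) (one_mul x.perm)
  mul_one x := ColoredPerm.ext (funext fun i => add_zero (x.color i)) (mul_one x.perm)
  inv_mul_cancel x := by
    refine ColoredPerm.ext (funext fun i => ?_) (inv_mul_cancel x.perm)
    change -x.color (x.perm⁻¹ (x.perm i)) + x.color i = 0
    simp

/-- The flag inversion number `r |Inv(π)| + ∑ cᵢ`, with the colors represented in
`{0, …, r - 1}`. -/
noncomputable def finv {r n : ℕ} (x : ColoredPerm r n) : ℕ :=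
  r * (invA x.perm).ncard + ∑ i, (x.color i).val

/-- The generating set `A ∪ B`: `aᵢ = (δᵢ, sᵢ)` for `1 ≤ i ≤ n - 1` and `bᵢ = (δᵢ, Id)` for
`1 ≤ i ≤ n`, where `δᵢ` has color `1` at `i` and `0` elsewhere. -/
def flagGens (r n : ℕ) : Set (ColoredPerm r n) :=
  {s | ∃ i j : Fin n, (i : ℕ) + 1 = j ∧ s = ⟨Pi.single i 1, Equiv.swap i j⟩} ∪
  {s | ∃ i : Fin n, s = ⟨Pi.single i 1, 1⟩}

/-- The flag weak order: the reflexive transitive closure of the relation "`y = x s` for some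
`s ∈ A ∪ B` and `finv x < finv y`". -/
def FlagLE {r n : ℕ} : ColoredPerm r n → ColoredPerm r n → Prop :=
  Relation.ReflTransGen fun x y => (∃ s ∈ flagGens r n, y = x * s) ∧ finv x < finv y

end ColoredPerm

/-- The staircase part of the diagram `λ_{r,n}`. -/
def boxesFlagA (n : ℕ) : Set (ℤ × ℤ) := {c | 1 ≤ c.1 ∧ c.1 < c.2 ∧ c.2 ≤ n}

/-- The left part of the diagram `λ_{r,n}`. -/
def boxesFlagB (r n : ℕ) : Set (ℤ × ℤ) :=
  {c | 1 ≤ c.2 ∧ c.2 ≤ n ∧ -c.2 * ((r : ℤ) - 1) ≤ c.1 ∧ c.1 ≤ -1}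

/-- The hook based on a box of `λ_{r,n}` (before intersecting with the diagram). -/
def hookFlag (r n : ℕ) (c : ℤ × ℤ) : Set (ℤ × ℤ) :=
  {d | c ∈ boxesFlagA n ∧ ∃ k, c.1 < k ∧ k < c.2 ∧ (d = (c.1, k) ∨ d = (k, c.2))} ∪
  {d | c ∈ boxesFlagB r n ∧ c.1 < d.1 ∧ d.2 = c.2}

open Classical in
/-- The valuation: `b - a - 1` on the staircase part and `b + ⌊a / (r - 1)⌋` on the left part. -/
noncomputable def valFlag (n : ℕ) (r : ℕ) (c : ℤ × ℤ) : ℕ :=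
  if c ∈ boxesFlagA n then (c.2 - c.1 - 1).toNat
  else (c.2 + ⌊(c.1 : ℚ) / ((r : ℚ) - 1)⌋).toNat

/-- The valued digraph on `λ_{r,n}`. -/
noncomputable def digraphFlag (r n : ℕ) : ValuedDigraph (ℤ × ℤ) where
  verts := boxesFlagA n ∪ boxesFlagB r n
  Arc := HookArc (boxesFlagA n ∪ boxesFlagB r n) (hookFlag r n)
  mem_left _ _ h := h.1
  mem_right _ _ h := h.2.1
  acyclic := by
    refine ValuedDigraph.acyclic_of_decreasing (fun c => (c.2 - c.1).toNat) ?_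
    rintro ⟨a, b⟩ ⟨x, y⟩ ⟨h1, h2, h3, h4⟩
    have hab : a < b := by
      rcases h1 with h | h
      · exact h.2.1
      · have e1 : (1 : ℤ) ≤ b := h.1
        have e2 : a ≤ -1 := h.2.2.2
        omega
    rcases h4 with ⟨_, k, hk1, hk2, h | h⟩ | ⟨_, hk1, hk2⟩
    · simp only [Prod.mk.injEq] at hk1 hk2 h ⊢
      omega
    · simp only [Prod.mk.injEq] at hk1 hk2 h ⊢
      omega
    · simp only at hk1 hk2 ⊢
      omega
  val := valFlag n r
  val_le := by
    rintro ⟨a, b⟩ hc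
    by_cases hA : (a, b) ∈ boxesFlagA n
    · obtain ⟨h1, h2, h3⟩ := hA
      simp only at h1 h2 h3
      have hs : ((Finset.Ioo a b).image (fun k => (k, b)) : Set (ℤ × ℤ)) ⊆
          {d | HookArc (boxesFlagA n ∪ boxesFlagB r n) (hookFlag r n) (a, b) d} := by
        intro d hd
        simp only [Finset.coe_image, Finset.coe_Ioo, Set.mem_image, Set.mem_Ioo] at hd
        obtain ⟨k, ⟨hk1, hk2⟩, rfl⟩ := hd
        refine ⟨hc, Or.inl ⟨by simp only; omega, hk2, h3⟩, ?_,
          Or.inl ⟨⟨h1, h2, h3⟩, k, hk1, hk2, Or.inr rfl⟩⟩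
        intro h
        have : a = k := congrArg Prod.fst h
        omega
      refine le_trans ?_ (Set.encard_le_encard hs)
      rw [Set.encard_coe_eq_coe_finsetCard, Finset.card_image_of_injective _
        (fun x y h => congrArg Prod.fst h), Int.card_Ioo, valFlag, if_pos ⟨h1, h2, h3⟩]
    · have hB : (a, b) ∈ boxesFlagB r n := hc.resolve_left hA
      obtain ⟨h1, h2, h3, h4⟩ := hB
      simp only at h1 h2 h3 h4
      have hs : ((Finset.Ioo 0 b).image (fun k => (k, b)) : Set (ℤ × ℤ)) ⊆
          {d | HookArc (boxesFlagA n ∪ boxesFlagB r n) (hookFlag r n) (a, b) d} := by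
        intro d hd
        simp only [Finset.coe_image, Finset.coe_Ioo, Set.mem_image, Set.mem_Ioo] at hd
        obtain ⟨k, ⟨hk1, hk2⟩, rfl⟩ := hd
        refine ⟨hc, Or.inl ⟨by simp only; omega, hk2, h2⟩, ?_,
          Or.inr ⟨⟨h1, h2, h3, h4⟩, by simp only; omega, rfl⟩⟩
        intro h
        have : a = k := congrArg Prod.fst h
        omega
      refine le_trans ?_ (Set.encard_le_encard hs)
      rw [Set.encard_coe_eq_coe_finsetCard, Finset.card_image_of_injective _
        (fun x y h => congrArg Prod.fst h), Int.card_Ioo, valFlag, if_neg hA]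
      have hr : (0 : ℚ) < (r : ℚ) - 1 := by
        have : (0 : ℤ) < (r : ℤ) - 1 := by nlinarith
        exact_mod_cast this
      have ha : (a : ℚ) < 0 := by exact_mod_cast (by omega : a < 0)
      have hf : ⌊(a : ℚ) / ((r : ℚ) - 1)⌋ < 0 := by
        rw [Int.floor_lt]
        simpa using div_neg_of_neg_of_pos ha hr
      exact Nat.cast_le.mpr (Int.toNat_le_toNat (by simp only; omega))

/-! ### Down-set and up-set lattices of a finite poset -/

theorem acyclic_poset {P : Type*} [PartialOrder P] (x : P) :
    ¬ Relation.TransGen (fun x y : P => x ≠ y ∧ x ≤ y) x x := by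
  intro h
  have key : ∀ y z : P, Relation.TransGen (fun x y : P => x ≠ y ∧ x ≤ y) y z → y < z := by
    intro y z h
    induction h with
    | single h => exact lt_of_le_of_ne h.2 h.1
    | tail _ h ih => exact ih.trans (lt_of_le_of_ne h.2 h.1)
  exact lt_irrefl _ (key x x h)

/-- The digraph of the strict order relation of a poset, with valuation `0`. -/
def digraphDown (P : Type*) [PartialOrder P] : ValuedDigraph P where
  verts := Set.univ
  Arc x y := x ≠ y ∧ x ≤ y
  mem_left _ _ _ := trivial
  mem_right _ _ _ := trivial
  acyclic := acyclic_poset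
  val _ := 0
  val_le _ _ := by simp

/-- The same digraph, with valuation `d⁺`. -/
noncomputable def digraphUp (P : Type*) [PartialOrder P] : ValuedDigraph P where
  verts := Set.univ
  Arc x y := x ≠ y ∧ x ≤ y
  mem_left _ _ _ := trivial
  mem_right _ _ _ := trivial
  acyclic := acyclic_poset
  val x := {y | x ≠ y ∧ x ≤ y}.ncard
  val_le _ _ := ValuedDigraph.ncard_le_encard _

/-!
For a finite set `A` of peeled vertices, the remaining valued digraph is determined by `A`: the
value of `x` has dropped by the number of its out-neighbours in `A`. Hence `IS(G)` is the family of
sets reachable from `∅` by adding one vertex `x` such that `CanPeel A x`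
(`ValuedDigraph.mem_IS_iff`). All five statements then have the same shape
(`ValuedDigraph.IsPeelModel`): a map `e` from a set with a relation `Cov` to sets of vertices sends
`Cov` to peeling steps, lifts every peeling step, and turns inclusions into chains of `Cov`. This
gives both `IS(G) = range e` and the isomorphism of posets.

**Types `A`, `B`, `Ã`.** Each group permutes a linear order, and the boxes represent the orbits of
pairs `a < b` under a symmetry that commutes with the group; this is a `WeakOrderModel`. Two facts
carry the argument.

* Peeling from `Inv(w)` adds a box `(a, b)` if and only if `a` and `b` are adjacent in `w`, in this
  order. For `a < b` not inverted, no `k` between `a` and `b` has both `(a, k)` and `(k, b)`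
  inverted. So at most `θ(a, b)` out-neighbours lie in `Inv(w)`, and the value of the box is
  `0` if and only if no value between `a` and `b` stands between them (`IsTight`). If `(a, b)` is
  tight but something stands between `a` and `b`, for instance a value `k > b`, then the smallest
  such `k` gives a tight box `(a, k)`, which has an arc to `(a, b)` and blocks it. Conversely, a box
  with an arc to an adjacent pair is separated by one of the two entries, and so has a positive
  value. See `canPeel_of_covBy` and `covBy_of_canPeel`. In type `Ã` the value `k` must not be
  congruent to `a`; `exists_near` is where `n ≥ 3` is needed.
* If `Inv(w) ⊊ Inv(v)`, then some pair adjacent in `w` is inverted in `v` but not in `w`: take one at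
  minimal distance (`exists_covBy`). So inclusion is generated by adding single inversions, the
  length is the number of inversions, and inclusion is the weak order.

**Flag weak order.** A colored permutation is determined by its inversion set and the colors of its
entries. To it belongs the set `flagInv`, made of the inversions in the staircase and, in row `b` of
the left part, of the first `(r - 1) m_b + c_b` boxes, where `m_b` is the number of inversions
`(a, b)` and `c_b` the color of `b`. The valuation of the left part is arranged so that an inversion
`(a, b)` can be added only when `c_b = r - 1`, which resets `c_b` to `0`, and that the row can grow
by a box only while `c_b < r - 1`. These are the covers `FlagCov` of the flag weak order.
-/

/-! ### Initial sections as chains of sets -/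

namespace ValuedDigraph

/-- `x` can be peeled once the vertices of `A` have been removed: exactly `θ(x)` out-neighbours of
`x` lie in `A`, and every remaining vertex with an arc to `x` still has a positive value. -/
def CanPeel {α : Type*} (G : ValuedDigraph α) (A : Set α) (x : α) : Prop :=
  x ∈ G.verts ∧ x ∉ A ∧ ({y | G.Arc x y} ∩ A).ncard = G.val x ∧
    ∀ z, G.Arc z x → z ∉ A → ({y | G.Arc z y} ∩ A).ncard < G.val z

/-- `B` arises from `A` by one more peeling step. -/
def PeelStep {α : Type*} (G : ValuedDigraph α) (A B : Set α) : Prop :=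
  ∃ x, G.CanPeel A x ∧ B = insert x A

/-- `K` is what is left of `G` after the vertices of the finite set `A` have been peeled. The value
of a remaining vertex has gone down by the number of its out-neighbours in `A`; the equation is
stated additively, so that it also records that no value was decreased below `0`. -/
structure IsResidual {α : Type*} (G : ValuedDigraph α) (A : Set α) (K : ValuedDigraph α) :
    Prop where
  finite : A.Finite
  verts : K.verts = G.verts \ A
  arc : ∀ x y, K.Arc x y ↔ G.Arc x y ∧ x ∉ A ∧ y ∉ A
  val : ∀ x ∈ G.verts, x ∉ A → K.val x + ({y | G.Arc x y} ∩ A).ncard = G.val x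

namespace IsResidual

variable {α : Type*} {G K : ValuedDigraph α} {A : Set α}

theorem refl (G : ValuedDigraph α) : G.IsResidual ∅ G where
  finite := Set.finite_empty
  verts := by simp
  arc := by simp
  val := by simp

theorem erasable_iff (h : G.IsResidual A K) (x : α) : K.Erasable x ↔ G.CanPeel A x := by
  constructor
  · rintro ⟨hx, h0, hz⟩
    rw [h.verts] at hx
    refine ⟨hx.1, hx.2, ?_, fun z hzx hzA => ?_⟩
    · have := h.val x hx.1 hx.2
      omega
    · have h1 := hz z ((h.arc _ _).2 ⟨hzx, hzA, hx.2⟩)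
      have := h.val z (G.mem_left _ _ hzx) hzA
      omega
  · rintro ⟨hx, hxA, h0, hz⟩
    refine ⟨by rw [h.verts]; exact ⟨hx, hxA⟩, ?_, fun z hzx => ?_⟩
    · have := h.val x hx hxA
      omega
    · obtain ⟨h1, h2, -⟩ := (h.arc _ _).1 hzx
      have := h.val z (G.mem_left _ _ h1) h2
      have := hz z h1 h2
      omega

theorem erase (h : G.IsResidual A K) {x : α} (hx : K.Erasable x) :
    G.IsResidual (insert x A) (K.erase x hx) where
  finite := h.finite.insert x
  verts := by
    ext y
    simp only [ValuedDigraph.erase, h.verts, Set.mem_sdiff, Set.mem_singleton_iff,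
      Set.mem_insert_iff]
    tauto
  arc y z := by
    simp only [ValuedDigraph.erase, h.arc, Set.mem_insert_iff]
    tauto
  val y hy hyA := by
    have hxA := ((h.erasable_iff x).1 hx).2.1
    rw [Set.mem_insert_iff, not_or] at hyA
    have hv := h.val y hy hyA.2
    by_cases hyx : G.Arc y x
    · have hK : K.Arc y x := (h.arc _ _).2 ⟨hyx, hyA.2, hxA⟩
      have h0 := hx.2.2 y hK
      have e : {z | G.Arc y z} ∩ insert x A = insert x ({z | G.Arc y z} ∩ A) :=
        Set.inter_insert_of_mem hyx
      rw [e, Set.ncard_insert_of_notMem (fun h => hxA h.2) (h.finite.inter_of_right _)]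
      simp only [ValuedDigraph.erase, if_pos hK]
      omega
    · have hK : ¬ K.Arc y x := fun h' => hyx ((h.arc _ _).1 h').1
      have e : {z | G.Arc y z} ∩ insert x A = {z | G.Arc y z} ∩ A :=
        Set.inter_insert_of_notMem hyx
      rw [e]
      simpa only [ValuedDigraph.erase, if_neg hK] using hv

end IsResidual

section

variable {α : Type*} {G : ValuedDigraph α}

theorem IsPeeling.reflTransGen {K : ValuedDigraph α} {l : List α} (hl : K.IsPeeling l) :
    ∀ {A : Set α}, G.IsResidual A K →
      Relation.ReflTransGen G.PeelStep A (A ∪ {x | x ∈ l}) := by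
  induction hl with
  | nil => intro A _; simpa using Relation.ReflTransGen.refl
  | cons K x hx l _ ih =>
    intro A h
    have e : A ∪ {y | y ∈ x :: l} = insert x A ∪ {y | y ∈ l} := by
      ext y
      simp only [List.mem_cons, Set.mem_union, Set.mem_ofPred_eq, Set.mem_insert_iff]
      tauto
    rw [e]
    exact (ih (h.erase hx)).head ⟨x, (h.erasable_iff x).1 hx, rfl⟩

theorem exists_isPeeling {A B : Set α} (h : Relation.ReflTransGen G.PeelStep A B) :
    ∀ {K : ValuedDigraph α}, G.IsResidual A K →
      ∃ l, K.IsPeeling l ∧ B = A ∪ {x | x ∈ l} := by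
  induction h using Relation.ReflTransGen.head_induction_on with
  | refl => exact fun {K} _ => ⟨[], .nil K, by simp⟩
  | head hstep _ ih =>
    intro K hK
    obtain ⟨x, hx, rfl⟩ := hstep
    have hx' := (hK.erasable_iff x).2 hx
    obtain ⟨l, hl, rfl⟩ := ih (hK.erase hx')
    refine ⟨x :: l, .cons K x hx' l hl, ?_⟩
    ext y
    simp only [List.mem_cons, Set.mem_union, Set.mem_ofPred_eq, Set.mem_insert_iff]
    tauto

theorem mem_IS_iff {A : Set α} : A ∈ G.IS ↔ Relation.ReflTransGen G.PeelStep ∅ A := by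
  constructor
  · rintro ⟨l, hl, rfl⟩
    simpa using hl.reflTransGen (IsResidual.refl G)
  · intro h
    obtain ⟨l, hl, rfl⟩ := exists_isPeeling h (IsResidual.refl G)
    exact ⟨l, hl, by simp⟩

end

/-- A map `e` to sets under which the relation `Cov` corresponds to the peeling steps of `G`, and
such that inclusion forces a chain for `Cov`, identifies the order generated by `Cov` with the
initial sections of `G`. -/
structure IsPeelModel {α T : Type*} (G : ValuedDigraph α) (e : T → Set α) (Cov : T → T → Prop)
    (bot : T) : Prop where
  bot : e bot = ∅
  peel : ∀ t t', Cov t t' → G.PeelStep (e t) (e t')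
  lift : ∀ t A, G.PeelStep (e t) A → ∃ t', Cov t t' ∧ e t' = A
  chain : ∀ t t', e t ⊆ e t' → Relation.ReflTransGen Cov t t'

namespace IsPeelModel

variable {α T : Type*} {G : ValuedDigraph α} {e : T → Set α} {Cov : T → T → Prop} {bot : T}

theorem subset_of_reflTransGen (h : G.IsPeelModel e Cov bot) {t t' : T}
    (ht : Relation.ReflTransGen Cov t t') : e t ⊆ e t' := by
  induction ht with
  | refl => exact subset_rfl
  | tail _ hc ih =>
    obtain ⟨x, -, hx⟩ := h.peel _ _ hc
    rw [hx]
    exact ih.trans (Set.subset_insert _ _)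

theorem subset_iff (h : G.IsPeelModel e Cov bot) {t t' : T} :
    e t ⊆ e t' ↔ Relation.ReflTransGen Cov t t' :=
  ⟨h.chain t t', h.subset_of_reflTransGen⟩

theorem injective (h : G.IsPeelModel e Cov bot) : Function.Injective e := by
  intro t t' htt
  rcases Relation.ReflTransGen.cases_head (h.chain t t' htt.le) with rfl | ⟨u, hu, hut⟩
  · rfl
  · -- a first step would enlarge `e t` strictly
    obtain ⟨x, hx, hx'⟩ := h.peel _ _ hu
    have hmem : x ∈ e t' := h.subset_of_reflTransGen hut (hx' ▸ Set.mem_insert _ _)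
    exact absurd (htt ▸ hmem) hx.2.1

theorem IS_eq_range (h : G.IsPeelModel e Cov bot) : G.IS = Set.range e := by
  ext A
  rw [mem_IS_iff]
  constructor
  · intro hA
    induction hA with
    | refl => exact ⟨bot, h.bot⟩
    | tail _ hs ih =>
      obtain ⟨t, rfl⟩ := ih
      obtain ⟨t', -, rfl⟩ := h.lift _ _ hs
      exact ⟨t', rfl⟩
  · rintro ⟨t, rfl⟩
    rw [← h.bot]
    have hc := h.chain bot t (by simp [h.bot])
    exact hc.lift e h.peel

theorem exists_relIso (h : G.IsPeelModel e Cov bot) {LE : T → T → Prop}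
    (hLE : ∀ t t', LE t t' ↔ Relation.ReflTransGen Cov t t') :
    ∃ f : LE ≃r G.isLE, ∀ t, (f t : Set α) = e t := by
  have hmem : ∀ t, e t ∈ G.IS := fun t => h.IS_eq_range ▸ Set.mem_range_self t
  let f : T → G.IS := fun t => ⟨e t, hmem t⟩
  have hf : Function.Bijective f := by
    refine ⟨fun t t' htt => h.injective (congrArg Subtype.val htt), ?_⟩
    rintro ⟨A, hA⟩
    rw [h.IS_eq_range] at hA
    obtain ⟨t, rfl⟩ := hA
    exact ⟨t, rfl⟩
  refine ⟨⟨Equiv.ofBijective f hf, ?_⟩, fun t => rfl⟩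
  intro t t'
  rw [hLE, ← h.subset_iff]
  rfl

end IsPeelModel

end ValuedDigraph

/-! ### Down-sets and up-sets of a finite poset -/

theorem isPeelModel_digraphDown (P : Type*) [PartialOrder P] [Finite P] :
    (digraphDown P).IsPeelModel (fun A : {A : Set P // IsLowerSet A} => (A : Set P))
      (fun A B => ∃ x, x ∉ (A : Set P) ∧ (B : Set P) = insert x (A : Set P))
      ⟨∅, isLowerSet_empty⟩ where
  bot := rfl
  peel := by
    rintro ⟨A, hA⟩ ⟨B, hB⟩ ⟨x, hx, rfl : B = insert x A⟩
    refine ⟨x, ⟨trivial, hx, ?_, ?_⟩, rfl⟩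
    · have : {y | (digraphDown P).Arc x y} ∩ A = ∅ := by
        ext y
        simp only [Set.mem_inter_iff, Set.mem_ofPred_eq, Set.mem_empty_iff_false, iff_false]
        exact fun ⟨h, hy⟩ => hx (hA h.2 hy)
      exact (congrArg Set.ncard this).trans (Set.ncard_empty P)
    · intro z hz hzA
      exact absurd ((hB hz.2 (Set.mem_insert _ _)).resolve_left hz.1) hzA
  lift := by
    rintro ⟨A, hA⟩ B ⟨x, ⟨-, hx, h0, hz⟩, rfl⟩
    refine ⟨⟨insert x A, ?_⟩, ⟨x, hx, rfl⟩, rfl⟩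
    intro y z hzy hy
    rcases hy with rfl | hy
    · by_cases hzA : z ∈ A
      · exact Or.inr hzA
      · by_contra hne
        have := hz z ⟨fun h => hne (Or.inl h), hzy⟩ hzA
        simp [digraphDown] at this
    · exact Or.inr (hA hzy hy)
  chain := by
    rintro ⟨A, hA⟩ ⟨B, hB⟩ (hAB : A ⊆ B)
    induction hn : (B \ A).ncard using Nat.strong_induction_on generalizing A with
    | _ n ih =>
    by_cases hBA : B ⊆ A
    · obtain rfl := hAB.antisymm hBA
      exact Relation.ReflTransGen.refl
    · obtain ⟨x, ⟨hxB, hxA⟩, hmin⟩ :=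
        (B \ A).toFinite.exists_minimal (Set.sdiff_nonempty.2 hBA)
      have hlow : IsLowerSet (insert x A) := by
        intro y z hzy hy
        rcases hy with rfl | hy
        · by_contra hne
          rw [Set.mem_insert_iff, not_or] at hne
          exact hne.1 (hzy.antisymm (hmin ⟨hB hzy hxB, hne.2⟩ hzy))
        · exact Or.inr (hA hzy hy)
      refine (ih _ ?_ _ hlow (Set.insert_subset hxB hAB) rfl).head ⟨x, hxA, rfl⟩
      rw [← hn]
      refine Set.ncard_lt_ncard ⟨fun y hy => ⟨hy.1, fun h => hy.2 (Or.inr h)⟩, fun h => ?_⟩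
        (B \ A).toFinite
      exact (h ⟨hxB, hxA⟩).2 (Set.mem_insert _ _)

theorem isPeelModel_digraphUp (P : Type*) [PartialOrder P] [Finite P] :
    (digraphUp P).IsPeelModel (fun A : {A : Set P // IsUpperSet A} => (A : Set P))
      (fun A B => ∃ x, x ∉ (A : Set P) ∧ (B : Set P) = insert x (A : Set P))
      ⟨∅, isUpperSet_empty⟩ where
  bot := rfl
  peel := by
    rintro ⟨A, hA⟩ ⟨B, hB⟩ ⟨x, hx, rfl : B = insert x A⟩
    refine ⟨x, ⟨trivial, hx, ?_, ?_⟩, rfl⟩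
    · have : {y | (digraphUp P).Arc x y} ∩ A = {y | x ≠ y ∧ x ≤ y} := by
        ext y
        refine ⟨fun h => h.1, fun h => ⟨h, ?_⟩⟩
        exact (hB h.2 (Set.mem_insert _ _)).resolve_left h.1.symm
      rw [this]
      rfl
    · intro z hz hzA
      refine Set.ncard_lt_ncard ⟨Set.inter_subset_left, fun h => ?_⟩ (Set.toFinite _)
      exact hx (h (show x ∈ {y | z ≠ y ∧ z ≤ y} from hz)).2
  lift := by
    rintro ⟨A, hA⟩ B ⟨x, ⟨-, hx, h0, hz⟩, rfl⟩
    refine ⟨⟨insert x A, ?_⟩, ⟨x, hx, rfl⟩, rfl⟩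
    have heq : {y | x ≠ y ∧ x ≤ y} ∩ A = {y | x ≠ y ∧ x ≤ y} :=
      Set.eq_of_subset_of_ncard_le Set.inter_subset_left h0.ge (Set.toFinite _)
    intro y z hyz hy
    rcases hy with rfl | hy
    · by_contra hne
      rw [Set.mem_insert_iff, not_or] at hne
      have : z ∈ {z | y ≠ z ∧ y ≤ z} ∩ A := heq.ge ⟨Ne.symm hne.1, hyz⟩
      exact hne.2 this.2
    · exact Or.inr (hA hyz hy)
  chain := by
    rintro ⟨A, hA⟩ ⟨B, hB⟩ (hAB : A ⊆ B)
    induction hn : (B \ A).ncard using Nat.strong_induction_on generalizing A with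
    | _ n ih =>
    by_cases hBA : B ⊆ A
    · obtain rfl := hAB.antisymm hBA
      exact Relation.ReflTransGen.refl
    · obtain ⟨x, ⟨hxB, hxA⟩, hmax⟩ :=
        (B \ A).toFinite.exists_maximal (Set.sdiff_nonempty.2 hBA)
      have hupp : IsUpperSet (insert x A) := by
        intro y z hyz hy
        rcases hy with rfl | hy
        · by_contra hne
          rw [Set.mem_insert_iff, not_or] at hne
          exact hne.1 ((hmax ⟨hB hyz hxB, hne.2⟩ hyz).antisymm hyz)
        · exact Or.inr (hA hyz hy)
      refine (ih _ ?_ _ hupp (Set.insert_subset hxB hAB) rfl).head ⟨x, hxA, rfl⟩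
      rw [← hn]
      refine Set.ncard_lt_ncard ⟨fun y hy => ⟨hy.1, fun h => hy.2 (Or.inr h)⟩, fun h => ?_⟩
        (B \ A).toFinite
      exact (h ⟨hxB, hxA⟩).2 (Set.mem_insert _ _)

theorem nonempty_relIso_of_isPeelModel {α : Type*} {p : Set α → Prop} {G : ValuedDigraph α}
    {bot : {A : Set α // p A}}
    (h : G.IsPeelModel (fun A : {A : Set α // p A} => (A : Set α))
      (fun A B => ∃ x, x ∉ (A : Set α) ∧ (B : Set α) = insert x (A : Set α)) bot) :
    Nonempty ((fun A B : {A : Set α // p A} => (A : Set α) ⊆ B) ≃r G.isLE) :=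
  ⟨(h.exists_relIso fun _ _ => h.subset_iff).choose⟩

/-! ### Weak orders and inversion sets -/

/-- No value strictly between the entries of the pair `c` stands at a position strictly between
theirs. The position of the value `x` in `w` is `w⁻¹ • x`. -/
def IsTight {X W : Type*} [LinearOrder X] [Group W] [MulAction W X] (w : W) (c : X × X) : Prop :=
  ∀ k, c.1 < k → k < c.2 → ¬ (w⁻¹ • c.1 < w⁻¹ • k ∧ w⁻¹ • k < w⁻¹ • c.2)

/-- The generator `s` exchanges two adjacent positions `i` and `j`: it reverses the order of exactly
those pairs of positions that are equivalent to `(i, j)`. -/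
def IsSimpleAt {X W : Type*} [LinearOrder X] [Group W] [MulAction W X] (rel : Setoid (X × X))
    (s : W) (i j : X) : Prop :=
  s⁻¹ = s ∧ ∀ p q, p < q → (s • q < s • p ↔ rel (p, q) (i, j))

theorem IsSimpleAt.of_rel {X W : Type*} [LinearOrder X] [Group W] [MulAction W X]
    {rel : Setoid (X × X)} {s : W} {i j i' j' : X} (h : IsSimpleAt rel s i j)
    (hr : rel (i, j) (i', j')) : IsSimpleAt rel s i' j' :=
  ⟨h.1, fun p q hpq => (h.2 p q hpq).trans
    ⟨fun h => rel.trans h hr, fun h => rel.trans h (rel.symm hr)⟩⟩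

theorem smul_lt_of_not_lt {X W : Type*} [LinearOrder X] [Group W] [MulAction W X] (w : W)
    {a b : X} (hab : a ≠ b) (h : ¬ w • b < w • a) :
    w • a < w • b :=
  lt_of_le_of_ne (not_lt.1 h) fun h' => hab (smul_left_cancel w h')

/-- If the entries of a tight pair are not adjacent in position, a value that separates them is
smaller or larger than both. -/
theorem exists_between_outside {X W : Type*} [LinearOrder X] [Group W] [MulAction W X] {w : W}
    {c : X × X} (ht : IsTight w c) (hlt : w⁻¹ • c.1 < w⁻¹ • c.2)
    (hcov : ¬ w⁻¹ • c.1 ⋖ w⁻¹ • c.2) :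
    (∃ k, c.2 < k ∧ w⁻¹ • c.1 < w⁻¹ • k ∧ w⁻¹ • k < w⁻¹ • c.2) ∨
      ∃ k, k < c.1 ∧ w⁻¹ • c.1 < w⁻¹ • k ∧ w⁻¹ • k < w⁻¹ • c.2 := by
  obtain ⟨x, hax, hxb⟩ := (not_covBy_iff hlt).1 hcov
  obtain ⟨k, rfl⟩ : ∃ k, x = w⁻¹ • k := ⟨w • x, by simp⟩
  rcases lt_trichotomy c.2 k with h | h | h
  · exact Or.inl ⟨k, h, hax, hxb⟩
  · exact absurd hxb (h ▸ lt_irrefl _)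
  · rcases lt_trichotomy c.1 k with h' | h' | h'
    · exact absurd ⟨hax, hxb⟩ (ht k h' h)
    · exact absurd hax (h' ▸ lt_irrefl _)
    · exact Or.inr ⟨k, h', hax, hxb⟩

/-- A group `W` of permutations of a linear order `X`, together with an equivalence relation `rel`
on pairs under which inversions are inherited (the orbit relation of a symmetry group commuting
with `W`), and a valued digraph `G` whose vertices represent the classes of pairs that can be
inverted. The field `tight` says how the valuation sees inversions. For a tight pair whose positions
are not adjacent, `escape` provides a value `k` outside the pair that stands between its entries, such
that the pairs on the way to `k` are represented by boxes: one of them will prevent the given pair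
from being peeled. -/
structure WeakOrderModel (X W : Type*) [LinearOrder X] [Group W] [MulAction W X] where
  gens : Set W
  G : ValuedDigraph (X × X)
  rel : Setoid (X × X)
  rel_smul : ∀ (w : W) c d, rel c d → rel (w • c) (w • d)
  rel_lt : ∀ c d, rel c d → c.1 < c.2 → d.1 < d.2
  rel_tight : ∀ (w : W) c d, rel c d → IsTight w c → IsTight w d
  lt_of_mem : ∀ c ∈ G.verts, c.1 < c.2
  eq_of_rel : ∀ c ∈ G.verts, ∀ d ∈ G.verts, rel c d → c = d
  exists_rel : ∀ (w : W) c, c.1 < c.2 → w⁻¹ • c.2 < w⁻¹ • c.1 → ∃ d ∈ G.verts, rel c d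
  eq_one : ∀ w : W, (∀ p q : X, p < q → w • p < w • q) → w = 1
  finite : ∀ w : W, {c ∈ G.verts | w⁻¹ • c.2 < w⁻¹ • c.1}.Finite
  exists_gen : ∀ i j : X, i ⋖ j → ∃ s ∈ gens, IsSimpleAt rel s i j
  gen_simple : ∀ s ∈ gens, ∃ i j : X, i ⋖ j ∧ IsSimpleAt rel s i j
  tight : ∀ (w : W), ∀ c ∈ G.verts, w⁻¹ • c.1 < w⁻¹ • c.2 →
    ({d | G.Arc c d} ∩ {c ∈ G.verts | w⁻¹ • c.2 < w⁻¹ • c.1}).ncard ≤ G.val c ∧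
    (({d | G.Arc c d} ∩ {c ∈ G.verts | w⁻¹ • c.2 < w⁻¹ • c.1}).ncard = G.val c ↔ IsTight w c)
  arc_rel : ∀ z c, G.Arc z c → ∃ k, z.1 < k ∧ k < z.2 ∧ (rel c (z.1, k) ∨ rel c (k, z.2))
  arc_right : ∀ c ∈ G.verts, ∀ z ∈ G.verts, ∀ k, c.2 < k → rel (c.1, k) z → G.Arc z c
  arc_left : ∀ c ∈ G.verts, ∀ z ∈ G.verts, ∀ k, k < c.1 → rel (k, c.2) z → G.Arc z c
  escape : ∀ (w : W), ∀ c ∈ G.verts, IsTight w c → w⁻¹ • c.1 < w⁻¹ • c.2 →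
    ¬ w⁻¹ • c.1 ⋖ w⁻¹ • c.2 →
    (∃ k, c.2 < k ∧ w⁻¹ • c.1 < w⁻¹ • k ∧ w⁻¹ • k < w⁻¹ • c.2 ∧
      ∀ m, c.1 < m → m ≤ k → w⁻¹ • c.1 < w⁻¹ • m → w⁻¹ • m ≤ w⁻¹ • k →
        ∃ z ∈ G.verts, rel (c.1, m) z) ∨
    (∃ k, k < c.1 ∧ w⁻¹ • c.1 < w⁻¹ • k ∧ w⁻¹ • k < w⁻¹ • c.2 ∧
      ∀ m, k ≤ m → m < c.2 → w⁻¹ • k ≤ w⁻¹ • m → w⁻¹ • m < w⁻¹ • c.2 →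
        ∃ z ∈ G.verts, rel (m, c.2) z)

namespace WeakOrderModel

variable {X W : Type*} [LinearOrder X] [Group W] [MulAction W X]
  (M : WeakOrderModel X W)

/-- The inversion set: the boxes whose entries stand in the wrong order. -/
def inv (w : W) : Set (X × X) := {c ∈ M.G.verts | w⁻¹ • c.2 < w⁻¹ • c.1}

theorem inv_one : M.inv 1 = ∅ := by
  ext c
  simp only [inv, _root_.inv_one, one_smul, Set.mem_ofPred_eq, Set.mem_empty_iff_false, iff_false]
  exact fun ⟨h, h'⟩ => h'.asymm (M.lt_of_mem c h)

theorem smul_lt_of_notMem {w : W} {c : X × X} (hc : c ∈ M.G.verts) (h : c ∉ M.inv w) :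
    w⁻¹ • c.1 < w⁻¹ • c.2 :=
  smul_lt_of_not_lt _ (M.lt_of_mem c hc).ne fun h' => h ⟨hc, h'⟩

theorem notMem_inv {w : W} {c : X × X} (h : w⁻¹ • c.1 < w⁻¹ • c.2) : c ∉ M.inv w :=
  fun h' => h.asymm h'.2

theorem rel_inv_smul_lt {w : W} {c d : X × X} (h : M.rel c d) (hc : w⁻¹ • c.1 < w⁻¹ • c.2) :
    w⁻¹ • d.1 < w⁻¹ • d.2 :=
  M.rel_lt _ _ (M.rel_smul w⁻¹ _ _ h) hc

/-- Adjacency of entries is inherited along `rel`. -/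
theorem rel_covBy {c d : X × X} (h : M.rel c d) (hc : c.1 ⋖ c.2) : d.1 ⋖ d.2 := by
  refine ⟨M.rel_lt _ _ h hc.1, fun k h1 h2 => ?_⟩
  have ht : IsTight (1 : W) c := fun k h1 h2 => absurd h2 (hc.2 h1)
  refine M.rel_tight 1 c d h ht k h1 h2 ?_
  simpa using ⟨h1, h2⟩

/-- Inversion sets in terms of all pairs instead of representatives. -/
theorem inv_lt_of_subset {w v : W} (h : M.inv w ⊆ M.inv v) {a b : X} (hab : a < b)
    (hw : w⁻¹ • b < w⁻¹ • a) : v⁻¹ • b < v⁻¹ • a := by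
  obtain ⟨d, hd, hr⟩ := M.exists_rel w (a, b) hab hw
  have hdw : d ∈ M.inv w := by
    by_contra hne
    have := M.rel_inv_smul_lt (M.rel.symm hr) (M.smul_lt_of_notMem hd hne)
    exact this.asymm hw
  by_contra hne
  exact M.notMem_inv (M.rel_inv_smul_lt hr (smul_lt_of_not_lt _ hab.ne hne)) (h hdw)

theorem inv_injective : Function.Injective M.inv := by
  intro w v h
  have key : w⁻¹ * v = 1 := by
    apply M.eq_one
    intro p q hpq
    rw [mul_smul, mul_smul]
    refine smul_lt_of_not_lt _ (fun e => hpq.ne (smul_left_cancel v e)) fun hlt => ?_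
    rcases lt_trichotomy (v • p) (v • q) with h1 | h1 | h1
    · have := M.inv_lt_of_subset h.le h1 hlt
      rw [inv_smul_smul, inv_smul_smul] at this
      exact this.asymm hpq
    · exact hpq.ne (smul_left_cancel v h1)
    · have := M.inv_lt_of_subset h.ge h1 (by simpa using hpq)
      exact this.asymm hlt
  rw [inv_mul_eq_one] at key
  exact key

/-- Exchanging two adjacent positions whose entries are in order adds exactly one inversion. -/
theorem inv_mul_of_lt {w s : W} {i j : X} (hij : i < j) (hs : IsSimpleAt M.rel s i j)
    (h : w • i < w • j) :
    ∃ c ∈ M.G.verts, M.rel (w • i, w • j) c ∧ c ∉ M.inv w ∧ M.inv (w * s) = insert c (M.inv w) := by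
  have hswap : s • j < s • i := (hs.2 i j hij).2 (M.rel.refl _)
  have hsm : ∀ x : X, (w * s)⁻¹ • x = s • (w⁻¹ • x) := fun x => by
    rw [mul_inv_rev, mul_smul, hs.1]
  obtain ⟨c, hc, hr⟩ := M.exists_rel (w * s) (w • i, w • j) h (by
    simpa only [hsm, inv_smul_smul] using hswap)
  have hcw : w⁻¹ • c.1 < w⁻¹ • c.2 := M.rel_inv_smul_lt hr (by simpa using hij)
  refine ⟨c, hc, hr, M.notMem_inv hcw, ?_⟩
  ext d
  constructor
  · rintro ⟨hd, hd'⟩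
    by_cases hdw : d ∈ M.inv w
    · exact Or.inr hdw
    · left
      have hlt := M.smul_lt_of_notMem hd hdw
      rw [hsm, hsm, hs.2 _ _ hlt] at hd'
      have := M.rel_smul w _ _ hd'
      simp only [Prod.smul_mk, smul_inv_smul] at this
      exact M.eq_of_rel d hd c hc (M.rel.trans this hr)
  · rintro (rfl | ⟨hd, hd'⟩)
    · refine ⟨hc, ?_⟩
      rw [hsm, hsm, hs.2 _ _ hcw]
      have := M.rel_smul w⁻¹ _ _ hr
      simp only [Prod.smul_mk, inv_smul_smul] at this
      exact M.rel.symm this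
    · refine ⟨hd, ?_⟩
      rw [hsm, hsm]
      refine smul_lt_of_not_lt _ (fun e => hd'.ne e) fun hlt => ?_
      rw [hs.2 _ _ hd'] at hlt
      -- otherwise `d` read backwards would be in the class of an increasing pair
      have := M.rel_smul w _ _ hlt
      simp only [Prod.smul_mk, smul_inv_smul] at this
      exact (M.rel_lt _ _ (M.rel.symm this) h).asymm (M.lt_of_mem d hd)

theorem inv_mul_of_gt {w s : W} {i j : X} (hs : IsSimpleAt M.rel s i j)
    (h : w • j < w • i) : M.inv (w * s) ⊆ M.inv w := by
  rintro d ⟨hd, hd'⟩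
  by_contra hdw
  have hlt := M.smul_lt_of_notMem hd hdw
  rw [mul_inv_rev, mul_smul, mul_smul, hs.1, hs.2 _ _ hlt] at hd'
  have := M.rel_smul w _ _ hd'
  simp only [Prod.smul_mk, smul_inv_smul] at this
  exact (M.rel_lt _ _ this (M.lt_of_mem d hd)).asymm h

/-- `v` covers `w` in the weak order. -/
def Cov (w v : W) : Prop :=
  ∃ s ∈ M.gens, v = w * s ∧ ∃ c, c ∉ M.inv w ∧ M.inv v = insert c (M.inv w)

theorem ncard_inv_mul (w : W) {s : W} (hs : s ∈ M.gens) :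
    (M.inv (w * s)).ncard ≤ (M.inv w).ncard + 1 ∧
      ((M.inv (w * s)).ncard = (M.inv w).ncard + 1 → M.Cov w (w * s)) := by
  obtain ⟨i, j, hij, hsij⟩ := M.gen_simple s hs
  by_cases h : w • i < w • j
  · obtain ⟨c, -, -, hcw, he⟩ := M.inv_mul_of_lt hij.1 hsij h
    refine ⟨?_, fun _ => ⟨s, hs, rfl, c, hcw, he⟩⟩
    rw [he]
    exact Set.ncard_insert_le _ _
  · have hsub := M.inv_mul_of_gt hsij (smul_lt_of_not_lt w hij.1.ne' h)
    have := Set.ncard_le_ncard hsub (M.finite w)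
    exact ⟨by omega, fun h => by omega⟩

/-- A chain of covers from `w` to `v` spells a word, each letter of which adds one inversion. -/
theorem exists_word_of_reflTransGen {w v : W} (h : Relation.ReflTransGen M.Cov w v) :
    ∃ l : List W, (∀ s ∈ l, s ∈ M.gens) ∧ v = w * l.prod ∧
      (M.inv v).ncard = (M.inv w).ncard + l.length := by
  induction h with
  | refl => exact ⟨[], by simp, by simp, by simp⟩
  | tail _ hc ih =>
    obtain ⟨l, hl, rfl, hlen⟩ := ih
    obtain ⟨s, hs, rfl, c, hcw, he⟩ := hc
    refine ⟨l ++ [s], ?_, by simp [mul_assoc], ?_⟩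
    · intro t ht
      rcases List.mem_append.1 ht with ht | ht
      · exact hl t ht
      · rw [List.mem_singleton.1 ht]
        exact hs
    · rw [he, Set.ncard_insert_of_notMem hcw (M.finite _), hlen]
      simp [add_assoc]

theorem ncard_inv_le (w : W) (l : List W) (hl : ∀ s ∈ l, s ∈ M.gens) :
    (M.inv (w * l.prod)).ncard ≤ (M.inv w).ncard + l.length := by
  induction l generalizing w with
  | nil => simp
  | cons s l ih =>
    have h1 := (M.ncard_inv_mul w (hl s (by simp))).1
    have h2 := ih (w * s) fun t ht => hl t (by simp [ht])
    rw [List.prod_cons, ← mul_assoc, List.length_cons]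
    omega

/-- A pair whose positions are adjacent can be peeled. -/
theorem canPeel_of_covBy {w : W} {c : X × X} (hc : c ∈ M.G.verts) (h : w⁻¹ • c.1 ⋖ w⁻¹ • c.2) :
    M.G.CanPeel (M.inv w) c := by
  refine ⟨hc, M.notMem_inv h.1, ?_, fun z hzc hzw => ?_⟩
  · refine (M.tight w c hc h.1).2.2 fun k _ _ hk => h.2 hk.1 hk.2
  · have hz := M.G.mem_left _ _ hzc
    have hlt := M.smul_lt_of_notMem hz hzw
    have ht := M.tight w z hz hlt
    refine lt_of_le_of_ne ht.1 fun he => ?_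
    obtain ⟨k, hk1, hk2, hk | hk⟩ := M.arc_rel z c hzc
    · have hcov := M.rel_covBy (M.rel_smul w⁻¹ _ _ hk) h
      refine ht.2.1 he k hk1 hk2 ⟨hcov.1, ?_⟩
      exact smul_lt_of_not_lt _ hk2.ne fun h' => hcov.2 hlt h'
    · have hcov := M.rel_covBy (M.rel_smul w⁻¹ _ _ hk) h
      refine ht.2.1 he k hk1 hk2 ⟨?_, hcov.1⟩
      exact smul_lt_of_not_lt _ hk1.ne fun h' => hcov.2 h' hlt

variable [LocallyFiniteOrder X]

/-- An adjacent pair of positions whose entries are inverted in `v` but not in `w` exists as soon as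
any such pair exists: choose one at minimal distance in `w`. -/
theorem exists_covBy {w v : W} (hwv : M.inv w ⊆ M.inv v) {a b : X} (hab : a < b)
    (hw : w⁻¹ • a < w⁻¹ • b) (hv : v⁻¹ • b < v⁻¹ • a) :
    ∃ a b : X, a < b ∧ w⁻¹ • a ⋖ w⁻¹ • b ∧ v⁻¹ • b < v⁻¹ • a := by
  induction hn : (Finset.Ioo (w⁻¹ • a) (w⁻¹ • b)).card using Nat.strong_induction_on
    generalizing a b with
  | _ n ih =>
  by_cases hc : w⁻¹ • a ⋖ w⁻¹ • b
  · exact ⟨a, b, hab, hc, hv⟩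
  obtain ⟨x, hax, hxb⟩ := (not_covBy_iff hw).1 hc
  obtain ⟨k, rfl⟩ : ∃ k, x = w⁻¹ • k := ⟨w • x, by simp⟩
  have hleft : (Finset.Ioo (w⁻¹ • a) (w⁻¹ • k)).card < n := by
    rw [← hn]
    refine Finset.card_lt_card ⟨Finset.Ioo_subset_Ioo_right hxb.le, fun h => ?_⟩
    simpa using h (Finset.mem_Ioo.2 ⟨hax, hxb⟩)
  have hright : (Finset.Ioo (w⁻¹ • k) (w⁻¹ • b)).card < n := by
    rw [← hn]
    refine Finset.card_lt_card ⟨Finset.Ioo_subset_Ioo_left hax.le, fun h => ?_⟩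
    simpa using h (Finset.mem_Ioo.2 ⟨hax, hxb⟩)
  have hka : k ≠ a := by rintro rfl; exact lt_irrefl _ hax
  have hkb : k ≠ b := by rintro rfl; exact lt_irrefl _ hxb
  rcases lt_or_gt_of_ne hka with h1 | h1
  · -- `k < a < b`: the pair `(k, a)` is inverted in `w`, hence in `v`
    exact ih _ hright (h1.trans hab) hxb (hv.trans (M.inv_lt_of_subset hwv h1 hax)) rfl
  rcases lt_or_gt_of_ne hkb with h2 | h2
  · by_cases h3 : v⁻¹ • k < v⁻¹ • a
    · exact ih _ hleft h1 hax h3 rfl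
    · exact ih _ hright h2 hxb (hv.trans_le (not_lt.1 h3)) rfl
  · exact ih _ hleft h1 hax ((M.inv_lt_of_subset hwv h2 hxb).trans hv) rfl

theorem reflTransGen_of_subset {w v : W} (h : M.inv w ⊆ M.inv v) :
    Relation.ReflTransGen M.Cov w v := by
  induction hn : (M.inv v \ M.inv w).ncard using Nat.strong_induction_on generalizing w with
  | _ n ih =>
  by_cases hvw : M.inv v ⊆ M.inv w
  · rw [M.inv_injective (h.antisymm hvw)]
  obtain ⟨x, hxv, hxw⟩ := Set.not_subset.1 hvw
  obtain ⟨a, b, hab, hc, hv⟩ := M.exists_covBy h (M.lt_of_mem x hxv.1)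
    (M.smul_lt_of_notMem hxv.1 hxw) hxv.2
  obtain ⟨s, hs, hsij⟩ := M.exists_gen _ _ hc
  obtain ⟨c, hcV, hr, hcw, he⟩ := M.inv_mul_of_lt (w := w) hc.1 hsij (by simpa using hab)
  rw [smul_inv_smul, smul_inv_smul] at hr
  have hcv : c ∈ M.inv v := by
    by_contra hne
    exact (M.rel_inv_smul_lt (M.rel.symm hr) (M.smul_lt_of_notMem hcV hne)).asymm hv
  refine (ih _ ?_ (he ▸ Set.insert_subset hcv h) rfl).head ⟨s, hs, rfl, c, hcw, he⟩
  rw [← hn, he]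
  refine Set.ncard_lt_ncard ⟨fun y hy => ⟨hy.1, fun h => hy.2 (Or.inr h)⟩, fun h => ?_⟩
    ((M.finite v).subset Set.sdiff_subset)
  exact (h ⟨hcv, hcw⟩).2 (Set.mem_insert _ _)

/-- The length is the number of inversions. -/
theorem genLength_eq (w : W) : genLength M.gens w = (M.inv w).ncard := by
  obtain ⟨l, hl, hw, hlen⟩ := M.exists_word_of_reflTransGen
    (M.reflTransGen_of_subset (w := 1) (v := w) (by simp [M.inv_one]))
  rw [one_mul] at hw
  rw [M.inv_one, Set.ncard_empty, zero_add] at hlen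
  refine le_antisymm (Nat.sInf_le ⟨l, hl, hw.symm, hlen.symm⟩)
    (le_csInf ⟨_, l, hl, hw.symm, rfl⟩ ?_)
  rintro k ⟨l, hl, rfl, rfl⟩
  simpa [M.inv_one] using M.ncard_inv_le 1 l hl

theorem weakLE_iff {w v : W} :
    WeakLE M.gens w v ↔ Relation.ReflTransGen M.Cov w v := by
  constructor
  · rintro ⟨l, hl, rfl, hlen⟩
    rw [genLength_eq, genLength_eq] at hlen
    induction l generalizing w with
    | nil => simpa using Relation.ReflTransGen.refl
    | cons s l ih =>
      -- each letter adds at most one inversion, so each has to add exactly one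
      have hsg := hl s (by simp)
      have hlg : ∀ t ∈ l, t ∈ M.gens := fun t ht => hl t (by simp [ht])
      have h1 := M.ncard_inv_mul w hsg
      have h2 := M.ncard_inv_le (w * s) l hlg
      rw [List.prod_cons, ← mul_assoc, List.length_cons] at hlen
      rw [List.prod_cons, ← mul_assoc]
      exact (ih hlg (by omega)).head (h1.2 (by omega))
  · intro h
    obtain ⟨l, hl, hv, hlen⟩ := M.exists_word_of_reflTransGen h
    exact ⟨l, hl, hv, by rwa [genLength_eq, genLength_eq]⟩

/-- If a value `k > b` stands between `a` and `b`, the smallest one gives a tight pair `(a, k)`. -/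
theorem exists_tight_right {w : W} {c : X × X} (ht : IsTight w c)
    (hlt : c.1 < c.2) {k : X} (hk : c.2 < k) (h1 : w⁻¹ • c.1 < w⁻¹ • k)
    (h2 : w⁻¹ • k < w⁻¹ • c.2)
    (hV : ∀ m, c.1 < m → m ≤ k → w⁻¹ • c.1 < w⁻¹ • m → w⁻¹ • m ≤ w⁻¹ • k →
        ∃ z ∈ M.G.verts, M.rel (c.1, m) z) :
    ∃ k, c.2 < k ∧ w⁻¹ • c.1 < w⁻¹ • k ∧ IsTight w (c.1, k) ∧
      ∃ z ∈ M.G.verts, M.rel (c.1, k) z := by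
  induction hn : (Finset.Ioo c.2 k).card using Nat.strong_induction_on generalizing k with
  | _ n ih =>
  by_cases hk' : IsTight w (c.1, k)
  · exact ⟨k, hk, h1, hk', hV k (hlt.trans hk) le_rfl h1 le_rfl⟩
  · simp only [IsTight, not_forall, not_not] at hk'
    obtain ⟨m, hm1, hm2, hm3, hm4⟩ := hk'
    have hm : c.2 < m := by
      rcases lt_trichotomy m c.2 with h | h | h
      · exact absurd ⟨hm3, hm4.trans h2⟩ (ht m hm1 h)
      · subst h; exact absurd h2 hm4.asymm
      · exact h
    refine ih _ ?_ hm hm3 (hm4.trans h2)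
      (fun x e1 e2 e3 e4 => hV x e1 (e2.trans hm2.le) e3 (e4.trans hm4.le)) rfl
    rw [← hn]
    refine Finset.card_lt_card ⟨Finset.Ioo_subset_Ioo_right hm2.le, fun h => ?_⟩
    simpa using h (Finset.mem_Ioo.2 ⟨hm, hm2⟩)

/-- If a value `k < a` stands between `a` and `b`, the largest one gives a tight pair `(k, b)`. -/
theorem exists_tight_left {w : W} {c : X × X} (ht : IsTight w c)
    (hlt : c.1 < c.2) {k : X} (hk : k < c.1) (h1 : w⁻¹ • c.1 < w⁻¹ • k)
    (h2 : w⁻¹ • k < w⁻¹ • c.2)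
    (hV : ∀ m, k ≤ m → m < c.2 → w⁻¹ • k ≤ w⁻¹ • m → w⁻¹ • m < w⁻¹ • c.2 →
        ∃ z ∈ M.G.verts, M.rel (m, c.2) z) :
    ∃ k, k < c.1 ∧ w⁻¹ • k < w⁻¹ • c.2 ∧ IsTight w (k, c.2) ∧
      ∃ z ∈ M.G.verts, M.rel (k, c.2) z := by
  induction hn : (Finset.Ioo k c.1).card using Nat.strong_induction_on generalizing k with
  | _ n ih =>
  by_cases hk' : IsTight w (k, c.2)
  · exact ⟨k, hk, h2, hk', hV k le_rfl (hk.trans hlt) le_rfl h2⟩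
  · simp only [IsTight, not_forall, not_not] at hk'
    obtain ⟨m, hm1, hm2, hm3, hm4⟩ := hk'
    have hm : m < c.1 := by
      rcases lt_trichotomy m c.1 with h | h | h
      · exact h
      · subst h; exact absurd h1 hm3.asymm
      · exact absurd ⟨h1.trans hm3, hm4⟩ (ht m h hm2)
    refine ih _ ?_ hm (h1.trans hm3) hm4
      (fun x e1 e2 e3 e4 => hV x (hm1.le.trans e1) e2 (hm3.le.trans e3) e4) rfl
    rw [← hn]
    refine Finset.card_lt_card ⟨Finset.Ioo_subset_Ioo_left hm1.le, fun h => ?_⟩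
    simpa using h (Finset.mem_Ioo.2 ⟨hm1, hm⟩)

theorem covBy_of_canPeel {w : W} {c : X × X} (h : M.G.CanPeel (M.inv w) c) :
    w⁻¹ • c.1 ⋖ w⁻¹ • c.2 := by
  obtain ⟨hc, hcw, h0, hz⟩ := h
  have hlt := M.smul_lt_of_notMem hc hcw
  have hlt' := M.lt_of_mem c hc
  have ht := (M.tight w c hc hlt).2.1 h0
  by_contra hcov
  -- a tight box outside the inversion set with an arc to `c` has value `0` and blocks `c`
  have hblock : ∀ z ∈ M.G.verts, ∀ d, M.rel d z → w⁻¹ • d.1 < w⁻¹ • d.2 → IsTight w d →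
      M.G.Arc z c → False := by
    intro z hzV d hr hd hdt harc
    have hzlt := M.rel_inv_smul_lt hr hd
    have := (M.tight w z hzV hzlt).2.2 (M.rel_tight w d z hr hdt)
    exact (hz z harc (M.notMem_inv hzlt)).ne this
  rcases M.escape w c hc ht hlt hcov with ⟨k, hk, h1, h2, hV⟩ | ⟨k, hk, h1, h2, hV⟩
  · obtain ⟨k, hk, h1, hkt, z, hzV, hr⟩ := M.exists_tight_right ht hlt' hk h1 h2 hV
    exact hblock z hzV _ hr h1 hkt (M.arc_right c hc z hzV k hk hr)
  · obtain ⟨k, hk, h1, hkt, z, hzV, hr⟩ := M.exists_tight_left ht hlt' hk h1 h2 hV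
    exact hblock z hzV _ hr h1 hkt (M.arc_left c hc z hzV k hk hr)

theorem isPeelModel : M.G.IsPeelModel M.inv M.Cov 1 where
  bot := M.inv_one
  peel := by
    rintro w _ ⟨s, hs, rfl, c, hcw, he⟩
    have hc : c ∈ M.inv (w * s) := he ▸ Set.mem_insert _ _
    refine ⟨c, M.canPeel_of_covBy hc.1 ?_, he⟩
    obtain ⟨i, j, hij, hsij⟩ := M.gen_simple s hs
    have h := hc.2
    rw [mul_inv_rev, mul_smul, mul_smul, hsij.1,
      hsij.2 _ _ (M.smul_lt_of_notMem hc.1 hcw)] at h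
    exact M.rel_covBy (M.rel.symm h) hij
  lift := by
    rintro w _ ⟨c, hc, rfl⟩
    have hcov := M.covBy_of_canPeel hc
    obtain ⟨s, hs, hsij⟩ := M.exists_gen _ _ hcov
    obtain ⟨d, hd, hr, hdw, he⟩ := M.inv_mul_of_lt (w := w) hcov.1 hsij (by
      simpa using M.lt_of_mem c hc.1)
    rw [smul_inv_smul, smul_inv_smul] at hr
    obtain rfl := M.eq_of_rel c hc.1 d hd hr
    exact ⟨w * s, ⟨s, hs, rfl, c, hdw, he⟩, he⟩
  chain _ _ := M.reflTransGen_of_subset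

/-- The initial sections are the inversion sets, and the weak order is their inclusion order. -/
theorem IS_eq_range_and_exists_relIso : M.G.IS = Set.range M.inv ∧
    ∃ e : WeakLE M.gens ≃r M.G.isLE, ∀ w, (e w : Set (X × X)) = M.inv w :=
  ⟨M.isPeelModel.IS_eq_range, M.isPeelModel.exists_relIso fun _ _ => M.weakLE_iff⟩

end WeakOrderModel

/-! ### Counting inversions in a hook -/

/-- A hook `N = f(I) ⊔ g(J)` with `J ⊆ I`, of which `A` contains at most one of `f k` and `g k` for
each `k`, meets `A` in at most `|I|` elements, with equality if and only if each `k` contributes. -/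
theorem ncard_hook_inter {κ α : Type*} [DecidableEq κ] {N A : Set α} {I J : Finset κ} (hJ : J ⊆ I)
    (f g : κ → α) (hf : Set.InjOn f I) (hg : Set.InjOn g J) (hfg : ∀ i ∈ I, ∀ j ∈ J, f i ≠ g j)
    (hN : ∀ d, d ∈ N ↔ (∃ k ∈ I, d = f k) ∨ ∃ k ∈ J, d = g k)
    (hA : ∀ k ∈ J, f k ∈ A → g k ∉ A) :
    N.ncard = I.card + J.card ∧ (N ∩ A).ncard ≤ I.card ∧
      ((N ∩ A).ncard = I.card ↔ ∀ k ∈ I, f k ∈ A ∨ (k ∈ J ∧ g k ∈ A)) := by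
  classical
  have count : ∀ I' ⊆ I, ∀ J' ⊆ J, ∀ B : Set α,
      (∀ d, d ∈ B ↔ (∃ k ∈ I', d = f k) ∨ ∃ k ∈ J', d = g k) → B.ncard = I'.card + J'.card := by
    intro I' hI' J' hJ' B hB
    have e : B = ((I'.image f ∪ J'.image g : Finset α) : Set α) := by
      ext d
      simp only [hB, Finset.coe_union, Finset.coe_image, Set.mem_union, Set.mem_image,
        Finset.mem_coe, eq_comm]
    rw [e, Set.ncard_coe_finset, Finset.card_union_of_disjoint, Finset.card_image_of_injOn,
      Finset.card_image_of_injOn]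
    · exact hg.mono (Finset.coe_subset.2 hJ')
    · exact hf.mono (Finset.coe_subset.2 hI')
    · rw [Finset.disjoint_left]
      intro d h1 h2
      obtain ⟨i, hi, rfl⟩ := Finset.mem_image.1 h1
      obtain ⟨j, hj, h⟩ := Finset.mem_image.1 h2
      exact hfg i (hI' hi) j (hJ' hj) h.symm
  have hcard : (N ∩ A).ncard = (I.filter fun k => f k ∈ A ∨ (k ∈ J ∧ g k ∈ A)).card := by
    rw [count (I.filter fun k => f k ∈ A) (Finset.filter_subset _ _)
      (J.filter fun k => g k ∈ A) (Finset.filter_subset _ _), ← Finset.card_union_of_disjoint]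
    · congr 1
      ext k
      simp only [Finset.mem_union, Finset.mem_filter]
      constructor
      · rintro (h | h)
        · exact ⟨h.1, Or.inl h.2⟩
        · exact ⟨hJ h.1, Or.inr h⟩
      · tauto
    · rw [Finset.disjoint_left]
      intro k h1 h2
      rw [Finset.mem_filter] at h1 h2
      exact hA k h2.1 h1.2 h2.2
    · intro d
      simp only [Set.mem_inter_iff, hN, Finset.mem_filter]
      constructor
      · rintro ⟨⟨k, hk, rfl⟩ | ⟨k, hk, rfl⟩, hd⟩
        · exact Or.inl ⟨k, ⟨hk, hd⟩, rfl⟩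
        · exact Or.inr ⟨k, ⟨hk, hd⟩, rfl⟩
      · rintro (⟨k, ⟨hk, hd⟩, rfl⟩ | ⟨k, ⟨hk, hd⟩, rfl⟩)
        · exact ⟨Or.inl ⟨k, hk, rfl⟩, hd⟩
        · exact ⟨Or.inr ⟨k, hk, rfl⟩, hd⟩
  refine ⟨count I subset_rfl J subset_rfl N hN, ?_, ?_⟩
  · rw [hcard]
    exact Finset.card_filter_le _ _
  · rw [hcard, Finset.card_filter_eq_iff]

/-- A strictly monotone self-map of a finite linear order, given by a group action, is trivial. -/
theorem smul_eq_of_strictMono {X W : Type*} [LinearOrder X] [Finite X] [Group W] [MulAction W X]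
    {w : W} (h : ∀ p q : X, p < q → w • p < w • q) (p : X) : w • p = p := by
  have hmono : StrictMono fun p : X => w • p := fun p q hpq => h p q hpq
  let e : X ≃o X := hmono.orderIsoOfSurjective _ (MulAction.surjective w)
  have : e = OrderIso.refl X := Subsingleton.elim _ _
  exact congrArg (fun e : X ≃o X => e p) this

/-! ### Type `A` -/

theorem arcA_iff {n : ℕ} {c : Fin n × Fin n} (hc : c ∈ boxesA n) (d : Fin n × Fin n) :
    (digraphA n).Arc c d ↔ (∃ k ∈ Finset.Ioo c.1 c.2, d = (c.1, k)) ∨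
      ∃ k ∈ Finset.Ioo c.1 c.2, d = (k, c.2) := by
  constructor
  · rintro ⟨-, -, hne, hd | ⟨k, h1, h2, rfl | rfl⟩⟩
    · exact absurd hd.symm hne
    · exact Or.inl ⟨k, Finset.mem_Ioo.2 ⟨h1, h2⟩, rfl⟩
    · exact Or.inr ⟨k, Finset.mem_Ioo.2 ⟨h1, h2⟩, rfl⟩
  · rintro (⟨k, hk, rfl⟩ | ⟨k, hk, rfl⟩)
    · rw [Finset.mem_Ioo] at hk
      exact ⟨hc, hk.1, fun h => hk.2.ne (congrArg Prod.snd h).symm,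
        Or.inr ⟨k, hk.1, hk.2, Or.inl rfl⟩⟩
    · rw [Finset.mem_Ioo] at hk
      exact ⟨hc, hk.2, fun h => hk.1.ne (congrArg Prod.fst h), Or.inr ⟨k, hk.1, hk.2, Or.inr rfl⟩⟩

theorem tight_iffA {n : ℕ} (w : Equiv.Perm (Fin n)) {c : Fin n × Fin n} (hc : c ∈ boxesA n)
    (h : w⁻¹ • c.1 < w⁻¹ • c.2) :
    (digraphA n).val c = (Finset.Ioo c.1 c.2).card ∧
    ({d | (digraphA n).Arc c d} ∩ {c ∈ boxesA n | w⁻¹ • c.2 < w⁻¹ • c.1}).ncard ≤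
      (digraphA n).val c ∧
    (({d | (digraphA n).Arc c d} ∩ {c ∈ boxesA n | w⁻¹ • c.2 < w⁻¹ • c.1}).ncard =
      (digraphA n).val c ↔ IsTight w c) := by
  obtain ⟨h0, h1, h2⟩ := ncard_hook_inter (N := {d | (digraphA n).Arc c d})
    (A := {c ∈ boxesA n | w⁻¹ • c.2 < w⁻¹ • c.1})
    (subset_refl (Finset.Ioo c.1 c.2)) (fun k => (c.1, k)) (fun k => (k, c.2))
    (fun _ _ _ _ e => congrArg Prod.snd e) (fun _ _ _ _ e => congrArg Prod.fst e)
    (fun i _ j hj e => (Finset.mem_Ioo.1 hj).1.ne (congrArg Prod.fst e)) (arcA_iff hc)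
    (fun k _ h1 h2 => (h1.2.trans h).asymm h2.2)
  have hval : (digraphA n).val c = (Finset.Ioo c.1 c.2).card := by
    change {d | (digraphA n).Arc c d}.ncard / 2 = _
    omega
  refine ⟨hval, hval ▸ h1, ?_⟩
  rw [hval, h2]
  constructor
  · intro ht k hk1 hk2 hk
    rcases ht k (Finset.mem_Ioo.2 ⟨hk1, hk2⟩) with ht | ⟨-, ht⟩
    · exact hk.1.asymm ht.2
    · exact hk.2.asymm ht.2
  · intro ht k hk
    have hk' := Finset.mem_Ioo.1 hk
    by_cases h3 : w⁻¹ • k < w⁻¹ • c.1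
    · exact Or.inl ⟨hk'.1, h3⟩
    · refine Or.inr ⟨hk, hk'.2, ?_⟩
      have := smul_lt_of_not_lt w⁻¹ hk'.1.ne h3
      exact smul_lt_of_not_lt w⁻¹ hk'.2.ne' fun h4 => ht k hk'.1 hk'.2 ⟨this, h4⟩

theorem swap_lt_swap_iff {n : ℕ} {i j : Fin n} (hij : (i : ℕ) + 1 = j) (p q : Fin n) (hpq : p < q) :
    Equiv.swap i j q < Equiv.swap i j p ↔ p = i ∧ q = j := by
  simp only [Equiv.swap_apply_def, Fin.lt_def, Fin.ext_iff] at hpq ⊢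
  split_ifs <;> omega

theorem isSimpleAt_swap {n : ℕ} {i j : Fin n} (hij : (i : ℕ) + 1 = j) :
    IsSimpleAt (W := Equiv.Perm (Fin n)) ⟨Eq, eq_equivalence⟩ (Equiv.swap i j) i j := by
  refine ⟨Equiv.swap_inv i j, fun p q hpq => ?_⟩
  rw [Equiv.Perm.smul_def, Equiv.Perm.smul_def, swap_lt_swap_iff hij p q hpq]
  exact ⟨fun h => Prod.ext h.1 h.2, Prod.mk.inj⟩

theorem covBy_iff_val_add_one {n : ℕ} {i j : Fin n} : i ⋖ j ↔ (i : ℕ) + 1 = j := by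
  rw [Fin.covBy_iff, Nat.covBy_iff_add_one_eq]

/-- The symmetric group: all pairs `a < b` are boxes, and distinct pairs are inequivalent. -/
noncomputable def modelA (n : ℕ) : WeakOrderModel (Fin n) (Equiv.Perm (Fin n)) where
  gens := simpleA n
  G := digraphA n
  rel := ⟨Eq, eq_equivalence⟩
  rel_smul := by rintro w c _ rfl; rfl
  rel_lt := by rintro c _ rfl h; exact h
  rel_tight := by rintro w c _ rfl h; exact h
  lt_of_mem _ h := h
  eq_of_rel _ _ _ _ h := h
  exists_rel _ c h _ := ⟨c, h, rfl⟩
  eq_one _ h := Equiv.ext (smul_eq_of_strictMono h)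
  finite _ := Set.toFinite _
  exists_gen i j h := ⟨_, ⟨i, j, covBy_iff_val_add_one.1 h, rfl⟩,
    isSimpleAt_swap (covBy_iff_val_add_one.1 h)⟩
  gen_simple := by
    rintro _ ⟨i, j, h, rfl⟩
    exact ⟨i, j, covBy_iff_val_add_one.2 h, isSimpleAt_swap h⟩
  tight w _ hc h := (tight_iffA w hc h).2
  arc_rel z c h := by
    rcases (arcA_iff h.1 c).1 h with ⟨k, hk, rfl⟩ | ⟨k, hk, rfl⟩
    · exact ⟨k, (Finset.mem_Ioo.1 hk).1, (Finset.mem_Ioo.1 hk).2, Or.inl rfl⟩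
    · exact ⟨k, (Finset.mem_Ioo.1 hk).1, (Finset.mem_Ioo.1 hk).2, Or.inr rfl⟩
  arc_right := by
    rintro c hc _ hz k hk rfl
    exact (arcA_iff hz c).2 (Or.inl ⟨c.2, Finset.mem_Ioo.2 ⟨hc, hk⟩, rfl⟩)
  arc_left := by
    rintro c hc _ hz k hk rfl
    exact (arcA_iff hz c).2 (Or.inr ⟨c.1, Finset.mem_Ioo.2 ⟨hk, hc⟩, rfl⟩)
  escape w c hc ht hlt hcov := by
    rcases exists_between_outside ht hlt hcov with ⟨k, hk, h1, h2⟩ | ⟨k, hk, h1, h2⟩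
    · exact Or.inl ⟨k, hk, h1, h2, fun m hm _ _ _ => ⟨_, hm, rfl⟩⟩
    · exact Or.inr ⟨k, hk, h1, h2, fun m _ hm _ _ => ⟨_, hm, rfl⟩⟩

/-! ### Type `B` -/

namespace SignedIdx

variable {n : ℕ}

@[simp] theorem val_neg (m : SignedIdx n) : m.neg.1 = -m.1 := rfl

@[simp] theorem neg_neg (m : SignedIdx n) : m.neg.neg = m := Subtype.ext (_root_.neg_neg m.1)

theorem lt_iff {a b : SignedIdx n} : a < b ↔ a.1 < b.1 := Iff.rfl

theorem smul_neg (w : SignedPerm n) (m : SignedIdx n) : w • m.neg = (w • m).neg := w.2 m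

@[simp] theorem val_smul_neg (w : SignedPerm n) (m : SignedIdx n) :
    (w • m.neg).1 = -(w • m).1 := by
  rw [smul_neg, val_neg]

instance : Finite (SignedIdx n) :=
  Set.Finite.to_subtype (s := {m : ℤ | m ≠ 0 ∧ |m| ≤ n})
    ((Set.finite_Icc (-n : ℤ) n).subset fun _ hm => abs_le.1 hm.2)

/-- The entries adjacent in `[±n]` are the consecutive integers and the pair `-1, 1`. -/
theorem covBy_iff {a b : SignedIdx n} :
    a ⋖ b ↔ b.1 = a.1 + 1 ∨ (a.1 = -1 ∧ b.1 = 1) := by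
  have ha := a.2.1
  have hb := b.2.1
  have han := abs_le.1 a.2.2
  have hbn := abs_le.1 b.2.2
  constructor
  · intro h
    have hlt : a.1 < b.1 := h.1
    by_contra hne
    rw [not_or, not_and] at hne
    have key : ∀ k : ℤ, k ≠ 0 → ¬ (a.1 < k ∧ k < b.1) := fun k hk hk' =>
      h.2 (c := ⟨k, hk, abs_le.2 ⟨by omega, by omega⟩⟩) hk'.1 hk'.2
    have h1 := key (a.1 + 1)
    have h2 := key (b.1 - 1)
    omega
  · intro h
    refine ⟨lt_iff.2 (by omega), fun k h1 h2 => ?_⟩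
    have := k.2.1
    rw [lt_iff] at h1 h2
    omega

end SignedIdx

section

variable {n : ℕ}

open SignedIdx

theorem mem_boxesB {c : SignedIdx n × SignedIdx n} :
    c ∈ boxesB n ↔ c.1.1 < c.2.1 ∧ -c.2.1 ≤ c.1.1 := by
  simp only [boxesB, Set.mem_ofPred_eq, lt_iff, abs_le]
  exact ⟨fun h => ⟨h.1, h.2.1⟩, fun h => ⟨h.1, h.2, h.1.le⟩⟩

/-- The equivalence `(a, b) ∼ (-b, -a)`. -/
def relB (n : ℕ) : Setoid (SignedIdx n × SignedIdx n) where
  r c d := d = c ∨ d = (c.2.neg, c.1.neg)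
  iseqv :=
    { refl := fun _ => Or.inl rfl
      symm := by rintro c _ (rfl | rfl) <;> simp
      trans := by rintro c _ _ (rfl | rfl) (rfl | rfl) <;> simp }

/-- The representative in the shifted diagram of an increasing pair. -/
def repB (c : SignedIdx n × SignedIdx n) : SignedIdx n × SignedIdx n :=
  if -c.2.1 ≤ c.1.1 then c else (c.2.neg, c.1.neg)

theorem relB_repB (c : SignedIdx n × SignedIdx n) : relB n c (repB c) := by
  unfold repB
  split_ifs
  · exact Or.inl rfl
  · exact Or.inr rfl

theorem repB_mem {c : SignedIdx n × SignedIdx n} (h : c.1 < c.2) : repB c ∈ boxesB n := by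
  rw [lt_iff] at h
  unfold repB
  rw [mem_boxesB]
  split_ifs with h'
  · exact ⟨h, h'⟩
  · simp only [val_neg]
    omega

theorem relB_smul (w : SignedPerm n) (c d : SignedIdx n × SignedIdx n) (h : relB n c d) :
    relB n (w • c) (w • d) := by
  rcases h with rfl | rfl
  · exact Or.inl rfl
  · exact Or.inr (Prod.ext (smul_neg w c.2) (smul_neg w c.1))

theorem relB_lt (c d : SignedIdx n × SignedIdx n) (h : relB n c d) (hc : c.1 < c.2) :
    d.1 < d.2 := by
  rcases h with rfl | rfl
  · exact hc
  · rw [lt_iff] at hc ⊢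
    simp only [val_neg]
    omega

theorem relB_tight (w : SignedPerm n) (c d : SignedIdx n × SignedIdx n) (h : relB n c d)
    (ht : IsTight w c) : IsTight w d := by
  rcases h with rfl | rfl
  · exact ht
  · intro k h1 h2 h3
    simp only [lt_iff, val_neg, val_smul_neg] at h1 h2 h3
    refine ht k.neg ?_ ?_ ?_ <;> simp only [lt_iff, val_neg, val_smul_neg] <;> omega

theorem eq_of_relB {c : SignedIdx n × SignedIdx n} (hc : c ∈ boxesB n)
    {d : SignedIdx n × SignedIdx n} (hd : d ∈ boxesB n) (h : relB n c d) : c = d := by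
  rcases h with rfl | rfl
  · rfl
  · rw [mem_boxesB] at hc hd
    simp only [val_neg] at hd
    refine Prod.ext (Subtype.ext ?_) (Subtype.ext ?_) <;> simp only [val_neg] <;> omega

theorem repB_mem_inv (w : SignedPerm n) {c : SignedIdx n × SignedIdx n} (h : c.1 < c.2) :
    repB c ∈ {c ∈ boxesB n | w⁻¹ • c.2 < w⁻¹ • c.1} ↔ w⁻¹ • c.2 < w⁻¹ • c.1 := by
  rw [Set.mem_ofPred_eq, and_iff_right (repB_mem h)]
  unfold repB
  split_ifs
  · rfl
  · simp only [lt_iff, val_smul_neg]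
    omega

/-- The out-neighbours of a box, up to the identification of `(a, b)` with `(-b, -a)`. -/
theorem arcB_iff {c : SignedIdx n × SignedIdx n} (hc : c ∈ boxesB n)
    (d : SignedIdx n × SignedIdx n) :
    (digraphB n).Arc c d ↔ (∃ k ∈ Finset.Ioo c.1 c.2, d = repB (c.1, k)) ∨
      ∃ k ∈ Finset.Ioo c.1 c.2, d = (k, c.2) := by
  have hc' := mem_boxesB.1 hc
  simp only [Finset.mem_Ioo]
  constructor
  · rintro ⟨-, hd, hne, hd' | ⟨k, h1, h2, rfl | rfl | rfl⟩⟩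
    · exact absurd hd'.symm hne
    · exact Or.inr ⟨k, ⟨h1, h2⟩, rfl⟩
    · rw [mem_boxesB] at hd
      exact Or.inl ⟨k, ⟨h1, h2⟩, (if_pos hd.2).symm⟩
    · refine Or.inl ⟨k, ⟨h1, h2⟩, eq_of_relB hd (repB_mem h1) ?_⟩
      exact (relB n).trans ((relB n).symm (Or.inr rfl)) (relB_repB (c.1, k))
  · rintro (⟨k, hk, rfl⟩ | ⟨k, hk, rfl⟩)
    · refine ⟨hc, repB_mem hk.1, ?_, Or.inr ⟨k, hk.1, hk.2, ?_⟩⟩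
      · simp only [lt_iff] at hk
        intro h
        have e1 := congrArg (fun d => d.1.1) h
        have e2 := congrArg (fun d => d.2.1) h
        simp only [repB] at e1 e2
        split_ifs at e1 e2
        · simp only at e2
          omega
        · simp only [val_neg] at e1 e2
          omega
      · unfold repB
        split_ifs
        · exact Or.inr (Or.inl rfl)
        · exact Or.inr (Or.inr rfl)
    · simp only [lt_iff] at hk
      refine ⟨hc, mem_boxesB.2 (by simp only; omega), ?_, Or.inr ⟨k, hk.1, hk.2, Or.inl rfl⟩⟩
      intro h
      have := congrArg (fun d => d.1.1) h
      simp only at this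
      omega

/-- On a box `(-b, b)` each out-neighbour arises twice; positive `k` lists them once. -/
theorem arcB_iff_of_symm {c : SignedIdx n × SignedIdx n} (hc : c ∈ boxesB n) (h : c.1 = c.2.neg)
    (d : SignedIdx n × SignedIdx n) :
    (digraphB n).Arc c d ↔
      (∃ k ∈ (Finset.Ioo c.1 c.2).filter (fun k : SignedIdx n => 0 < k.1), d = (k.neg, c.2)) ∨
      ∃ k ∈ (Finset.Ioo c.1 c.2).filter (fun k : SignedIdx n => 0 < k.1), d = (k, c.2) := by
  have h' : c.1.1 = -c.2.1 := congrArg Subtype.val h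
  rw [arcB_iff hc]
  simp only [Finset.mem_filter, Finset.mem_Ioo, lt_iff]
  constructor
  · intro hd
    obtain ⟨k, h1, h2, rfl⟩ : ∃ k : SignedIdx n, c.1.1 < k.1 ∧ k.1 < c.2.1 ∧ d = (k, c.2) := by
      rcases hd with ⟨k, hk, rfl⟩ | ⟨k, hk, rfl⟩
      · refine ⟨k.neg, ?_, ?_, ?_⟩
        · simp only [val_neg]; omega
        · simp only [val_neg]; omega
        · rw [repB, if_neg (by simp only; omega), h, neg_neg]
      · exact ⟨k, hk.1, hk.2, rfl⟩
    by_cases hk : 0 < k.1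
    · exact Or.inr ⟨k, ⟨⟨h1, h2⟩, hk⟩, rfl⟩
    · have := k.2.1
      refine Or.inl ⟨k.neg, ⟨⟨?_, ?_⟩, ?_⟩, by rw [neg_neg]⟩ <;> simp only [val_neg] <;> omega
  · rintro (⟨k, hk, rfl⟩ | ⟨k, hk, rfl⟩)
    · refine Or.inr ⟨k.neg, ⟨?_, ?_⟩, rfl⟩ <;> simp only [val_neg] <;> omega
    · exact Or.inr ⟨k, hk.1, rfl⟩

theorem tightB_of_ne (w : SignedPerm n) {c : SignedIdx n × SignedIdx n} (hc : c ∈ boxesB n)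
    (hne : c.1 ≠ c.2.neg) (h : w⁻¹ • c.1 < w⁻¹ • c.2) :
    ({d | (digraphB n).Arc c d} ∩ {c ∈ boxesB n | w⁻¹ • c.2 < w⁻¹ • c.1}).ncard ≤
      (digraphB n).val c ∧
    (({d | (digraphB n).Arc c d} ∩ {c ∈ boxesB n | w⁻¹ • c.2 < w⁻¹ • c.1}).ncard =
      (digraphB n).val c ↔ IsTight w c) := by
  have hc' := mem_boxesB.1 hc
  have hne' : c.1.1 ≠ -c.2.1 := fun h => hne (Subtype.ext h)
  have hg : ∀ k : SignedIdx n, c.1.1 < k.1 → k.1 < c.2.1 → (k, c.2) ∈ boxesB n := fun k h1 h2 =>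
    mem_boxesB.2 (by simp only; omega)
  obtain ⟨h0, h1, h2⟩ := ncard_hook_inter (N := {d | (digraphB n).Arc c d})
    (A := {c ∈ boxesB n | w⁻¹ • c.2 < w⁻¹ • c.1})
    (subset_refl (Finset.Ioo c.1 c.2)) (fun k => repB (c.1, k)) (fun k => (k, c.2))
    (by
      intro k hk l hl e
      rw [Finset.mem_coe, Finset.mem_Ioo, lt_iff, lt_iff] at hk hl
      have e1 := congrArg (fun d => d.1.1) e
      have e2 := congrArg (fun d => d.2.1) e
      refine Subtype.ext ?_
      simp only [repB] at e1 e2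
      split_ifs at e1 e2 <;> simp only [val_neg] at e1 e2 <;> omega)
    (fun _ _ _ _ e => congrArg Prod.fst e)
    (by
      intro k hk l hl e
      rw [Finset.mem_Ioo, lt_iff, lt_iff] at hk hl
      have e2 := congrArg (fun d => d.2.1) e
      simp only [repB] at e2
      split_ifs at e2 <;> simp only [val_neg] at e2 <;> omega)
    (arcB_iff hc)
    (fun k hk h1 h2 => by
      rw [repB_mem_inv w (Finset.mem_Ioo.1 hk).1] at h1
      exact (h1.trans h).asymm h2.2)
  have hval : (digraphB n).val c = (Finset.Ioo c.1 c.2).card := by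
    change {d | (digraphB n).Arc c d}.ncard / 2 = _
    omega
  refine ⟨hval ▸ h1, ?_⟩
  rw [hval, h2]
  constructor
  · intro ht k hk1 hk2 hk
    rcases ht k (Finset.mem_Ioo.2 ⟨hk1, hk2⟩) with ht | ⟨-, ht⟩
    · rw [repB_mem_inv w hk1] at ht
      exact hk.1.asymm ht
    · exact hk.2.asymm ht.2
  · intro ht k hk
    have hk' := Finset.mem_Ioo.1 hk
    rw [repB_mem_inv w hk'.1]
    by_cases h3 : w⁻¹ • k < w⁻¹ • c.1
    · exact Or.inl h3
    · refine Or.inr ⟨hk, hg k hk'.1 hk'.2, ?_⟩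
      have := smul_lt_of_not_lt w⁻¹ hk'.1.ne h3
      exact smul_lt_of_not_lt w⁻¹ hk'.2.ne' fun h4 => ht k hk'.1 hk'.2 ⟨this, h4⟩

theorem tightB_of_eq (w : SignedPerm n) {c : SignedIdx n × SignedIdx n} (hc : c ∈ boxesB n)
    (hsymm : c.1 = c.2.neg) (h : w⁻¹ • c.1 < w⁻¹ • c.2) :
    ({d | (digraphB n).Arc c d} ∩ {c ∈ boxesB n | w⁻¹ • c.2 < w⁻¹ • c.1}).ncard ≤
      (digraphB n).val c ∧
    (({d | (digraphB n).Arc c d} ∩ {c ∈ boxesB n | w⁻¹ • c.2 < w⁻¹ • c.1}).ncard =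
      (digraphB n).val c ↔ IsTight w c) := by
  have hc' := mem_boxesB.1 hc
  have hs : c.1.1 = -c.2.1 := congrArg Subtype.val hsymm
  have hpos : (w⁻¹ • c.1).1 = -(w⁻¹ • c.2).1 := by rw [hsymm, val_smul_neg]
  have hg : ∀ k : SignedIdx n, c.1.1 < k.1 → k.1 < c.2.1 → (k, c.2) ∈ boxesB n := fun k h1 h2 =>
    mem_boxesB.2 (by simp only; omega)
  rw [lt_iff] at h
  obtain ⟨h0, h1, h2⟩ := ncard_hook_inter (N := {d | (digraphB n).Arc c d})
    (A := {c ∈ boxesB n | w⁻¹ • c.2 < w⁻¹ • c.1})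
    (subset_refl ((Finset.Ioo c.1 c.2).filter (fun k : SignedIdx n => 0 < k.1)))
    (fun k => (k.neg, c.2)) (fun k => (k, c.2))
    (by
      intro k _ l _ e
      have := congrArg (fun d => d.1.neg) e
      simpa using this)
    (fun _ _ _ _ e => congrArg Prod.fst e)
    (by
      intro k hk l hl e
      rw [Finset.mem_filter] at hk hl
      have e1 := congrArg (fun d => d.1.1) e
      simp only [val_neg] at e1
      omega)
    (arcB_iff_of_symm hc hsymm)
    (fun k hk h1 h2 => by
      have h1 := h1.2
      have h2 := h2.2
      simp only [lt_iff, val_smul_neg] at h1 h2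
      omega)
  have hval : (digraphB n).val c =
      ((Finset.Ioo c.1 c.2).filter (fun k : SignedIdx n => 0 < k.1)).card := by
    change {d | (digraphB n).Arc c d}.ncard / 2 = _
    omega
  refine ⟨hval ▸ h1, ?_⟩
  rw [hval, h2]
  simp only [Finset.mem_filter, Finset.mem_Ioo, Set.mem_ofPred_eq, lt_iff, val_smul_neg]
  constructor
  · intro ht k hk1 hk2 hk
    have hk0 := k.2.1
    simp only [lt_iff] at hk1 hk2 hk
    by_cases hk3 : 0 < k.1
    · have := ht k ⟨⟨hk1, hk2⟩, hk3⟩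
      omega
    · have := ht k.neg (by simp only [val_neg]; omega)
      simp only [val_smul_neg] at this
      omega
  · intro ht k hk
    have h3 := ht k hk.1.1 hk.1.2
    have h4 : (w⁻¹ • k).1 ≠ (w⁻¹ • c.2).1 := fun e => by
      have := smul_left_cancel _ (Subtype.ext e)
      rw [this] at hk
      omega
    have h5 : (w⁻¹ • k).1 ≠ (w⁻¹ • c.1).1 := fun e => by
      have := smul_left_cancel _ (Subtype.ext e)
      rw [this] at hk
      omega
    simp only [lt_iff] at h3
    by_cases h6 : (w⁻¹ • c.2).1 < (w⁻¹ • k).1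
    · exact Or.inr ⟨hk, hg k hk.1.1 hk.1.2, h6⟩
    · refine Or.inl ⟨hg k.neg ?_ ?_, ?_⟩
      · simp only [val_neg]; omega
      · simp only [val_neg]; omega
      · omega

theorem val_swap {i j : SignedIdx n} (m : SignedIdx n) :
    (Equiv.swap i j m).1 = if m.1 = i.1 then j.1 else if m.1 = j.1 then i.1 else m.1 := by
  simp only [Equiv.swap_apply_def, Subtype.ext_iff]
  split_ifs <;> rfl

theorem val_swap_mul_swap {i j : SignedIdx n} (hi : 1 ≤ i.1) (hij : j.1 = i.1 + 1)
    (m : SignedIdx n) :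
    ((Equiv.swap i j * Equiv.swap i.neg j.neg) m).1 =
      if m.1 = i.1 then i.1 + 1 else if m.1 = i.1 + 1 then i.1 else
      if m.1 = -i.1 then -(i.1 + 1) else if m.1 = -(i.1 + 1) then -i.1 else m.1 := by
  rw [Equiv.Perm.mul_apply, val_swap, val_swap, val_neg, val_neg, hij]
  split_ifs <;> omega

theorem isSimpleAt_zeroB {i : SignedIdx n} (hi : i.1 = 1) {s : SignedPerm n}
    (hs : s.1 = Equiv.swap i i.neg) : IsSimpleAt (relB n) s i.neg i := by
  have hv : ∀ m : SignedIdx n, (s • m).1 =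
      if m.1 = 1 then -1 else if m.1 = -1 then 1 else m.1 := fun m => by
    change (s.1 m).1 = _
    rw [hs, val_swap, val_neg, hi]
  refine ⟨inv_eq_of_mul_eq_one_left (Subtype.ext ?_), fun p q hpq => ?_⟩
  · change s.1 * s.1 = 1
    rw [hs, Equiv.swap_mul_self]
  · have hp := p.2.1
    have hq := q.2.1
    have hr : relB n (p, q) (i.neg, i) ↔ p.1 = -1 ∧ q.1 = 1 := by
      change (_ = _ ∨ _ = _) ↔ _
      simp only [Prod.mk.injEq, Subtype.ext_iff, val_neg, hi]
      omega
    rw [hr, lt_iff, hv, hv]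
    rw [lt_iff] at hpq
    split_ifs <;> omega

theorem isSimpleAt_succB {i j : SignedIdx n} (hi : 1 ≤ i.1) (hij : j.1 = i.1 + 1)
    {s : SignedPerm n} (hs : s.1 = Equiv.swap i j * Equiv.swap i.neg j.neg) :
    IsSimpleAt (relB n) s i j := by
  have hv : ∀ m : SignedIdx n, (s • m).1 =
      if m.1 = i.1 then i.1 + 1 else if m.1 = i.1 + 1 then i.1 else
      if m.1 = -i.1 then -(i.1 + 1) else if m.1 = -(i.1 + 1) then -i.1 else m.1 := fun m =>
    (congrArg (fun s : Equiv.Perm (SignedIdx n) => (s m).1) hs).trans (val_swap_mul_swap hi hij m)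
  refine ⟨inv_eq_of_mul_eq_one_left (Subtype.ext (Equiv.ext fun m => Subtype.ext ?_)),
    fun p q hpq => ?_⟩
  · change (s • (s • m)).1 = m.1
    rw [hv, hv]
    split_ifs <;> omega
  · have hp := p.2.1
    have hq := q.2.1
    have hr : relB n (p, q) (i, j) ↔
        p.1 = i.1 ∧ q.1 = i.1 + 1 ∨ p.1 = -(i.1 + 1) ∧ q.1 = -i.1 := by
      change (_ = _ ∨ _ = _) ↔ _
      simp only [Prod.mk.injEq, Subtype.ext_iff, val_neg, hij]
      omega
    rw [hr, lt_iff, hv, hv]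
    rw [lt_iff] at hpq
    split_ifs <;> omega

theorem exists_succB {i j : SignedIdx n} (hi : 1 ≤ i.1) (hij : j.1 = i.1 + 1) :
    ∃ s ∈ simpleB n, IsSimpleAt (relB n) s i j := by
  have hmem : Equiv.swap i j * Equiv.swap i.neg j.neg ∈ SignedPerm n := by
    intro m
    refine Subtype.ext ?_
    rw [val_neg, val_swap_mul_swap hi hij, val_swap_mul_swap hi hij, val_neg]
    have := m.2.1
    split_ifs <;> omega
  exact ⟨⟨_, hmem⟩, Or.inr ⟨i, j, hi, hij, rfl⟩, isSimpleAt_succB hi hij rfl⟩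

theorem exists_genB (i j : SignedIdx n) (h : i ⋖ j) :
    ∃ s ∈ simpleB n, IsSimpleAt (relB n) s i j := by
  have hi := i.2.1
  rcases covBy_iff.1 h with h | ⟨h1, h2⟩
  · by_cases hpos : 1 ≤ i.1
    · exact exists_succB hpos h
    · have hj := j.2.1
      obtain ⟨s, hs, hsij⟩ := exists_succB (i := j.neg) (j := i.neg)
        (by simp only [val_neg]; omega) (by simp only [val_neg]; omega)
      exact ⟨s, hs, hsij.of_rel (Or.inr (by simp))⟩
  · obtain rfl : i = j.neg := Subtype.ext (by simp only [val_neg]; omega)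
    have hmem : Equiv.swap j j.neg ∈ SignedPerm n := by
      intro m
      refine Subtype.ext ?_
      rw [val_neg, val_swap, val_swap, val_neg, val_neg, h2]
      split_ifs <;> omega
    exact ⟨⟨_, hmem⟩, Or.inl ⟨j, h2, rfl⟩, isSimpleAt_zeroB h2 rfl⟩

/-- The group `Bₙ`: the boxes represent all pairs `a < b` up to `(a, b) ∼ (-b, -a)`. -/
noncomputable def modelB (n : ℕ) : WeakOrderModel (SignedIdx n) (SignedPerm n) where
  gens := simpleB n
  G := digraphB n
  rel := relB n
  rel_smul := relB_smul
  rel_lt := relB_lt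
  rel_tight := relB_tight
  lt_of_mem _ h := h.1
  eq_of_rel _ hc _ hd h := eq_of_relB hc hd h
  exists_rel _ c h _ := ⟨repB c, repB_mem h, relB_repB c⟩
  eq_one _ h := Subtype.ext (Equiv.ext (smul_eq_of_strictMono h))
  finite _ := Set.toFinite _
  exists_gen := exists_genB
  gen_simple := by
    rintro s (⟨i, hi, hs⟩ | ⟨i, j, hi, hij, hs⟩)
    · exact ⟨i.neg, i, covBy_iff.2 (Or.inr ⟨by simp [hi], hi⟩), isSimpleAt_zeroB hi hs⟩
    · exact ⟨i, j, covBy_iff.2 (Or.inl hij), isSimpleAt_succB hi hij hs⟩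
  tight w c hc h := by
    by_cases hs : c.1 = c.2.neg
    · exact tightB_of_eq w hc hs h
    · exact tightB_of_ne w hc hs h
  arc_rel z c h := by
    rcases (arcB_iff h.1 c).1 h with ⟨k, hk, rfl⟩ | ⟨k, hk, rfl⟩
    · exact ⟨k, (Finset.mem_Ioo.1 hk).1, (Finset.mem_Ioo.1 hk).2,
        Or.inl ((relB n).symm (relB_repB _))⟩
    · exact ⟨k, (Finset.mem_Ioo.1 hk).1, (Finset.mem_Ioo.1 hk).2, Or.inr ((relB n).refl _)⟩
  arc_right := by
    rintro ⟨a, b⟩ hc z hz k hk (rfl | rfl)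
    · exact ⟨hz, hc, fun h => hk.ne (congrArg Prod.snd h).symm,
        Or.inr ⟨b, hc.1, hk, Or.inr (Or.inl rfl)⟩⟩
    · -- `(-k, -a)` is not a box, as `|a| ≤ b < k`
      have h1 := (mem_boxesB.1 hc).2
      have h2 := (mem_boxesB.1 hz).2
      rw [lt_iff] at hk
      simp only [val_neg] at h1 h2 hk
      omega
  arc_left := by
    rintro ⟨a, b⟩ hc z hz k hk (rfl | rfl)
    · exact ⟨hz, hc, fun h => hk.ne (congrArg Prod.fst h),
        Or.inr ⟨a, hk, hc.1, Or.inl rfl⟩⟩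
    · have h1 := mem_boxesB.1 hc
      rw [lt_iff] at hk
      simp only at h1 hk
      refine ⟨hz, hc, fun h => ?_, Or.inr ⟨a.neg, ?_, ?_, Or.inr (Or.inr (by simp))⟩⟩
      · have e1 := congrArg (fun d => d.1.1) h
        have e2 := congrArg (fun d => d.2.1) h
        simp only [val_neg] at e1 e2
        omega
      · simp only [lt_iff, val_neg]; omega
      · simp only [lt_iff, val_neg]; omega
  escape w c hc ht hlt hcov := by
    rcases exists_between_outside ht hlt hcov with ⟨k, hk, h1, h2⟩ | ⟨k, hk, h1, h2⟩
    · exact Or.inl ⟨k, hk, h1, h2, fun m hm _ _ _ => ⟨_, repB_mem hm, relB_repB _⟩⟩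
    · exact Or.inr ⟨k, hk, h1, h2, fun m _ hm _ _ => ⟨_, repB_mem hm, relB_repB _⟩⟩

theorem inv_modelB (n : ℕ) : (modelB n).inv = invB := by
  funext w
  ext c
  exact and_assoc

end

/-! ### Type `Ã` -/

section

variable {n : ℕ}

theorem affine_smul_add (w : AffinePerm n) (q k : ℤ) : w • (q + k * n) = w • q + k * n :=
  w.2.1 q k

theorem affine_smul_sub (w : AffinePerm n) (q k : ℤ) : w • (q - k * n) = w • q - k * n := by
  have := affine_smul_add w q (-k)
  rwa [neg_mul, ← sub_eq_add_neg, ← sub_eq_add_neg] at this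

/-- The interval `[1, n]` is a fundamental domain for the translations by `n`. -/
theorem eq_of_dvd_sub {a b : ℤ} (ha : 1 ≤ a) (ha' : a ≤ n) (hb : 1 ≤ b) (hb' : b ≤ n)
    (h : (n : ℤ) ∣ a - b) : a = b := by
  obtain ⟨k, hk⟩ := h
  have h1 : k < 1 := by nlinarith
  have h2 : -1 < k := by nlinarith
  obtain rfl : k = 0 := by omega
  linarith

theorem dvd_sub_add_mul_iff (q k i : ℤ) : (n : ℤ) ∣ q + k * n - i ↔ (n : ℤ) ∣ q - i := by
  rw [show q + k * n - i = (q - i) + n * k by ring]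
  exact dvd_add_left (Dvd.intro k rfl)

theorem not_dvd_of_small {x d : ℤ} (h : (n : ℤ) ∣ x) (hd : 0 < d) (hd' : d < n) :
    ¬ (n : ℤ) ∣ x + d := fun h' => by
  have := Int.le_of_dvd hd ((Int.dvd_add_right h).1 h')
  omega

/-- The translation equivalence `(a, b) ∼ (a + kn, b + kn)`. -/
def relCyl (n : ℕ) : Setoid (ℤ × ℤ) where
  r c d := ∃ k : ℤ, d = (c.1 + k * n, c.2 + k * n)
  iseqv :=
    { refl := fun _ => ⟨0, by simp⟩
      symm := by
        rintro c _ ⟨k, rfl⟩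
        exact ⟨-k, by simp⟩
      trans := by
        rintro c _ _ ⟨k, rfl⟩ ⟨l, rfl⟩
        exact ⟨k + l, by simp only [Prod.mk.injEq]; constructor <;> ring⟩ }

/-- The translate of a pair with first entry in `[1, n]`. -/
def repCyl (n : ℕ) (c : ℤ × ℤ) : ℤ × ℤ :=
  (c.1 - (c.1 - 1) / n * n, c.2 - (c.1 - 1) / n * n)

theorem relCyl_repCyl (c : ℤ × ℤ) : relCyl n c (repCyl n c) :=
  ⟨-((c.1 - 1) / n), by simp only [repCyl, Prod.mk.injEq]; constructor <;> ring⟩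

theorem mem_boxesCyl {c : ℤ × ℤ} :
    c ∈ boxesCyl n ↔ 1 ≤ c.1 ∧ c.1 ≤ n ∧ ¬ (n : ℤ) ∣ c.2 - c.1 ∧ c.1 < c.2 := by
  rw [boxesCyl, Set.mem_ofPred_eq, Int.modEq_comm, Int.modEq_iff_dvd]

theorem repCyl_mem (hn : 0 < n) {c : ℤ × ℤ} (h : c.1 < c.2) (hc : ¬ (n : ℤ) ∣ c.2 - c.1) :
    repCyl n c ∈ boxesCyl n := by
  have hn' : (0 : ℤ) < n := by exact_mod_cast hn
  have h1 := Int.emod_add_mul_ediv (c.1 - 1) n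
  have h2 := Int.emod_nonneg (c.1 - 1) hn'.ne'
  have h3 := Int.emod_lt_of_pos (c.1 - 1) hn'
  rw [mul_comm] at h1
  rw [mem_boxesCyl]
  simp only [repCyl, sub_sub_sub_cancel_right]
  exact ⟨by omega, by omega, hc, by omega⟩

theorem eq_of_relCyl {c d : ℤ × ℤ} (hc : c ∈ boxesCyl n) (hd : d ∈ boxesCyl n)
    (h : relCyl n c d) : c = d := by
  obtain ⟨k, rfl⟩ := h
  rw [mem_boxesCyl] at hc hd
  have h := eq_of_dvd_sub hd.1 hd.2.1 hc.1 hc.2.1 ⟨k, by simp only; ring⟩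
  simp only at h
  refine Prod.ext ?_ ?_ <;> simp only <;> omega

theorem relCyl_tight (w : AffinePerm n) (c d : ℤ × ℤ) (h : relCyl n c d) (ht : IsTight w c) :
    IsTight w d := by
  obtain ⟨k, rfl⟩ := h
  intro x h1 h2 h3
  obtain ⟨y, rfl⟩ : ∃ y, x = y + k * n := ⟨x - k * n, by ring⟩
  simp only [affine_smul_add] at h1 h2 h3
  exact ht y (by omega) (by omega) (by omega)

/-- An inverted pair is never congruent modulo `n`. -/
theorem not_dvd_of_smul_lt {w : AffinePerm n} {a b : ℤ} (hab : a < b) (h : w • b < w • a) :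
    ¬ (n : ℤ) ∣ b - a := by
  rintro ⟨k, hk⟩
  obtain rfl : b = a + k * n := by linarith
  rw [affine_smul_add] at h
  omega

theorem repCyl_mem_inv (hn : 0 < n) (w : AffinePerm n) {c : ℤ × ℤ} (h : c.1 < c.2) :
    repCyl n c ∈ {c ∈ boxesCyl n | w⁻¹ • c.2 < w⁻¹ • c.1} ↔ w⁻¹ • c.2 < w⁻¹ • c.1 := by
  have e : w⁻¹ • (repCyl n c).2 < w⁻¹ • (repCyl n c).1 ↔ w⁻¹ • c.2 < w⁻¹ • c.1 := by
    simp only [repCyl, affine_smul_sub, sub_lt_sub_iff_right]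
  rw [Set.mem_ofPred_eq, e]
  exact ⟨fun h => h.2, fun h' => ⟨repCyl_mem hn h (not_dvd_of_smul_lt h h'), h'⟩⟩

theorem finite_inv_affine (hn : 0 < n) (w : AffinePerm n) :
    {c ∈ boxesCyl n | w⁻¹ • c.2 < w⁻¹ • c.1}.Finite := by
  have hn' : (0 : ℤ) < n := by exact_mod_cast hn
  set C := ∑ i ∈ Finset.Icc (1 : ℤ) n, |w⁻¹ • i - i| with hC
  -- the displacement is periodic, hence bounded
  have hbound : ∀ q : ℤ, |w⁻¹ • q - q| ≤ C := by
    intro q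
    have h1 := Int.emod_add_mul_ediv (q - 1) n
    have h2 := Int.emod_nonneg (q - 1) hn'.ne'
    have h3 := Int.emod_lt_of_pos (q - 1) hn'
    have hq : q = ((q - 1) % n + 1) + (q - 1) / n * n := by linarith
    have hmem : (q - 1) % n + 1 ∈ Finset.Icc (1 : ℤ) n := by
      rw [Finset.mem_Icc]
      omega
    have := Finset.single_le_sum (f := fun i : ℤ => |w⁻¹ • i - i|) (fun i _ => abs_nonneg _) hmem
    rw [hq, affine_smul_add, add_sub_add_right_eq_sub]
    exact this
  refine ((Set.finite_Icc (1 : ℤ) n).prod (Set.finite_Icc (1 : ℤ) (n + 2 * C))).subset ?_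
  rintro ⟨a, b⟩ ⟨hc, hlt⟩
  rw [mem_boxesCyl] at hc
  have h1 := abs_le.1 (hbound a)
  have h2 := abs_le.1 (hbound b)
  simp only at hc hlt
  simp only [Set.mem_prod, Set.mem_Icc]
  omega

theorem affine_eq_one (hn : 0 < n) (w : AffinePerm n) (h : ∀ p q : ℤ, p < q → w • p < w • q) :
    w = 1 := by
  have hmono : StrictMono fun p : ℤ => w • p := fun p q hpq => h p q hpq
  let e : ℤ ≃o ℤ := hmono.orderIsoOfSurjective _ (MulAction.surjective w)
  have hsucc : ∀ q : ℤ, w • (q + 1) = w • q + 1 := fun q => e.map_succ q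
  have hshift : ∀ q : ℤ, w • q = q + w • (0 : ℤ) := by
    intro q
    induction q using Int.induction_on with
    | zero => simp
    | succ i ih => rw [hsucc, ih]; ring
    | pred i ih =>
      have := hsucc (-(i : ℤ) - 1)
      rw [sub_add_cancel, ih] at this
      linarith
  have hsum : ∑ i ∈ Finset.Icc (1 : ℤ) n, w • i = (n : ℤ) * (n + 1) / 2 := w.2.2
  have h0 : w • (0 : ℤ) = 0 := by
    rw [Finset.sum_congr rfl fun i _ => hshift i, Finset.sum_add_distrib, sum_Icc_one] at hsum
    simp at hsum
    omega
  refine Subtype.ext (Equiv.ext fun q => ?_)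
  change w • q = q
  rw [hshift, h0, add_zero]

/-- The map exchanging `i + kn` and `i + 1 + kn` for all `k`. -/
def affineSwap (n : ℕ) (i q : ℤ) : ℤ :=
  if (n : ℤ) ∣ q - i then q + 1 else if (n : ℤ) ∣ q - i - 1 then q - 1 else q

theorem affineSwap_involutive (hn : 2 ≤ n) (i : ℤ) : Function.Involutive (affineSwap n i) := by
  intro q
  unfold affineSwap
  by_cases h1 : (n : ℤ) ∣ q - i
  · rw [if_pos h1, if_neg, if_pos, add_sub_cancel_right]
    · rwa [show q + 1 - i - 1 = q - i by ring]
    · rw [show q + 1 - i = q - i + 1 by ring]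
      exact not_dvd_of_small h1 one_pos (by omega)
  · rw [if_neg h1]
    by_cases h2 : (n : ℤ) ∣ q - i - 1
    · rw [if_pos h2, if_pos, sub_add_cancel]
      rwa [sub_right_comm]
    · rw [if_neg h2, if_neg h1, if_neg h2]

theorem sum_ite_dvd (hn : 0 < n) (i : ℤ) :
    ∑ q ∈ Finset.Icc (1 : ℤ) n, (if (n : ℤ) ∣ q - i then 1 else 0 : ℤ) = 1 := by
  have hn' : (0 : ℤ) < n := by exact_mod_cast hn
  have h1 := Int.emod_add_mul_ediv (i - 1) n
  have h2 := Int.emod_nonneg (i - 1) hn'.ne'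
  have h3 := Int.emod_lt_of_pos (i - 1) hn'
  have hd : (n : ℤ) ∣ (i - 1) % n + 1 - i := ⟨-((i - 1) / n), by linarith⟩
  rw [Finset.sum_eq_single_of_mem ((i - 1) % n + 1) (by rw [Finset.mem_Icc]; omega), if_pos hd]
  intro q hq hne
  rw [Finset.mem_Icc] at hq
  refine if_neg fun h => hne (eq_of_dvd_sub hq.1 hq.2 (by omega) (by omega) ?_)
  have := Int.dvd_sub h hd
  rwa [sub_sub_sub_cancel_right] at this

theorem affineSwap_mem (hn : 2 ≤ n) (i : ℤ) :
    (affineSwap_involutive hn i).toPerm ∈ AffinePerm n := by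
  constructor
  · intro q k
    simp only [Function.Involutive.coe_toPerm, affineSwap, dvd_sub_add_mul_iff, sub_sub]
    split_ifs <;> ring
  · have e : ∀ q, affineSwap n i q = q + ((if (n : ℤ) ∣ q - i then 1 else 0) -
        (if (n : ℤ) ∣ q - (i + 1) then 1 else 0)) := by
      intro q
      unfold affineSwap
      rw [sub_sub]
      by_cases h1 : (n : ℤ) ∣ q - i
      · have h2 : ¬ (n : ℤ) ∣ q - (i + 1) := fun h2 => by
          refine not_dvd_of_small h2 one_pos (by omega) ?_
          rwa [show q - (i + 1) + 1 = q - i by ring]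
        rw [if_pos h1, if_pos h1, if_neg h2, sub_zero]
      · rw [if_neg h1, if_neg h1]
        split_ifs <;> ring
    simp only [Function.Involutive.coe_toPerm, e, Finset.sum_add_distrib, Finset.sum_sub_distrib]
    rw [sum_ite_dvd (by omega), sum_ite_dvd (by omega), sum_Icc_one, sub_self, add_zero]

theorem isSimpleAt_affineSwap (hn : 2 ≤ n) {i : ℤ} {s : AffinePerm n}
    (hs : ∀ q : ℤ, s • q = affineSwap n i q) : IsSimpleAt (relCyl n) s i (i + 1) := by
  refine ⟨inv_eq_of_mul_eq_one_left (Subtype.ext (Equiv.ext fun q => ?_)), fun p q hpq => ?_⟩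
  · change s • s • q = q
    rw [hs, hs, affineSwap_involutive hn]
  · have hr : relCyl n (p, q) (i, i + 1) ↔ q = p + 1 ∧ (n : ℤ) ∣ p - i := by
      constructor
      · rintro ⟨k, hk⟩
        rw [Prod.mk.injEq] at hk
        exact ⟨by linarith, -k, by linarith⟩
      · rintro ⟨rfl, k, hk⟩
        exact ⟨-k, Prod.ext (by simp only; linarith) (by simp only; linarith)⟩
    rw [hr, hs, hs]
    constructor
    · intro h
      have hq : q = p + 1 := by
        unfold affineSwap at h
        split_ifs at h <;> omega
      subst hq
      refine ⟨rfl, ?_⟩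
      by_contra h1
      unfold affineSwap at h
      rw [if_neg h1, show p + 1 - i - 1 = p - i by ring, if_neg h1] at h
      split_ifs at h <;> omega
    · rintro ⟨rfl, h1⟩
      have h2 : ¬ (n : ℤ) ∣ p + 1 - i := by
        rw [show p + 1 - i = p - i + 1 by ring]
        exact not_dvd_of_small h1 one_pos (by omega)
      unfold affineSwap
      rw [if_neg h2, show p + 1 - i - 1 = p - i by ring, if_pos h1, if_pos h1]
      omega

theorem smul_eq_affineSwap {i : ℤ} {s : AffinePerm n}
    (h1 : ∀ k : ℤ, s.1 (i + k * n) = i + 1 + k * n ∧ s.1 (i + 1 + k * n) = i + k * n)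
    (h2 : ∀ q : ℤ, ¬ q ≡ i [ZMOD n] → ¬ q ≡ i + 1 [ZMOD n] → s.1 q = q) (q : ℤ) :
    s • q = affineSwap n i q := by
  change s.1 q = _
  unfold affineSwap
  rw [sub_sub]
  by_cases h3 : (n : ℤ) ∣ q - i
  · rw [if_pos h3]
    obtain ⟨k, hk⟩ := h3
    obtain rfl : q = i + k * n := by linarith
    rw [(h1 k).1]
    ring
  · rw [if_neg h3]
    by_cases h4 : (n : ℤ) ∣ q - (i + 1)
    · rw [if_pos h4]
      obtain ⟨k, hk⟩ := h4
      obtain rfl : q = i + 1 + k * n := by linarith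
      rw [(h1 k).2]
      ring
    · rw [if_neg h4]
      refine h2 q ?_ ?_ <;> rw [Int.modEq_comm, Int.modEq_iff_dvd] <;> assumption

theorem exists_genAffine (hn : 2 ≤ n) (i : ℤ) :
    ∃ s ∈ simpleAffine n, IsSimpleAt (relCyl n) s i (i + 1) := by
  have hn' : (0 : ℤ) < n := by omega
  have h1 := Int.emod_add_mul_ediv (i - 1) n
  have h2 := Int.emod_nonneg (i - 1) hn'.ne'
  have h3 := Int.emod_lt_of_pos (i - 1) hn'
  set j := (i - 1) % n + 1 with hj
  have hdvd : ∀ q : ℤ, (n : ℤ) ∣ q - j ↔ (n : ℤ) ∣ q - i := fun q => by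
    rw [← dvd_sub_add_mul_iff q ((i - 1) / n) i, show q + (i - 1) / n * n - i = q - j by linarith]
  have hs : ∀ q : ℤ, affineSwap n j q = affineSwap n i q := fun q => by
    unfold affineSwap
    simp only [sub_right_comm _ _ (1 : ℤ), hdvd]
  let s : AffinePerm n := ⟨_, affineSwap_mem hn j⟩
  refine ⟨s, ⟨j, by omega, by omega, fun k => ⟨?_, ?_⟩, fun q hq1 hq2 => ?_⟩,
    isSimpleAt_affineSwap hn hs⟩
  · change affineSwap n j _ = _
    rw [affineSwap, if_pos ⟨k, by ring⟩]
    ring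
  · change affineSwap n j _ = _
    have hne : ¬ (n : ℤ) ∣ j + 1 + k * n - j := by
      rw [show j + 1 + k * n - j = k * n + 1 by ring]
      exact not_dvd_of_small (Dvd.intro_left k rfl) one_pos (by omega)
    rw [affineSwap, if_neg hne, if_pos ⟨k, by ring⟩]
    ring
  · change affineSwap n j _ = _
    rw [Int.modEq_comm, Int.modEq_iff_dvd] at hq1 hq2
    rw [affineSwap, if_neg hq1, sub_sub, if_neg hq2]

theorem arcCyl_iff {c : ℤ × ℤ} (hn : 0 < n) (hc : c ∈ boxesCyl n) (d : ℤ × ℤ) :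
    (digraphCyl n).Arc c d ↔
      (∃ k, c.1 < k ∧ k < c.2 ∧ ¬ (n : ℤ) ∣ k - c.1 ∧ d = (c.1, k)) ∨
      ∃ k, c.1 < k ∧ k < c.2 ∧ ¬ (n : ℤ) ∣ c.2 - k ∧ d = repCyl n (k, c.2) := by
  have hc' := mem_boxesCyl.1 hc
  have hn' : (0 : ℤ) < n := by exact_mod_cast hn
  constructor
  · rintro ⟨-, hd, -, ⟨k, h1, h2, rfl⟩ | ⟨k, h1, h2, j, rfl⟩⟩
    · exact Or.inl ⟨k, h1, h2, (mem_boxesCyl.1 hd).2.2.1, rfl⟩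
    · have h3 := (mem_boxesCyl.1 hd).2.2.1
      simp only [sub_sub_sub_cancel_right] at h3
      refine Or.inr ⟨k, h1, h2, h3, eq_of_relCyl hd (repCyl_mem hn h2 h3) ?_⟩
      refine (relCyl n).trans ⟨j, ?_⟩ (relCyl_repCyl (k, c.2))
      simp
  · rintro (⟨k, h1, h2, h3, rfl⟩ | ⟨k, h1, h2, h3, rfl⟩)
    · exact ⟨hc, mem_boxesCyl.2 ⟨hc'.1, hc'.2.1, h3, h1⟩,
        fun h => h2.ne (congrArg Prod.snd h).symm, Or.inl ⟨k, h1, h2, rfl⟩⟩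
    · refine ⟨hc, repCyl_mem hn h2 h3, fun h => ?_, Or.inr ⟨k, h1, h2, ((k - 1) / n).toNat, ?_⟩⟩
      · have e1 := congrArg Prod.fst h
        have e2 := congrArg Prod.snd h
        simp only [repCyl] at e1 e2
        omega
      · rw [Int.toNat_of_nonneg (Int.ediv_nonneg (by omega) hn'.le)]
        rfl

theorem val_digraphCyl {c : ℤ × ℤ} (hc : c ∈ boxesCyl n) : (digraphCyl n).val c =
    ((Finset.Ioo c.1 c.2).filter fun k => ¬ (n : ℤ) ∣ k - c.1).card := by
  have hc' := mem_boxesCyl.1 hc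
  have hinj : Function.Injective fun k : ℤ => (c.1, k) := fun _ _ h => congrArg Prod.snd h
  rw [← Finset.card_image_of_injective _ hinj, ← Set.ncard_coe_finset]
  change Set.ncard {d | d ∈ boxesCyl n ∧ ∃ k, c.1 < k ∧ k < c.2 ∧ d = (c.1, k)} = _
  congr 1
  ext d
  simp only [Set.mem_ofPred_eq, Finset.coe_image, Set.mem_image, Finset.mem_coe,
    Finset.mem_filter, Finset.mem_Ioo]
  constructor
  · rintro ⟨hd, k, h1, h2, rfl⟩
    exact ⟨k, ⟨⟨h1, h2⟩, (mem_boxesCyl.1 hd).2.2.1⟩, rfl⟩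
  · rintro ⟨k, ⟨⟨h1, h2⟩, h3⟩, rfl⟩
    exact ⟨mem_boxesCyl.2 ⟨hc'.1, hc'.2.1, h3, h1⟩, k, h1, h2, rfl⟩

/-- The two halves of the cylindrical hook of `(a, b)` overlap in the boxes `(a, b - jn)`, `j ≥ 1`.
For such a box to be inverted is the same as for `a + jn` to stand after `b`, which accounts for the
values congruent to `a`, although these contribute no box to the first half. -/
theorem tightCyl (hn : 0 < n) (w : AffinePerm n) {c : ℤ × ℤ} (hc : c ∈ boxesCyl n)
    (h : w⁻¹ • c.1 < w⁻¹ • c.2) :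
    ({d | (digraphCyl n).Arc c d} ∩ {c ∈ boxesCyl n | w⁻¹ • c.2 < w⁻¹ • c.1}).ncard ≤
      (digraphCyl n).val c ∧
    (({d | (digraphCyl n).Arc c d} ∩ {c ∈ boxesCyl n | w⁻¹ • c.2 < w⁻¹ • c.1}).ncard =
      (digraphCyl n).val c ↔ IsTight w c) := by
  obtain ⟨a, b⟩ := c
  have hc' := mem_boxesCyl.1 hc
  simp only at h hc'
  set I := (Finset.Ioo a b).filter fun k => ¬ (n : ℤ) ∣ k - a with hI
  have memI : ∀ k, k ∈ I ↔ (a < k ∧ k < b) ∧ ¬ (n : ℤ) ∣ k - a := fun k => by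
    simp [hI]
  have memJ : ∀ k, k ∈ (I.filter fun k => ¬ (n : ℤ) ∣ b - k) ↔
      ((a < k ∧ k < b) ∧ ¬ (n : ℤ) ∣ k - a) ∧ ¬ (n : ℤ) ∣ b - k := fun k => by
    rw [Finset.mem_filter, memI]
  obtain ⟨-, h1, h2⟩ := ncard_hook_inter (N := {d | (digraphCyl n).Arc (a, b) d})
    (A := {c ∈ boxesCyl n | w⁻¹ • c.2 < w⁻¹ • c.1})
    (Finset.filter_subset (fun k => ¬ (n : ℤ) ∣ b - k) I)
    (fun k => (a, k)) (fun k => repCyl n (k, b)) (fun _ _ _ _ e => congrArg Prod.snd e)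
    (by
      intro k _ l _ e
      have e1 := congrArg Prod.fst e
      have e2 := congrArg Prod.snd e
      simp only [repCyl] at e1 e2
      omega)
    (by
      intro k _ l hl e
      have e1 := congrArg Prod.fst e
      simp only [repCyl] at e1
      exact ((memJ l).1 hl).1.2 ⟨(l - 1) / n, by linarith⟩)
    (by
      intro d
      refine (arcCyl_iff hn hc d).trans ⟨?_, ?_⟩
      · rintro (⟨k, h1, h2, h3, rfl⟩ | ⟨k, h1, h2, h3, rfl⟩)
        · exact Or.inl ⟨k, (memI k).2 ⟨⟨h1, h2⟩, h3⟩, rfl⟩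
        · by_cases hk : (n : ℤ) ∣ k - a
          · have hr := repCyl_mem hn (c := (k, b)) h2 h3
            have hr' := mem_boxesCyl.1 hr
            obtain ⟨j, hj⟩ := hk
            obtain rfl : k = a + n * j := by linarith
            have e1 : (repCyl n (a + n * j, b)).1 = a :=
              eq_of_dvd_sub hr'.1 hr'.2.1 hc'.1 hc'.2.1
                ⟨j - (a + n * j - 1) / n, by simp only [repCyl]; ring⟩
            refine Or.inl ⟨(repCyl n (a + n * j, b)).2, (memI _).2 ?_, Prod.ext e1 rfl⟩
            rw [e1] at hr'
            refine ⟨⟨hr'.2.2.2, ?_⟩, hr'.2.2.1⟩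
            simp only [repCyl] at e1 h1 ⊢
            omega
          · exact Or.inr ⟨k, (memJ k).2 ⟨⟨⟨h1, h2⟩, hk⟩, h3⟩, rfl⟩
      · rintro (⟨k, hk, rfl⟩ | ⟨k, hk, rfl⟩)
        · rw [memI] at hk
          exact Or.inl ⟨k, hk.1.1, hk.1.2, hk.2, rfl⟩
        · rw [memJ] at hk
          exact Or.inr ⟨k, hk.1.1.1, hk.1.1.2, hk.2, rfl⟩)
    (fun k hk h1 h2 => by
      rw [repCyl_mem_inv hn w ((memJ k).1 hk).1.1.2] at h2
      exact (h1.2.trans h).asymm h2)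
  have hval : (digraphCyl n).val (a, b) = I.card := val_digraphCyl hc
  rw [hval]
  refine ⟨h1, h2.trans ⟨?_, ?_⟩⟩
  · intro ht k hk1 hk2 hk
    simp only at hk1 hk2 hk
    by_cases hka : (n : ℤ) ∣ k - a
    · obtain ⟨j, hj⟩ := hka
      obtain rfl : k = a + j * n := by linarith
      have hdvd : ¬ (n : ℤ) ∣ b - j * n - a := fun ⟨x, hx⟩ => hc'.2.2.1 ⟨x + j, by linarith⟩
      rcases ht (b - j * n) ((memI _).2 ⟨⟨by omega, by omega⟩, hdvd⟩) with h3 | ⟨h3, -⟩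
      · have h3 := h3.2
        simp only [affine_smul_sub] at h3
        rw [affine_smul_add] at hk
        omega
      · exact ((memJ _).1 h3).2 ⟨j, by ring⟩
    · rcases ht k ((memI k).2 ⟨⟨hk1, hk2⟩, hka⟩) with h3 | ⟨-, h3⟩
      · exact hk.1.asymm h3.2
      · rw [repCyl_mem_inv hn w hk2] at h3
        exact hk.2.asymm h3
  · intro ht k hk
    have hk' := (memI k).1 hk
    by_cases h3 : w⁻¹ • k < w⁻¹ • a
    · exact Or.inl ⟨mem_boxesCyl.2 ⟨hc'.1, hc'.2.1, hk'.2, hk'.1.1⟩, h3⟩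
    · have h4 := smul_lt_of_not_lt w⁻¹ hk'.1.1.ne h3
      have h5 := smul_lt_of_not_lt w⁻¹ hk'.1.2.ne'
        fun h5 => ht k hk'.1.1 hk'.1.2 ⟨h4, h5⟩
      exact Or.inr ⟨(memJ k).2 ⟨hk', not_dvd_of_smul_lt hk'.1.2 h5⟩,
        (repCyl_mem_inv hn w hk'.1.2).2 h5⟩

/-- Between two non-adjacent positions whose entries form a tight pair `(a, b)` stands a value
`k > b` near to `a`, or `k < a` near to `b`, either as an integer or in position; nearness keeps the
values congruent to `a`, respectively `b`, out of the way. If all values near in position are on the wrong side,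
a third residue class contains a value that crosses from one side to the other. -/
theorem exists_near (hn : 3 ≤ n) (w : AffinePerm n) {a b : ℤ} (hab : a < b)
    (ht : IsTight w (a, b)) (hlt : w⁻¹ • a < w⁻¹ • b) (hcov : w⁻¹ • b ≠ w⁻¹ • a + 1) :
    (∃ k, b < k ∧ w⁻¹ • a < w⁻¹ • k ∧ w⁻¹ • k < w⁻¹ • b ∧
      (k - a < n ∨ w⁻¹ • k - w⁻¹ • a < n)) ∨
    ∃ k, k < a ∧ w⁻¹ • a < w⁻¹ • k ∧ w⁻¹ • k < w⁻¹ • b ∧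
      (b - k < n ∨ w⁻¹ • b - w⁻¹ • k < n) := by
  have hn' : (3 : ℤ) ≤ n := by exact_mod_cast hn
  have side : ∀ k, w⁻¹ • a < w⁻¹ • k → w⁻¹ • k < w⁻¹ • b → k < a ∨ b < k := by
    intro k h1 h2
    rcases lt_trichotomy k a with h | h | h
    · exact Or.inl h
    · exact absurd h1 (h ▸ lt_irrefl _)
    · rcases lt_trichotomy k b with h' | h' | h'
      · exact absurd ⟨h1, h2⟩ (ht k h h')
      · exact absurd h2 (h' ▸ lt_irrefl _)
      · exact Or.inr h'
  have hx : ∀ d, w⁻¹ • (w • (w⁻¹ • a + d)) = w⁻¹ • a + d := fun d => inv_smul_smul _ _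
  by_cases hfar : w⁻¹ • b - w⁻¹ • a ≤ n
  · rcases side (w • (w⁻¹ • a + 1)) (by rw [hx]; omega) (by rw [hx]; omega) with h | h
    · exact Or.inr ⟨_, h, by rw [hx]; omega, by rw [hx]; omega, Or.inr (by rw [hx]; omega)⟩
    · exact Or.inl ⟨_, h, by rw [hx]; omega, by rw [hx]; omega, Or.inr (by rw [hx]; omega)⟩
  · -- one of the two positions after that of `a` holds a value `m` congruent to neither `a` nor `b`
    obtain ⟨m, hm1, hm2, hmb⟩ : ∃ m, w⁻¹ • a < w⁻¹ • m ∧ w⁻¹ • m ≤ w⁻¹ • a + 2 ∧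
        ¬ (n : ℤ) ∣ w⁻¹ • b - w⁻¹ • m := by
      by_cases h1 : (n : ℤ) ∣ w⁻¹ • b - (w⁻¹ • a + 2)
      · refine ⟨w • (w⁻¹ • a + 1), by rw [hx]; omega, by rw [hx]; omega, ?_⟩
        rw [hx, show w⁻¹ • b - (w⁻¹ • a + 1) = w⁻¹ • b - (w⁻¹ • a + 2) + 1 by ring]
        exact not_dvd_of_small h1 one_pos (by omega)
      · exact ⟨w • (w⁻¹ • a + 2), by rw [hx]; omega, by rw [hx], by rwa [hx]⟩
    rcases side m hm1 (by omega) with hma | hma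
    · have h1 := Int.emod_add_mul_ediv (w⁻¹ • b - w⁻¹ • m) n
      have h2 := Int.emod_nonneg (w⁻¹ • b - w⁻¹ • m) (by omega : (n : ℤ) ≠ 0)
      have h3 := Int.emod_lt_of_pos (w⁻¹ • b - w⁻¹ • m) (by omega : (0 : ℤ) < n)
      have h4 : (w⁻¹ • b - w⁻¹ • m) % n ≠ 0 := fun h => hmb (Int.dvd_of_emod_eq_zero h)
      set T := (w⁻¹ • b - w⁻¹ • m) / n with hT
      have hT0 : 0 ≤ T := Int.ediv_nonneg (by omega) (by omega)
      have hnT : 0 ≤ T * n := by positivity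
      have hmT := affine_smul_add w⁻¹ m T
      rw [mul_comm] at h1
      -- `m + T n` is the translate of `m` that stands less than `n` places before `b`
      rcases side (m + T * n) (by omega) (by omega) with h | h
      · exact Or.inr ⟨_, h, by omega, by omega, Or.inr (by omega)⟩
      · have e1 := Int.emod_add_mul_ediv (a - m) n
        have e2 := Int.emod_nonneg (a - m) (by omega : (n : ℤ) ≠ 0)
        have e3 := Int.emod_lt_of_pos (a - m) (by omega : (0 : ℤ) < n)
        set i := (a - m) / n with hi
        have hi0 : 0 ≤ i := Int.ediv_nonneg (by omega) (by omega)
        rw [mul_comm] at e1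
        have hiT : i + 1 ≤ T := by
          by_contra hne
          have : T * n ≤ i * n := mul_le_mul_of_nonneg_right (by omega) (by omega)
          omega
        have hiT' : (i + 1) * n ≤ T * n := mul_le_mul_of_nonneg_right hiT (by omega)
        have hin : 0 ≤ i * n := by positivity
        have hmi := affine_smul_add w⁻¹ m (i + 1)
        have hring : (i + 1) * (n : ℤ) = i * n + n := by ring
        have hne : m + i * n ≠ a := by
          intro hne
          have := affine_smul_add w⁻¹ m i
          rw [hne] at this
          omega
        rcases side (m + (i + 1) * n) (by omega) (by omega) with h' | h'
        · omega
        · exact Or.inl ⟨_, h', by omega, by omega, Or.inl (by omega)⟩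
    · exact Or.inl ⟨m, hma, hm1, by omega, Or.inr (by omega)⟩

/-- The group `Ãₙ`: the boxes represent the pairs `a < b` with `a ≢ b`, up to translation. -/
noncomputable def modelAffine (n : ℕ) (hn : 3 ≤ n) : WeakOrderModel ℤ (AffinePerm n) where
  gens := simpleAffine n
  G := digraphCyl n
  rel := relCyl n
  rel_smul := by
    rintro w c _ ⟨k, rfl⟩
    exact ⟨k, Prod.ext (affine_smul_add w c.1 k) (affine_smul_add w c.2 k)⟩
  rel_lt := by
    rintro c _ ⟨k, rfl⟩ h
    simpa using h
  rel_tight := relCyl_tight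
  lt_of_mem _ h := h.2.2.2
  eq_of_rel _ hc _ hd h := eq_of_relCyl hc hd h
  exists_rel w c h h' :=
    ⟨repCyl n c, repCyl_mem (by omega) h (not_dvd_of_smul_lt h h'), relCyl_repCyl c⟩
  eq_one := affine_eq_one (by omega)
  finite := finite_inv_affine (by omega)
  exists_gen i j h := by
    obtain rfl : i + 1 = j := Order.covBy_iff_add_one_eq.1 h
    exact exists_genAffine (by omega) i
  gen_simple := by
    rintro s ⟨i, -, -, h1, h2⟩
    exact ⟨i, i + 1, Order.covBy_add_one i,
      isSimpleAt_affineSwap (by omega) (smul_eq_affineSwap h1 h2)⟩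
  tight w _ hc h := tightCyl (by omega) w hc h
  arc_rel z c h := by
    rcases (arcCyl_iff (by omega) h.1 c).1 h with ⟨k, h1, h2, -, rfl⟩ | ⟨k, h1, h2, -, rfl⟩
    · exact ⟨k, h1, h2, Or.inl ((relCyl n).refl _)⟩
    · exact ⟨k, h1, h2, Or.inr ((relCyl n).symm (relCyl_repCyl _))⟩
  arc_right := by
    rintro ⟨a, b⟩ hc z hz k hk hr
    have hc' := mem_boxesCyl.1 hc
    obtain ⟨j, rfl⟩ := hr
    have hz' := mem_boxesCyl.1 hz
    have h0 := eq_of_dvd_sub hz'.1 hz'.2.1 hc'.1 hc'.2.1 ⟨j, by simp only; ring⟩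
    simp only at h0 hk
    rw [arcCyl_iff (by omega) hz]
    refine Or.inl ⟨b, ?_, ?_, ?_, ?_⟩
    · simp only [h0]; exact hc'.2.2.2
    · simp only; omega
    · simp only [h0]; exact hc'.2.2.1
    · simp only [h0]
  arc_left := by
    rintro ⟨a, b⟩ hc z hz k hk hr
    have hc' := mem_boxesCyl.1 hc
    obtain ⟨j, rfl⟩ := hr
    simp only at hk hc'
    rw [arcCyl_iff (by omega) hz]
    have h3 : ¬ (n : ℤ) ∣ b + j * n - (a + j * n) := by
      rw [add_sub_add_right_eq_sub]; exact hc'.2.2.1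
    refine Or.inr ⟨a + j * n, by simpa using hk, by simpa using hc'.2.2.2, h3, ?_⟩
    refine eq_of_relCyl hc (repCyl_mem (by omega) (by simpa using hc'.2.2.2) h3) ?_
    exact (relCyl n).trans ⟨j, rfl⟩ (relCyl_repCyl _)
  escape := by
    rintro w ⟨a, b⟩ hc ht hlt hcov
    have hab := (mem_boxesCyl.1 hc).2.2.2
    have hcov' : w⁻¹ • b ≠ w⁻¹ • a + 1 := fun h => hcov (h ▸ Order.covBy_add_one _)
    have pos : ∀ {j : ℤ}, 0 < j * n → (n : ℤ) ≤ j * n := fun {j} hj => by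
      have : 0 < j := pos_of_mul_pos_left hj (by omega)
      nlinarith
    rcases exists_near hn w hab ht hlt hcov' with ⟨k, h1, h2, h3, h4⟩ | ⟨k, h1, h2, h3, h4⟩
    · refine Or.inl ⟨k, h1, h2, h3, fun m e1 e2 e3 e4 => ?_⟩
      refine ⟨_, repCyl_mem (by omega) e1 ?_, relCyl_repCyl _⟩
      rintro ⟨j, hj⟩
      simp only at hj e1 e2 e3 e4 h4
      obtain rfl : m = a + j * n := by linarith
      have := pos (j := j) (by omega)
      rw [affine_smul_add] at e4
      omega
    · refine Or.inr ⟨k, h1, h2, h3, fun m e1 e2 e3 e4 => ?_⟩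
      refine ⟨_, repCyl_mem (by omega) e2 ?_, relCyl_repCyl _⟩
      rintro ⟨j, hj⟩
      simp only at hj e1 e2 e3 e4 h4
      obtain rfl : m = b - j * n := by linarith
      have := pos (j := j) (by omega)
      rw [affine_smul_sub] at e3
      omega

theorem inv_modelAffine (n : ℕ) (hn : 3 ≤ n) : (modelAffine n hn).inv = invAffine := by
  funext w
  ext c
  constructor
  · rintro ⟨hc, h⟩
    exact ⟨hc.1, hc.2.1, hc.2.2.2, h⟩
  · rintro ⟨h1, h2, h3, h4⟩
    exact ⟨mem_boxesCyl.2 ⟨h1, h2, not_dvd_of_smul_lt (w := w⁻¹) h3 h4, h3⟩, h4⟩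

end

/-! ### The diagram of the flag weak order -/

section

variable {n : ℕ}

/-- A box of the staircase, with entries in `{1, …, n}`. -/
def flagBoxA (c : Fin n × Fin n) : ℤ × ℤ := ((c.1 : ℤ) + 1, (c.2 : ℤ) + 1)

/-- The `u`-th box from the left, counted from `0`, in row `b` of the left part of the diagram for
`r = q + 1`. -/
def flagBoxB (q : ℕ) (b : Fin n) (u : ℕ) : ℤ × ℤ := ((u : ℤ) - ((b : ℤ) + 1) * q, (b : ℤ) + 1)

theorem flagBoxA_injective : Function.Injective (flagBoxA (n := n)) := by
  intro c d h
  simp only [flagBoxA, Prod.mk.injEq, add_left_inj, Nat.cast_inj] at h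
  exact Prod.ext (Fin.ext h.1) (Fin.ext h.2)

theorem flagBoxB_inj {q : ℕ} {b b' : Fin n} {u u' : ℕ} :
    flagBoxB q b u = flagBoxB q b' u' ↔ b = b' ∧ u = u' := by
  constructor
  · intro h
    simp only [flagBoxB, Prod.mk.injEq, add_left_inj, Nat.cast_inj] at h
    obtain rfl : b = b' := Fin.ext h.2
    exact ⟨rfl, by have := h.1; omega⟩
  · rintro ⟨rfl, rfl⟩
    rfl

theorem flagBoxA_ne {q : ℕ} {c : Fin n × Fin n} {b : Fin n} {u : ℕ}
    (hu : (u : ℤ) < ((b : ℤ) + 1) * q) : flagBoxA c ≠ flagBoxB q b u := by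
  intro h
  have := congrArg Prod.fst h
  simp only [flagBoxA, flagBoxB] at this
  omega

theorem mem_boxesFlagB {q : ℕ} {c : ℤ × ℤ} : c ∈ boxesFlagB (q + 1) n ↔
    1 ≤ c.2 ∧ c.2 ≤ n ∧ -(c.2 * q) ≤ c.1 ∧ c.1 ≤ -1 := by
  simp [boxesFlagB]

theorem exists_fin_eq_add_one {x : ℤ} (h1 : 1 ≤ x) (h2 : x ≤ n) : ∃ a : Fin n, x = (a : ℤ) + 1 :=
  ⟨⟨(x - 1).toNat, by omega⟩, by simp only; omega⟩

theorem mem_boxesFlagA_iff {x : ℤ × ℤ} :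
    x ∈ boxesFlagA n ↔ ∃ c ∈ boxesA n, x = flagBoxA c := by
  constructor
  · rintro ⟨h1, h2, h3⟩
    obtain ⟨a, ha⟩ := exists_fin_eq_add_one (n := n) h1 (by omega)
    obtain ⟨b, hb⟩ := exists_fin_eq_add_one (n := n) (x := x.2) (by omega) h3
    refine ⟨(a, b), ?_, Prod.ext ha hb⟩
    change a < b
    rw [Fin.lt_def]
    omega
  · rintro ⟨⟨a, b⟩, h, rfl⟩
    have h' : (a : ℕ) < b := h
    have := b.2
    simp only [boxesFlagA, flagBoxA, Set.mem_ofPred_eq]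
    omega

theorem mem_boxesFlagB_iff {q : ℕ} {x : ℤ × ℤ} : x ∈ boxesFlagB (q + 1) n ↔
    ∃ (b : Fin n) (u : ℕ), (u : ℤ) < ((b : ℤ) + 1) * q ∧ x = flagBoxB q b u := by
  rw [mem_boxesFlagB]
  constructor
  · rintro ⟨h1, h2, h3, h4⟩
    obtain ⟨b, hb⟩ := exists_fin_eq_add_one (n := n) h1 h2
    rw [hb] at h3
    refine ⟨b, (x.1 + ((b : ℤ) + 1) * q).toNat, by omega, Prod.ext ?_ hb⟩
    simp only [flagBoxB]
    omega
  · rintro ⟨b, u, hu, rfl⟩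
    have := b.2
    simp only [flagBoxB]
    omega

theorem flagBoxA_notMem {q : ℕ} (c : Fin n × Fin n) : flagBoxA c ∉ boxesFlagB (q + 1) n := by
  rw [mem_boxesFlagB_iff]
  rintro ⟨b, u, hu, h⟩
  exact flagBoxA_ne hu h

theorem arc_flagBoxA {q : ℕ} {c : Fin n × Fin n} (hc : c ∈ boxesA n) (x : ℤ × ℤ) :
    (digraphFlag (q + 1) n).Arc (flagBoxA c) x ↔ ∃ d, (digraphA n).Arc c d ∧ x = flagBoxA d := by
  obtain ⟨a, b⟩ := c
  have hab : (a : ℕ) < b := hc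
  constructor
  · rintro ⟨-, -, -, ⟨-, k, h1, h2, h3⟩ | ⟨h, -⟩⟩
    · simp only [flagBoxA] at h1 h2 h3
      have := b.2
      obtain ⟨k, rfl⟩ := exists_fin_eq_add_one (n := n) (x := k) (by omega) (by omega)
      have hak : a < k := by rw [Fin.lt_def]; omega
      have hkb : k < b := by rw [Fin.lt_def]; omega
      rcases h3 with rfl | rfl
      · exact ⟨(a, k), (arcA_iff hc _).2 (Or.inl ⟨k, Finset.mem_Ioo.2 ⟨hak, hkb⟩, rfl⟩), rfl⟩
      · exact ⟨(k, b), (arcA_iff hc _).2 (Or.inr ⟨k, Finset.mem_Ioo.2 ⟨hak, hkb⟩, rfl⟩), rfl⟩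
    · exact absurd h (flagBoxA_notMem _)
  · rintro ⟨d, hd, rfl⟩
    have hcA : flagBoxA (a, b) ∈ boxesFlagA n := mem_boxesFlagA_iff.2 ⟨_, hc, rfl⟩
    refine ⟨Or.inl hcA, Or.inl (mem_boxesFlagA_iff.2 ⟨_, hd.2.1, rfl⟩),
      fun h => hd.2.2.1 (flagBoxA_injective h), Or.inl ⟨hcA, ?_⟩⟩
    rcases (arcA_iff hc d).1 hd with ⟨k, hk, rfl⟩ | ⟨k, hk, rfl⟩ <;>
    · simp only [Finset.mem_Ioo, Fin.lt_def] at hk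
      refine ⟨(k : ℤ) + 1, ?_, ?_, by simp [flagBoxA]⟩ <;> simp only [flagBoxA] <;> omega

theorem arc_flagBoxB {q : ℕ} {b : Fin n} {u : ℕ} (hu : (u : ℤ) < ((b : ℤ) + 1) * q) (x : ℤ × ℤ) :
    (digraphFlag (q + 1) n).Arc (flagBoxB q b u) x ↔
      (∃ v : ℕ, u < v ∧ (v : ℤ) < ((b : ℤ) + 1) * q ∧ x = flagBoxB q b v) ∨
      ∃ a : Fin n, a < b ∧ x = flagBoxA (a, b) := by
  have hmem : flagBoxB q b u ∈ boxesFlagB (q + 1) n := mem_boxesFlagB_iff.2 ⟨b, u, hu, rfl⟩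
  constructor
  · rintro ⟨-, hx, -, ⟨h, -⟩ | ⟨-, h1, h2⟩⟩
    · obtain ⟨c, -, h⟩ := mem_boxesFlagA_iff.1 h
      exact absurd h.symm (flagBoxA_ne hu)
    · rcases hx with hx | hx
      · obtain ⟨⟨a, b'⟩, hab, rfl⟩ := mem_boxesFlagA_iff.1 hx
        simp only [flagBoxA, flagBoxB, add_left_inj, Nat.cast_inj] at h2
        obtain rfl : b' = b := Fin.ext h2
        exact Or.inr ⟨a, hab, rfl⟩
      · obtain ⟨b', v, hv, rfl⟩ := mem_boxesFlagB_iff.1 hx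
        simp only [flagBoxB, add_left_inj, Nat.cast_inj] at h1 h2
        obtain rfl : b' = b := Fin.ext h2
        exact Or.inl ⟨v, by omega, hv, rfl⟩
  · rintro (⟨v, huv, hv, rfl⟩ | ⟨a, ha, rfl⟩)
    · refine ⟨Or.inr hmem, Or.inr (mem_boxesFlagB_iff.2 ⟨b, v, hv, rfl⟩), ?_,
        Or.inr ⟨hmem, ?_, rfl⟩⟩
      · rw [Ne, flagBoxB_inj]
        omega
      · simp only [flagBoxB]
        omega
    · refine ⟨Or.inr hmem, Or.inl (mem_boxesFlagA_iff.2 ⟨_, ha, rfl⟩), (flagBoxA_ne hu).symm,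
        Or.inr ⟨hmem, ?_, rfl⟩⟩
      simp only [flagBoxA, flagBoxB]
      omega

theorem val_flagBoxA {q : ℕ} {c : Fin n × Fin n} (hc : c ∈ boxesA n) :
    (digraphFlag (q + 1) n).val (flagBoxA c) = (Finset.Ioo c.1 c.2).card := by
  change valFlag n (q + 1) (flagBoxA c) = _
  rw [valFlag, if_pos (mem_boxesFlagA_iff.2 ⟨c, hc, rfl⟩), Fin.card_Ioo]
  have : (c.1 : ℕ) < c.2 := hc
  simp only [flagBoxA]
  omega

theorem val_flagBoxB {q : ℕ} {b : Fin n} {u : ℕ} (hu : (u : ℤ) < ((b : ℤ) + 1) * q) :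
    (digraphFlag (q + 1) n).val (flagBoxB q b u) = u / q := by
  have hq : (q : ℚ) ≠ 0 := by
    rintro h
    have : q = 0 := by exact_mod_cast h
    subst this
    simp at hu
    omega
  change valFlag n (q + 1) (flagBoxB q b u) = _
  rw [valFlag, if_neg]
  · have e : (((flagBoxB q b u).1 : ℤ) : ℚ) / (((q + 1 : ℕ) : ℚ) - 1) =
        (u : ℚ) / q - ((b : ℤ) + 1 : ℤ) := by
      simp only [flagBoxB]
      push_cast
      rw [add_sub_cancel_right, sub_div, mul_div_cancel_right₀ _ hq]
    rw [e, Int.floor_sub_intCast, Rat.floor_natCast_div_natCast, ← Int.natCast_div]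
    generalize u / q = v
    simp only [flagBoxB]
    omega
  · rw [mem_boxesFlagA_iff]
    rintro ⟨c, -, h⟩
    exact flagBoxA_ne hu h.symm

/-- The number of entries `a < b` inverted with `b`. -/
noncomputable def rowCount (σ : Equiv.Perm (Fin n)) (b : Fin n) : ℕ :=
  {a | (a, b) ∈ invA σ}.ncard

theorem rowCount_le (σ : Equiv.Perm (Fin n)) (b : Fin n) : rowCount σ b ≤ b := by
  have h : {a | (a, b) ∈ invA σ} ⊆ (Finset.Iio b : Set (Fin n)) := fun a ha => by
    simpa using ha.1
  have := Set.ncard_le_ncard h (Finset.finite_toSet _)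
  rwa [Set.ncard_coe_finset, Fin.card_Iio] at this

/-- The set of boxes that consists of `I` in the staircase and of the `t b` leftmost boxes of each
row `b` of the left part. -/
def flagSet (q : ℕ) (I : Set (Fin n × Fin n)) (t : Fin n → ℕ) : Set (ℤ × ℤ) :=
  flagBoxA '' I ∪ {x | ∃ b u, u < t b ∧ x = flagBoxB q b u}

/-- The row lengths that occur along with the inversion set of `σ`: `b` has been inverted
`rowCount σ b` times, each time at the end of a block of `q` boxes, and is now within a block. -/
def IsFlagState (q : ℕ) (σ : Equiv.Perm (Fin n)) (t : Fin n → ℕ) : Prop :=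
  ∀ b, rowCount σ b * q ≤ t b ∧ t b ≤ (rowCount σ b + 1) * q

theorem flagSet_insert (q : ℕ) (I : Set (Fin n × Fin n)) (t : Fin n → ℕ) (c : Fin n × Fin n) :
    flagSet q (insert c I) t = insert (flagBoxA c) (flagSet q I t) := by
  rw [flagSet, Set.image_insert_eq, Set.insert_union]
  rfl

theorem flagSet_update (q : ℕ) (I : Set (Fin n × Fin n)) {t t' : Fin n → ℕ} {b : Fin n}
    (h : ∀ x, t' x = t x + if x = b then 1 else 0) :
    flagSet q I t' = insert (flagBoxB q b (t b)) (flagSet q I t) := by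
  ext x
  simp only [flagSet, Set.mem_union, Set.mem_insert_iff, Set.mem_ofPred_eq]
  constructor
  · rintro (hx | ⟨b', u, hu, rfl⟩)
    · exact Or.inr (Or.inl hx)
    · rw [flagBoxB_inj]
      rw [h] at hu
      by_cases hb : b' = b
      · subst hb
        rw [if_pos rfl] at hu
        rcases Nat.lt_succ_iff_lt_or_eq.1 hu with hu | hu
        · exact Or.inr (Or.inr ⟨b', u, hu, rfl⟩)
        · exact Or.inl ⟨rfl, hu⟩
      · rw [if_neg hb] at hu
        exact Or.inr (Or.inr ⟨b', u, hu, rfl⟩)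
  · rintro (rfl | hx | ⟨b', u, hu, rfl⟩)
    · exact Or.inr ⟨b, t b, by simp [h], rfl⟩
    · exact Or.inl hx
    · exact Or.inr ⟨b', u, by rw [h]; omega, rfl⟩

section

variable {q : ℕ} {σ : Equiv.Perm (Fin n)} {t : Fin n → ℕ}

theorem IsFlagState.le (h : IsFlagState q σ t) (b : Fin n) : (t b : ℤ) ≤ ((b : ℤ) + 1) * q := by
  have : t b ≤ ((b : ℕ) + 1) * q :=
    (h b).2.trans (Nat.mul_le_mul_right q (Nat.succ_le_succ (rowCount_le σ b)))
  exact_mod_cast this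

theorem flagBoxA_mem (h : IsFlagState q σ t) {I : Set (Fin n × Fin n)} {c : Fin n × Fin n} :
    flagBoxA c ∈ flagSet q I t ↔ c ∈ I := by
  constructor
  · rintro (⟨d, hd, he⟩ | ⟨b, u, hu, he⟩)
    · rwa [← flagBoxA_injective he]
    · have := h.le b
      exact absurd he (flagBoxA_ne (by omega))
  · exact fun hc => Or.inl ⟨c, hc, rfl⟩

theorem flagBoxB_mem {I : Set (Fin n × Fin n)} {b : Fin n} {u : ℕ}
    (hu : (u : ℤ) < ((b : ℤ) + 1) * q) : flagBoxB q b u ∈ flagSet q I t ↔ u < t b := by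
  constructor
  · rintro (⟨d, hd, he⟩ | ⟨b', u', hu', he⟩)
    · exact absurd he (flagBoxA_ne hu)
    · obtain ⟨rfl, rfl⟩ := flagBoxB_inj.1 he
      exact hu'
  · exact fun h => Or.inr ⟨b, u, h, rfl⟩

theorem flagSet_subset_iff {σ' : Equiv.Perm (Fin n)} {t' : Fin n → ℕ} (h : IsFlagState q σ t)
    (h' : IsFlagState q σ' t') :
    flagSet q (invA σ) t ⊆ flagSet q (invA σ') t' ↔ invA σ ⊆ invA σ' ∧ ∀ b, t b ≤ t' b := by
  constructor
  · refine fun hs => ⟨fun c hc => (flagBoxA_mem h').1 (hs ((flagBoxA_mem h).2 hc)), fun b => ?_⟩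
    by_contra hlt
    have hb := h.le b
    have hu : ((t' b : ℕ) : ℤ) < ((b : ℤ) + 1) * q := by omega
    have := hs ((flagBoxB_mem (I := invA σ) hu).2 (not_le.1 hlt))
    rw [flagBoxB_mem hu] at this
    omega
  · rintro ⟨h1, h2⟩ x (⟨c, hc, rfl⟩ | ⟨b, u, hu, rfl⟩)
    · exact Or.inl ⟨c, h1 hc, rfl⟩
    · exact Or.inr ⟨b, u, hu.trans_le (h2 b), rfl⟩

theorem ncard_arc_flagBoxA (h : IsFlagState q σ t) {c : Fin n × Fin n} (hc : c ∈ boxesA n) :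
    ({x | (digraphFlag (q + 1) n).Arc (flagBoxA c) x} ∩ flagSet q (invA σ) t).ncard =
      ({d | (digraphA n).Arc c d} ∩ invA σ).ncard := by
  rw [← Set.ncard_image_of_injective _ flagBoxA_injective]
  congr 1
  ext x
  simp only [Set.mem_inter_iff, Set.mem_ofPred_eq, arc_flagBoxA hc, Set.mem_image]
  constructor
  · rintro ⟨⟨d, hd, rfl⟩, hx⟩
    exact ⟨d, ⟨hd, (flagBoxA_mem h).1 hx⟩, rfl⟩
  · rintro ⟨d, ⟨hd, hx⟩, rfl⟩
    exact ⟨⟨d, hd, rfl⟩, (flagBoxA_mem h).2 hx⟩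

theorem ncard_arc_flagBoxB (h : IsFlagState q σ t) {b : Fin n} {u : ℕ}
    (hu : (u : ℤ) < ((b : ℤ) + 1) * q) (htu : t b ≤ u) :
    ({x | (digraphFlag (q + 1) n).Arc (flagBoxB q b u) x} ∩ flagSet q (invA σ) t).ncard =
      rowCount σ b := by
  have hinj : Function.Injective fun a : Fin n => flagBoxA (a, b) :=
    fun _ _ e => congrArg Prod.fst (flagBoxA_injective e)
  rw [rowCount, ← Set.ncard_image_of_injective _ hinj]
  congr 1
  ext x
  simp only [Set.mem_inter_iff, Set.mem_ofPred_eq, arc_flagBoxB hu, Set.mem_image]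
  constructor
  · rintro ⟨⟨v, huv, hv, rfl⟩ | ⟨a, -, rfl⟩, hx⟩
    · rw [flagBoxB_mem hv] at hx
      omega
    · exact ⟨a, (flagBoxA_mem h).1 hx, rfl⟩
  · rintro ⟨a, ha, rfl⟩
    exact ⟨Or.inr ⟨a, ha.1, rfl⟩, (flagBoxA_mem h).2 ha⟩

/-- A box of the staircase can be peeled if this is so in type `A`, and if its row of the left part
has been peeled up to the end of the current block. -/
theorem canPeel_flagBoxA (h : IsFlagState q σ t) {c : Fin n × Fin n} (hc : c ∈ boxesA n) :
    (digraphFlag (q + 1) n).CanPeel (flagSet q (invA σ) t) (flagBoxA c) ↔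
      (digraphA n).CanPeel (invA σ) c ∧ (rowCount σ c.2 + 1) * q ≤ t c.2 := by
  obtain ⟨a, b⟩ := c
  have hval : ∀ d ∈ boxesA n,
      (digraphFlag (q + 1) n).val (flagBoxA d) = (digraphA n).val d := fun d hd => by
    rw [val_flagBoxA hd]
    exact (tight_iffA (Equiv.refl _) hd (by exact hd)).1.symm
  constructor
  · rintro ⟨h1, h2, h3, h4⟩
    refine ⟨⟨hc, fun h' => h2 ((flagBoxA_mem h).2 h'), ?_, fun z hz hzI => ?_⟩, ?_⟩
    · rw [← ncard_arc_flagBoxA h hc, h3, hval _ hc]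
    · have := h4 (flagBoxA z) ((arc_flagBoxA hz.1 _).2 ⟨_, hz, rfl⟩)
        (fun h' => hzI ((flagBoxA_mem h).1 h'))
      rwa [ncard_arc_flagBoxA h hz.1, hval _ hz.1] at this
    · simp only
      -- otherwise the first remaining box of the row would have value `0`
      by_contra hlt
      have hu : (t b : ℤ) < ((b : ℤ) + 1) * q := by
        have : (rowCount σ b + 1) * q ≤ ((b : ℕ) + 1) * q :=
          Nat.mul_le_mul_right q (Nat.succ_le_succ (rowCount_le σ b))
        have : t b < ((b : ℕ) + 1) * q := by omega
        exact_mod_cast this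
      have := h4 (flagBoxB q b (t b)) ((arc_flagBoxB hu _).2 (Or.inr ⟨a, hc, rfl⟩))
        (by rw [flagBoxB_mem hu]; omega)
      rw [ncard_arc_flagBoxB h hu le_rfl, val_flagBoxB hu] at this
      exact hlt ((Nat.mul_le_mul_right q this).trans (Nat.div_mul_le_self _ _))
  · rintro ⟨⟨h1, h2, h3, h4⟩, h5⟩
    refine ⟨Or.inl (mem_boxesFlagA_iff.2 ⟨_, hc, rfl⟩), fun h' => h2 ((flagBoxA_mem h).1 h'), ?_,
      fun z hz hzI => ?_⟩
    · rw [ncard_arc_flagBoxA h hc, h3, hval _ hc]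
    · rcases (digraphFlag (q + 1) n).mem_left _ _ hz with hz' | hz'
      · obtain ⟨d, hd, rfl⟩ := mem_boxesFlagA_iff.1 hz'
        obtain ⟨c, hc', he⟩ := (arc_flagBoxA hd _).1 hz
        rw [← flagBoxA_injective he] at hc'
        rw [ncard_arc_flagBoxA h hd, hval _ hd]
        exact h4 d hc' fun h' => hzI ((flagBoxA_mem h).2 h')
      · obtain ⟨b', u, hu, rfl⟩ := mem_boxesFlagB_iff.1 hz'
        rcases (arc_flagBoxB hu _).1 hz with ⟨v, -, hv, he⟩ | ⟨a', -, he⟩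
        · exact absurd he (flagBoxA_ne hv)
        · obtain rfl : b = b' := congrArg Prod.snd (flagBoxA_injective he)
          rw [flagBoxB_mem hu, not_lt] at hzI
          rw [ncard_arc_flagBoxB h hu hzI, val_flagBoxB hu]
          have hq : 0 < q := Nat.pos_of_ne_zero fun h0 => by
            subst h0
            simp at hu
            omega
          exact (Nat.le_div_iff_mul_le hq).2 (h5.trans hzI)

/-- A box of the left part can be peeled if it is the first remaining one of its row and belongs to
the current block. -/
theorem canPeel_flagBoxB (h : IsFlagState q σ t) {b : Fin n} {u : ℕ}
    (hu : (u : ℤ) < ((b : ℤ) + 1) * q) :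
    (digraphFlag (q + 1) n).CanPeel (flagSet q (invA σ) t) (flagBoxB q b u) ↔
      u = t b ∧ t b < (rowCount σ b + 1) * q := by
  have hq : 0 < q := Nat.pos_of_ne_zero fun h0 => by
    subst h0
    simp at hu
    omega
  constructor
  · rintro ⟨-, h2, h3, h4⟩
    rw [flagBoxB_mem hu, not_lt] at h2
    rw [ncard_arc_flagBoxB h hu h2, val_flagBoxB hu] at h3
    have hut : u = t b := by
      by_contra hne
      have hv : (t b : ℤ) < ((b : ℤ) + 1) * q := by omega
      have := h4 (flagBoxB q b (t b)) ((arc_flagBoxB hv _).2 (Or.inl ⟨u, by omega, hu, rfl⟩))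
        (by rw [flagBoxB_mem hv]; omega)
      rw [ncard_arc_flagBoxB h hv le_rfl, val_flagBoxB hv, h3] at this
      exact absurd (Nat.div_le_div_right h2) (not_le.2 this)
    subst hut
    refine ⟨rfl, ?_⟩
    rw [h3]
    exact Nat.lt_mul_of_div_lt (Nat.lt_succ_self _) hq
  · rintro ⟨rfl, hlt⟩
    refine ⟨Or.inr (mem_boxesFlagB_iff.2 ⟨b, _, hu, rfl⟩), by rw [flagBoxB_mem hu]; omega, ?_,
      fun z hz hzI => ?_⟩
    · rw [ncard_arc_flagBoxB h hu le_rfl, val_flagBoxB hu]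
      exact (Nat.div_eq_of_lt_le (h b).1 hlt).symm
    · exfalso
      rcases (digraphFlag (q + 1) n).mem_left _ _ hz with hz' | hz'
      · obtain ⟨d, hd, rfl⟩ := mem_boxesFlagA_iff.1 hz'
        obtain ⟨c, hc', he⟩ := (arc_flagBoxA hd _).1 hz
        exact flagBoxA_ne hu he.symm
      · obtain ⟨b', v, hv, rfl⟩ := mem_boxesFlagB_iff.1 hz'
        rcases (arc_flagBoxB hv _).1 hz with ⟨v', h1, hv', he⟩ | ⟨a', -, he⟩
        · obtain ⟨rfl, rfl⟩ := flagBoxB_inj.1 he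
          exact hzI ((flagBoxB_mem hv).2 h1)
        · exact flagBoxA_ne hu he.symm

end

end

/-! ### The flag weak order -/

section

variable {q n : ℕ}

namespace ColoredPerm

theorem mul_color {r : ℕ} (x y : ColoredPerm r n) (i : Fin n) :
    (x * y).color i = x.color (y.perm i) + y.color i := rfl

theorem mul_perm {r : ℕ} (x y : ColoredPerm r n) : (x * y).perm = x.perm * y.perm := rfl

/-- The color of the entry `b`, wherever it stands. -/
def entryColor {r : ℕ} (x : ColoredPerm r n) (b : Fin n) : ZMod r := x.color (x.perm⁻¹ b)

theorem entryColor_perm {r : ℕ} (x : ColoredPerm r n) (i : Fin n) :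
    x.entryColor (x.perm i) = x.color i :=
  congrArg x.color (inv_smul_smul x.perm i)

theorem ext_entryColor {r : ℕ} {x y : ColoredPerm r n} (h : x.perm = y.perm)
    (h' : ∀ b, x.entryColor b = y.entryColor b) : x = y := by
  refine ColoredPerm.ext (funext fun i => ?_) h
  have := h' (x.perm i)
  rwa [entryColor_perm, h, entryColor_perm] at this

theorem entryColor_mul_color {r : ℕ} (x : ColoredPerm r n) (i b : Fin n) :
    (x * ⟨Pi.single i 1, 1⟩).entryColor b = x.entryColor b + if b = x.perm i then 1 else 0 := by
  simp only [entryColor, mul_color, mul_perm, mul_one, Equiv.Perm.one_apply, Pi.single_apply,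
    Equiv.Perm.inv_eq_iff_eq]

/-- The generator `aᵢ` also changes the color of one entry only, that of the entry which moves to
the left. -/
theorem entryColor_mul_swap {r : ℕ} (x : ColoredPerm r n) (i j b : Fin n) :
    (x * ⟨Pi.single i 1, Equiv.swap i j⟩).entryColor b =
      x.entryColor b + if b = x.perm j then 1 else 0 := by
  simp only [entryColor, mul_color, mul_perm, mul_inv_rev, Equiv.swap_inv, Equiv.Perm.mul_apply,
    Equiv.swap_apply_self, Pi.single_apply]
  congr 2
  rw [Equiv.swap_apply_eq_iff, Equiv.swap_apply_left, Equiv.Perm.inv_eq_iff_eq]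

theorem finv_eq_sum_entryColor {r : ℕ} (x : ColoredPerm r n) :
    x.finv = r * (invA x.perm).ncard + ∑ b, (x.entryColor b).val := by
  rw [finv]
  congr 1
  exact (Equiv.sum_comp x.perm⁻¹ fun i => (x.color i).val).symm

end ColoredPerm

open ColoredPerm

theorem zmod_val_add_one (c : ZMod (q + 1)) :
    (c + 1).val = if c.val = q then 0 else c.val + 1 := by
  have h := ZMod.val_lt c
  rw [ZMod.val_add, ZMod.val_one_eq_one_mod, Nat.add_mod_mod]
  split_ifs with hc
  · rw [hc, Nat.mod_self]
  · exact Nat.mod_eq_of_lt (by omega)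

theorem zmod_val_le (c : ZMod (q + 1)) : c.val ≤ q := Nat.lt_succ_iff.1 (ZMod.val_lt c)

/-- The number of boxes peeled in row `b` of the left part: a block of `q` for each inversion, and
as many more as the color says. -/
noncomputable def rowLen (x : ColoredPerm (q + 1) n) (b : Fin n) : ℕ :=
  rowCount x.perm b * q + (x.entryColor b).val

theorem isFlagState_rowLen (x : ColoredPerm (q + 1) n) : IsFlagState q x.perm (rowLen x) :=
  fun b => by
  have := zmod_val_le (x.entryColor b)
  rw [add_mul, one_mul, rowLen]
  omega

/-- The initial section of a colored permutation. -/
noncomputable def flagInv (x : ColoredPerm (q + 1) n) : Set (ℤ × ℤ) :=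
  flagSet q (invA x.perm) (rowLen x)

/-- A color changing step `x bᵢ` is a cover if it does not return to color `0`, and an inversion
adding step `x aᵢ` is a cover if it does. -/
def FlagCov (x y : ColoredPerm (q + 1) n) : Prop :=
  (∃ i : Fin n, y = x * ⟨Pi.single i 1, 1⟩ ∧ (x.color i).val < q) ∨
  ∃ i j : Fin n, (i : ℕ) + 1 = j ∧ y = x * ⟨Pi.single i 1, Equiv.swap i j⟩ ∧
    x.perm i < x.perm j ∧ (x.color j).val = q

theorem invA_mul_swap {σ : Equiv.Perm (Fin n)} {i j : Fin n} (hij : (i : ℕ) + 1 = j)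
    (h : σ i < σ j) : (σ i, σ j) ∉ invA σ ∧
      invA (σ * Equiv.swap i j) = insert (σ i, σ j) (invA σ) := by
  obtain ⟨c, -, rfl, h1, h2⟩ := (modelA n).inv_mul_of_lt (w := σ) (Fin.lt_def.2 (by omega))
    (isSimpleAt_swap hij) h
  exact ⟨h1, h2⟩

theorem rowCount_mul_swap {σ : Equiv.Perm (Fin n)} {i j : Fin n} (hij : (i : ℕ) + 1 = j)
    (h : σ i < σ j) (b : Fin n) :
    rowCount (σ * Equiv.swap i j) b = rowCount σ b + if b = σ j then 1 else 0 := by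
  obtain ⟨h1, h2⟩ := invA_mul_swap hij h
  unfold rowCount
  rw [h2]
  split_ifs with hb
  · subst hb
    rw [← Set.ncard_insert_of_notMem (s := {a | (a, σ j) ∈ invA σ}) h1 (Set.toFinite _)]
    congr 1
    ext a
    simp [Prod.ext_iff]
  · congr 1
    ext a
    simp [Prod.ext_iff, hb]

theorem rowLen_mul_color (x : ColoredPerm (q + 1) n) {i : Fin n} (h : (x.color i).val < q)
    (b : Fin n) :
    rowLen (x * ⟨Pi.single i 1, 1⟩) b = rowLen x b + if b = x.perm i then 1 else 0 := by
  rw [rowLen, rowLen, entryColor_mul_color, mul_perm, mul_one]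
  split_ifs with hb
  · subst hb
    rw [entryColor_perm, zmod_val_add_one, if_neg h.ne, add_assoc]
  · rw [add_zero, add_zero]

theorem flagInv_mul_color (x : ColoredPerm (q + 1) n) {i : Fin n} (h : (x.color i).val < q) :
    flagInv (x * ⟨Pi.single i 1, 1⟩) =
      insert (flagBoxB q (x.perm i) (rowLen x (x.perm i))) (flagInv x) := by
  rw [flagInv, mul_perm, mul_one]
  exact flagSet_update q _ (rowLen_mul_color x h)

theorem rowLen_mul_swap (x : ColoredPerm (q + 1) n) {i j : Fin n} (hij : (i : ℕ) + 1 = j)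
    (h : x.perm i < x.perm j) (b : Fin n) :
    rowLen (x * ⟨Pi.single i 1, Equiv.swap i j⟩) b =
      if b = x.perm j ∧ (x.color j).val < q then rowLen x b + (q + 1) else rowLen x b := by
  rw [rowLen, rowLen, entryColor_mul_swap, mul_perm, rowCount_mul_swap hij h]
  by_cases hb : b = x.perm j
  · subst hb
    rw [entryColor_perm, if_pos rfl, if_pos rfl, zmod_val_add_one, add_mul, one_mul]
    have := zmod_val_le (x.color j)
    by_cases hc : (x.color j).val = q
    · rw [if_pos hc, if_neg (by omega)]
      omega
    · rw [if_neg hc, if_pos ⟨rfl, by omega⟩]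
      omega
  · simp [hb]

theorem flagInv_mul_swap (x : ColoredPerm (q + 1) n) {i j : Fin n} (hij : (i : ℕ) + 1 = j)
    (h : x.perm i < x.perm j) (hc : (x.color j).val = q) :
    flagInv (x * ⟨Pi.single i 1, Equiv.swap i j⟩) =
      insert (flagBoxA (x.perm i, x.perm j)) (flagInv x) := by
  have e : rowLen (x * ⟨Pi.single i 1, Equiv.swap i j⟩) = rowLen x := funext fun b => by
    rw [rowLen_mul_swap x hij h, if_neg (by omega)]
  rw [flagInv, e, mul_perm, (invA_mul_swap hij h).2, flagSet_insert]
  rfl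

theorem flagInv_subset_iff {x y : ColoredPerm (q + 1) n} :
    flagInv x ⊆ flagInv y ↔ invA x.perm ⊆ invA y.perm ∧ ∀ b, rowLen x b ≤ rowLen y b :=
  flagSet_subset_iff (isFlagState_rowLen x) (isFlagState_rowLen y)

theorem rowCount_mono {σ τ : Equiv.Perm (Fin n)} (h : invA σ ⊆ invA τ) (b : Fin n) :
    rowCount σ b ≤ rowCount τ b :=
  Set.ncard_le_ncard (fun _ ha => h ha) (Set.toFinite _)

theorem finite_flagInv (x : ColoredPerm (q + 1) n) : (flagInv x).Finite := by
  refine (Set.toFinite _).union ?_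
  refine (Set.finite_iUnion fun b : Fin n =>
    (Set.finite_Iio (rowLen x b)).image (flagBoxB q b)).subset ?_
  rintro _ ⟨b, u, hu, rfl⟩
  exact Set.mem_iUnion.2 ⟨b, u, hu, rfl⟩

theorem FlagCov.peelStep {x y : ColoredPerm (q + 1) n} (h : FlagCov x y) :
    (digraphFlag (q + 1) n).PeelStep (flagInv x) (flagInv y) := by
  rcases h with ⟨i, rfl, hc⟩ | ⟨i, j, hij, rfl, hlt, hc⟩
  · refine ⟨_, ?_, flagInv_mul_color x hc⟩
    have hlen : rowLen x (x.perm i) < (rowCount x.perm (x.perm i) + 1) * q := by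
      rw [rowLen, entryColor_perm, add_mul, one_mul]
      omega
    refine (canPeel_flagBoxB (isFlagState_rowLen x) ?_).2 ⟨rfl, hlen⟩
    have : rowLen x (x.perm i) < ((x.perm i : ℕ) + 1) * q :=
      hlen.trans_le (Nat.mul_le_mul_right q (Nat.succ_le_succ (rowCount_le _ _)))
    exact_mod_cast this
  · refine ⟨_, (canPeel_flagBoxA (isFlagState_rowLen x) hlt).2 ⟨?_, ?_⟩,
      flagInv_mul_swap x hij hlt hc⟩
    · refine (modelA n).canPeel_of_covBy hlt ?_
      simpa [Equiv.Perm.smul_def, covBy_iff_val_add_one] using hij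
    · rw [rowLen, entryColor_perm, hc, add_mul, one_mul]

theorem exists_flagCov_of_peelStep {x : ColoredPerm (q + 1) n} {A : Set (ℤ × ℤ)}
    (h : (digraphFlag (q + 1) n).PeelStep (flagInv x) A) : ∃ y, FlagCov x y ∧ flagInv y = A := by
  obtain ⟨z, hz, rfl⟩ := h
  rcases hz.1 with hz' | hz'
  · obtain ⟨⟨a, b⟩, hab, rfl⟩ := mem_boxesFlagA_iff.1 hz'
    obtain ⟨h1, h2⟩ := (canPeel_flagBoxA (isFlagState_rowLen x) hab).1 hz
    obtain ⟨i, rfl⟩ := x.perm.surjective a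
    obtain ⟨j, rfl⟩ := x.perm.surjective b
    have hij : (i : ℕ) + 1 = j := by
      have := (modelA n).covBy_of_canPeel h1
      simpa [Equiv.Perm.smul_def, covBy_iff_val_add_one] using this
    have hc : (x.color j).val = q := by
      have := zmod_val_le (x.color j)
      rw [rowLen, entryColor_perm, add_mul, one_mul] at h2
      omega
    exact ⟨_, Or.inr ⟨i, j, hij, rfl, hab, hc⟩, flagInv_mul_swap x hij hab hc⟩
  · obtain ⟨b, u, hu, rfl⟩ := mem_boxesFlagB_iff.1 hz'
    obtain ⟨rfl, h2⟩ := (canPeel_flagBoxB (isFlagState_rowLen x) hu).1 hz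
    obtain ⟨i, rfl⟩ := x.perm.surjective b
    have hc : (x.color i).val < q := by
      rw [rowLen, entryColor_perm, add_mul, one_mul] at h2
      omega
    exact ⟨_, Or.inl ⟨i, rfl, hc⟩, flagInv_mul_color x hc⟩

/-- If a row can still grow within its block, increase the color; otherwise an inversion that is
missing can be added at the end of a block. -/
theorem exists_flagCov {x y : ColoredPerm (q + 1) n} (h : flagInv x ⊆ flagInv y) (hne : x ≠ y) :
    ∃ z, FlagCov x z ∧ flagInv z ⊆ flagInv y := by
  obtain ⟨h1, h2⟩ := flagInv_subset_iff.1 h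
  by_cases hb : ∃ b, rowLen x b < rowLen y b ∧ (x.entryColor b).val < q
  · obtain ⟨b, hb1, hb2⟩ := hb
    obtain ⟨i, rfl⟩ := x.perm.surjective b
    rw [entryColor_perm] at hb2
    refine ⟨_, Or.inl ⟨i, rfl, hb2⟩, flagInv_subset_iff.2 ⟨by rwa [mul_perm, mul_one], fun b => ?_⟩⟩
    rw [rowLen_mul_color x hb2]
    have := h2 b
    split_ifs with hb
    · subst hb
      omega
    · omega
  · push Not at hb
    rcases Relation.ReflTransGen.cases_head ((modelA n).reflTransGen_of_subset
      (w := x.perm) (v := y.perm) h1) with hxy | ⟨τ, ⟨s, ⟨i, j, hij, rfl⟩, rfl, c, hc, he⟩, hτ⟩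
    · -- equal permutations: the colors agree as well
      refine absurd (ext_entryColor hxy fun b => ?_) hne
      have e1 := h2 b
      have e2 := hb b
      have e3 := zmod_val_le (y.entryColor b)
      rw [rowLen, rowLen, hxy] at e1 e2
      exact ZMod.val_injective _ (by omega)
    · have hlt : x.perm i < x.perm j := by
        by_contra hge
        have hne' : j ≠ i := fun e => by rw [e] at hij; omega
        have := (modelA n).inv_mul_of_gt (isSimpleAt_swap hij)
          (smul_lt_of_not_lt x.perm hne' hge)
        exact hc (this (he ▸ Set.mem_insert _ _))
      have hsub : invA (x.perm * Equiv.swap i j) ⊆ invA y.perm :=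
        (modelA n).isPeelModel.subset_of_reflTransGen hτ
      have hq : (x.color j).val = q := by
        have e1 := rowCount_mono hsub (x.perm j)
        rw [rowCount_mul_swap hij hlt, if_pos rfl] at e1
        have e2 := Nat.mul_le_mul_right q e1
        have e3 := hb (x.perm j)
        have e4 := zmod_val_le (x.color j)
        rw [rowLen, rowLen, entryColor_perm] at e3
        rw [add_mul, one_mul] at e2
        omega
      refine ⟨_, Or.inr ⟨i, j, hij, rfl, hlt, hq⟩, flagInv_subset_iff.2 ⟨hsub, fun b => ?_⟩⟩
      rw [rowLen_mul_swap x hij hlt, if_neg (by omega)]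
      exact h2 b

theorem reflTransGen_flagCov {x y : ColoredPerm (q + 1) n} (h : flagInv x ⊆ flagInv y) :
    Relation.ReflTransGen FlagCov x y := by
  induction hm : (flagInv y \ flagInv x).ncard using Nat.strong_induction_on generalizing x with
  | _ m ih =>
  by_cases hne : x = y
  · rw [hne]
  obtain ⟨z, hxz, hzy⟩ := exists_flagCov h hne
  refine (ih _ ?_ hzy rfl).head hxz
  obtain ⟨c, hc, he⟩ := hxz.peelStep
  rw [← hm, he]
  refine Set.ncard_lt_ncard ⟨fun d hd => ⟨hd.1, fun h => hd.2 (Or.inr h)⟩, fun h => ?_⟩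
    ((finite_flagInv y).subset Set.sdiff_subset)
  exact (h ⟨hzy (he ▸ Set.mem_insert _ _), hc.2.1⟩).2 (Set.mem_insert _ _)

theorem flagInv_one : flagInv (1 : ColoredPerm (q + 1) n) = ∅ := by
  have h1 : invA (1 : ColoredPerm (q + 1) n).perm = ∅ := (modelA n).inv_one
  have h2 : rowLen (1 : ColoredPerm (q + 1) n) = fun _ => 0 := funext fun b => by
    have : (1 : ColoredPerm (q + 1) n).entryColor b = 0 := rfl
    rw [rowLen, rowCount, h1, this, ZMod.val_zero]
    simp
  rw [flagInv, h1, h2]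
  simp [flagSet]

theorem isPeelModel_digraphFlag (q n : ℕ) :
    (digraphFlag (q + 1) n).IsPeelModel flagInv FlagCov (1 : ColoredPerm (q + 1) n) where
  bot := flagInv_one
  peel _ _ h := h.peelStep
  lift _ _ h := exists_flagCov_of_peelStep h
  chain _ _ h := reflTransGen_flagCov h

/-- Changing the color of a single entry by `1`. -/
theorem sum_entryColor {x y : ColoredPerm (q + 1) n} {b : Fin n}
    (h : ∀ a, y.entryColor a = x.entryColor a + if a = b then 1 else 0) :
    ∑ a, (y.entryColor a).val + (x.entryColor b).val =
      ∑ a, (x.entryColor a).val + (x.entryColor b + 1).val := by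
  have e : ∀ a ∈ Finset.univ.erase b, (y.entryColor a).val = (x.entryColor a).val := fun a ha => by
    rw [h, if_neg (Finset.ne_of_mem_erase ha), add_zero]
  rw [← Finset.add_sum_erase _ _ (Finset.mem_univ b), Finset.sum_congr rfl e,
    ← Finset.add_sum_erase _ (fun a => (x.entryColor a).val) (Finset.mem_univ b), h, if_pos rfl]
  ring

theorem ncard_invA_mul_swap {σ : Equiv.Perm (Fin n)} {i j : Fin n} (hij : (i : ℕ) + 1 = j)
    (h : σ i < σ j) : (invA (σ * Equiv.swap i j)).ncard = (invA σ).ncard + 1 := by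
  obtain ⟨h1, h2⟩ := invA_mul_swap hij h
  rw [h2, Set.ncard_insert_of_notMem h1 (Set.toFinite _)]

theorem finv_mul_color (x : ColoredPerm (q + 1) n) (i : Fin n) :
    (x * ⟨Pi.single i 1, 1⟩).finv + (x.color i).val = x.finv + (x.color i + 1).val := by
  have := sum_entryColor (entryColor_mul_color x i)
  rw [entryColor_perm] at this
  rw [finv_eq_sum_entryColor, finv_eq_sum_entryColor, mul_perm, mul_one]
  omega

theorem finv_mul_swap (x : ColoredPerm (q + 1) n) {i j : Fin n} (hij : (i : ℕ) + 1 = j)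
    (h : x.perm i < x.perm j) :
    (x * ⟨Pi.single i 1, Equiv.swap i j⟩).finv + (x.color j).val =
      x.finv + (q + 1) + (x.color j + 1).val := by
  have := sum_entryColor (entryColor_mul_swap x i j)
  rw [entryColor_perm] at this
  rw [finv_eq_sum_entryColor, finv_eq_sum_entryColor, mul_perm, ncard_invA_mul_swap hij h, mul_add,
    mul_one]
  omega

theorem finv_mul_swap_le (x : ColoredPerm (q + 1) n) {i j : Fin n} (hij : (i : ℕ) + 1 = j)
    (h : x.perm j < x.perm i) : (x * ⟨Pi.single i 1, Equiv.swap i j⟩).finv ≤ x.finv := by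
  have h1 := sum_entryColor (entryColor_mul_swap x i j)
  have h2 : (x.entryColor (x.perm j) + 1).val ≤ (x.entryColor (x.perm j)).val + 1 := by
    rw [zmod_val_add_one]
    split_ifs <;> omega
  have h3 : (invA x.perm).ncard = (invA (x.perm * Equiv.swap i j)).ncard + 1 := by
    rw [← ncard_invA_mul_swap (σ := x.perm * Equiv.swap i j) hij (by simpa using h), mul_assoc,
      Equiv.swap_mul_self, mul_one]
  rw [finv_eq_sum_entryColor, finv_eq_sum_entryColor, mul_perm, h3, mul_add, mul_one]
  dsimp only at h1 ⊢
  omega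

theorem FlagCov.finv_lt {x y : ColoredPerm (q + 1) n} (h : FlagCov x y) :
    (∃ s ∈ flagGens (q + 1) n, y = x * s) ∧ x.finv < y.finv := by
  rcases h with ⟨i, rfl, hc⟩ | ⟨i, j, hij, rfl, hlt, hc⟩
  · refine ⟨⟨_, Or.inr ⟨i, rfl⟩, rfl⟩, ?_⟩
    have := finv_mul_color x i
    rw [zmod_val_add_one, if_neg hc.ne] at this
    omega
  · refine ⟨⟨_, Or.inl ⟨i, j, hij, rfl⟩, rfl⟩, ?_⟩
    have := finv_mul_swap x hij hlt
    omega

theorem flagInv_subset_of_finv_lt {x y s : ColoredPerm (q + 1) n} (hs : s ∈ flagGens (q + 1) n)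
    (hy : y = x * s) (h : x.finv < y.finv) : flagInv x ⊆ flagInv y := by
  subst hy
  rcases hs with ⟨i, j, hij, rfl⟩ | ⟨i, rfl⟩
  · have hlt : x.perm i < x.perm j := by
      by_contra hne
      have hne' : i ≠ j := fun e => by rw [e] at hij; omega
      have := finv_mul_swap_le x hij
        (lt_of_le_of_ne (not_lt.1 hne) fun e => hne' (x.perm.injective e.symm))
      omega
    refine flagInv_subset_iff.2 ⟨?_, fun b => ?_⟩
    · rw [mul_perm, (invA_mul_swap hij hlt).2]
      exact Set.subset_insert _ _
    · rw [rowLen_mul_swap x hij hlt]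
      split_ifs <;> omega
  · have hc : (x.color i).val < q := by
      have h1 := finv_mul_color x i
      rw [zmod_val_add_one] at h1
      have := zmod_val_le (x.color i)
      split_ifs at h1 <;> omega
    rw [flagInv_mul_color x hc]
    exact Set.subset_insert _ _

theorem flagLE_iff {x y : ColoredPerm (q + 1) n} :
    FlagLE x y ↔ Relation.ReflTransGen FlagCov x y := by
  constructor
  · intro h
    apply reflTransGen_flagCov
    induction h with
    | refl => exact subset_rfl
    | tail _ hs ih =>
      obtain ⟨⟨s, hs, hy⟩, hlt⟩ := hs
      exact ih.trans (flagInv_subset_of_finv_lt hs hy hlt)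
  · exact fun h => Relation.ReflTransGen.mono (fun _ _ h => h.finv_lt) _ _ h

end

theorem mainTheorem3 :
    -- the weak order on the symmetric group `Aₙ₋₁ = Sₙ`
    (∀ n : ℕ, (digraphA n).IS = Set.range (invA (n := n)) ∧
      ∃ e : WeakLE (simpleA n) ≃r (digraphA n).isLE,
        ∀ σ, (e σ : Set (Fin n × Fin n)) = invA σ) ∧
    -- the weak order on `Bₙ`
    (∀ n : ℕ, (digraphB n).IS = Set.range (invB (n := n)) ∧
      ∃ e : WeakLE (simpleB n) ≃r (digraphB n).isLE,
        ∀ ω, (e ω : Set (SignedIdx n × SignedIdx n)) = invB ω) ∧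
    -- the weak order on `Ãₙ`
    (∀ n : ℕ, 3 ≤ n → (digraphCyl n).IS = Set.range (invAffine (n := n)) ∧
      ∃ e : WeakLE (simpleAffine n) ≃r (digraphCyl n).isLE,
        ∀ σ, (e σ : Set (ℤ × ℤ)) = invAffine σ) ∧
    -- the flag weak order on `ℤᵣ ≀ Sₙ`
    (∀ r n : ℕ, 1 ≤ r →
      Nonempty ((ColoredPerm.FlagLE (r := r) (n := n)) ≃r (digraphFlag r n).isLE)) ∧
    -- the down-set and up-set lattices of a finite poset, ordered by inclusion
    (∀ (P : Type*) [PartialOrder P] [Finite P],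
      Nonempty ((fun A B : {A : Set P // IsLowerSet A} => (A : Set P) ⊆ B) ≃r
        (digraphDown P).isLE) ∧
      Nonempty ((fun A B : {A : Set P // IsUpperSet A} => (A : Set P) ⊆ B) ≃r
        (digraphUp P).isLE)) := by
  refine ⟨fun n => ?_, fun n => ?_, fun n hn => ?_, fun r n hr => ?_, fun P _ _ => ⟨?_, ?_⟩⟩
  · exact (modelA n).IS_eq_range_and_exists_relIso
  · rw [← inv_modelB]
    exact (modelB n).IS_eq_range_and_exists_relIso
  · rw [← inv_modelAffine n hn]
    exact (modelAffine n hn).IS_eq_range_and_exists_relIso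
  · obtain ⟨q, rfl⟩ : ∃ q, r = q + 1 := ⟨r - 1, by omega⟩
    exact ⟨((isPeelModel_digraphFlag q n).exists_relIso fun _ _ => flagLE_iff).choose⟩
  · exact nonempty_relIso_of_isPeelModel (isPeelModel_digraphDown P)
  · exact nonempty_relIso_of_isPeelModel (isPeelModel_digraphUp P)
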